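/- **Setting.** Let $Q$ be a finite quiver with vertex set $I$, and let $\overline{Q}$ be its double, obtained by adding an arrow $a^*:h(a)\to t(a)$ for each arrow $a:t(a)\to h(a)$ of $Q$. Put $(a^*)^*=a$, $\epsilon(a)=1$ and $\epsilon(a^*)=-1$ for $a\in Q$. Fix a total order on the set of arrows of $\overline{Q}$ and put $o(a,b)=1$ if $a<b$, $-1$ if $b<a$, $0$ if $a=b$. Fix $\gamma_a\in\mathbb{C}$ for $a\in Q$, and put $\gamma_{a^*}=\gamma_a$. Paths are written from left to right, so that $a=e_{t(a)}\,a\,e_{h(a)}$ in the path algebra $\mathbb{C}\overline{Q}$, where $e_s$ ($s\in I$) are the vertex idempotents. Let $A_Q$ be the algebra obtained from $\mathbb{C}\overline{Q}$ by adjoining inverses of the elements $\gamma_a+aa^*$, $a\in\overline{Q}$. (The inverse is taken in the corner algebra with unit $e_{t(a)}$, i.e. one inverts $(1-e_{t(a)})+\gamma_a e_{t(a)}+aa^*$; if $\gamma_a\neq 0$ this is the same as inverting $\gamma_a1+aa^*$.) Let $H_0(A_Q)=A_Q/[A_Q,A_Q]$, where $[A_Q,A_Q]$ is the span of the commutators,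 and let $\operatorname{tr}:A_Q\to H_0(A_Q)\subset \operatorname{Sym}(H_0(A_Q))$ be the projection. An *outer* (resp. *right*) *double bracket* on an algebra $A$ is a bilinear map $⟦-,-⟧:A\times A\to A\otimes A$ with $⟦f,g⟧=-\tau_{(12)}⟦g,f⟧$, where $\tau_{(12)}$ exchanges the two factors, and with $$⟦f,gh⟧=(g\otimes1)⟦f,h⟧+⟦f,g⟧(1\otimes h),\quad ⟦fg,h⟧=(1\otimes f)⟦g,h⟧+⟦f,h⟧(g\otimes1)$$ in the outer case, and $$⟦f,gh⟧=(1\otimes g)⟦f,h⟧+⟦f,g⟧(1\otimes h),\quad ⟦fg,h⟧=(f\otimes1)⟦g,h⟧+⟦f,h⟧(g\otimes1)$$ in the right case. On $A_Q$ it is called $B$-linear if it vanishes as soon as one argument is some $e_s$. For a dimension vector $n=(n_s)\in\mathbb{Z}_{\ge0}^I$, let $M^\gamma_{\overline{Q}}$ be the variety of tuples $\mathtt{X}=(\mathtt{X}_a)_{a\in\overline{Q}}$ of matrices $\mathtt{X}_a\in\operatorname{Mat}_{n_{t(a)}\times n_{h(a)}}(\mathbb{C})$ such that every $\gamma_a\operatorname{Id}_{n_{t(a)}}+\mathtt{X}_a\mathtt{X}_{a^*}$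 is invertible, with the action $g\cdot\mathtt{X}=(g_{t(a)}\mathtt{X}_ag_{h(a)}^{-1})_a$ of $\operatorname{GL}_n=\prod_s\operatorname{GL}_{n_s}(\mathbb{C})$. Let $\mathbb{C}[M^\gamma_{\overline{Q}}/\!/\operatorname{GL}_n]$ be the algebra of invariant regular functions on $M^\gamma_{\overline{Q}}$. Let $\partial_a$ be the matrix of vector fields $(\partial_a)_{ij}=\partial/\partial(\mathtt{X}_a)_{ji}$, and for $z=(z_{ab})$, $z_{ab}\in\mathbb{C}$ ($a,b\in Q$, $a<b$), put $$P^\gamma=\tfrac12\sum_{a\in\overline{Q}}\epsilon(a)\operatorname{tr}\big[(\gamma_a\operatorname{Id}+\mathtt{X}_{a^*}\mathtt{X}_a)\,\partial_a\wedge\partial_{a^*}\big]-\tfrac12\sum_{a<b,\;a,b\in\overline{Q}}\operatorname{tr}\big[(\partial_{a^*}\mathtt{X}_{a^*}-\mathtt{X}_a\partial_a)\wedge(\partial_{b^*}\mathtt{X}_{b^*}-\mathtt{X}_b\partial_b)\big],$$ $$\psi_z=\sum_{a<b,\;a,b\in Q}z_{ab}\operatorname{tr}[\mathtt{X}_{a^*}\partial_{a^*}-\mathtt{X}_a\partial_a]\wedge\operatorname{tr}[\mathtt{X}_{b^*}\partial_{b^*}-\mathtt{X}_b\partial_b],$$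 where $V\wedge W=V\otimes W-W\otimes V$ and a bivector $R$ defines the bracket $\{f,g\}=\langle R,\mathrm{d}f\otimes\mathrm{d}g\rangle$. Let $\mathtt{X}_{\operatorname{tr}}:\operatorname{Sym}(H_0(A_Q))\to\mathbb{C}[M^\gamma_{\overline{Q}}/\!/\operatorname{GL}_n]$ be the algebra morphism sending $\operatorname{tr}(f)$ to the function $\mathtt{X}\mapsto\operatorname{tr}(\rho_{\mathtt{X}}(f))$, where $\rho_{\mathtt{X}}$ is the representation of $A_Q$ on $\bigoplus_s\mathbb{C}^{n_s}$ defined by $\mathtt{X}$; thus $\operatorname{tr}(a_1\cdots a_k)\mapsto\operatorname{tr}(\mathtt{X}_{a_1}\cdots\mathtt{X}_{a_k})$ for arrows $a_1,\dots,a_k$ of $\overline{Q}$. **Theorem.** 1. There is a unique $B$-linear outer double bracket on $A_Q$ such that for all $a,b\in\overline{Q}$ $$\begin{aligned}⟦a,b⟧_o={}&\epsilon(a)\,\delta_{(b=a^*)}\big[\gamma_a e_{h(a)}\otimes e_{t(a)}+\tfrac12\,ba\otimes e_{t(a)}+\tfrac12\,e_{h(a)}\otimes ab\big]\\&-\tfrac12o(a,b)\,e_{t(b)}a\otimes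 e_{t(a)}b-\tfrac12o(a^*,b^*)\,be_{h(a)}\otimes ae_{h(b)}\\&+\tfrac12o(a,b^*)\,ba\otimes e_{t(a)}+\tfrac12o(a^*,b)\,e_{h(a)}\otimes ab,\end{aligned}$$ and there is a unique Poisson bracket $\{-,-\}_{\mathrm{VdB}}$ on $\operatorname{Sym}(H_0(A_Q))$ with $\{\operatorname{tr}f,\operatorname{tr}g\}_{\mathrm{VdB}}=\operatorname{tr}(\mathrm{m}⟦f,g⟧_o)$ for $f,g\in A_Q$, where $\mathrm{m}$ is the multiplication of $A_Q$. 2. Let $z_{ab}\in\mathbb{C}$ for $a,b\in Q$ with $a<b$ be given; extend these constants to $\overline{Q}$ by $z_{aa}=0$, $z_{ab}=-z_{ba}$ if $b<a$, and $z_{a^*b}=z_{ab^*}=z_{a^*b^*}=z_{ab}$ ($a,b\in Q$). There is a unique $B$-linear right double bracket on $A_Q$ with $⟦a,b⟧_r=\epsilon(a)\epsilon(b)z_{ab}\,a\otimes b$ for $a,b\in\overline{Q}$, and there is a unique Poisson bracket $\{-,-\}_z$ on $\operatorname{Sym}(H_0(A_Q))$ with $\{\operatorname{tr}f,\operatorname{tr}g\}_z=(\operatorname{tr}\otimes\operatorname{tr})⟦f,g⟧_r\in\operatorname{Sym}^2(H_0(A_Q))$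 for $f,g\in A_Q$. 3. For all $z_0\in\mathbb{C}$ and all $z$, the bracket $z_0\{-,-\}_{\mathrm{VdB}}+\{-,-\}_z$ is a Poisson bracket on $\operatorname{Sym}(H_0(A_Q))$. For every dimension vector $n$, the bivector $z_0P^\gamma+\psi_z$ defines a Poisson bracket on $\mathbb{C}[M^\gamma_{\overline{Q}}/\!/\operatorname{GL}_n]$, and $\mathtt{X}_{\operatorname{tr}}$ is a morphism of Poisson algebras from $\big(\operatorname{Sym}(H_0(A_Q)),\,z_0\{-,-\}_{\mathrm{VdB}}+\{-,-\}_z\big)$ to $\big(\mathbb{C}[M^\gamma_{\overline{Q}}/\!/\operatorname{GL}_n],\,z_0P^\gamma+\psi_z\big)$. -/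

import Mathlib

open scoped TensorProduct

/-! ### Quivers and their doubles -/

/-- A quiver with vertex set `I`, arrow set `E`, tail map and head map; an arrow `a` goes
`tail a ⟶ head a`. -/
structure FinQuiver (I E : Type*) where
  tail : E → I
  head : E → I

/-- The arrows of the double of a quiver with arrow set `E`: `fwd a` is the arrow `a` itself,
`rev a` is the added opposite arrow `a*`. -/
inductive DArrow (E : Type*) where
  | fwd (a : E) : DArrow E
  | rev (a : E) : DArrow E

namespace DArrow

variable {E : Type*}

/-- The involution `a ↦ a*`. -/
def star : DArrow E → DArrow E
  | fwd a => rev a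
  | rev a => fwd a

/-- The original arrow underlying `a` or `a*`. -/
def base : DArrow E → E
  | fwd a => a
  | rev a => a

/-- The orientation map: `1` on original arrows, `-1` on added arrows. -/
def sign : DArrow E → ℂ
  | fwd _ => 1
  | rev _ => -1

/-- The arrows of the double are the disjoint union of two copies of the arrows. -/
def sumEquiv : E ⊕ E ≃ DArrow E where
  toFun := Sum.elim fwd rev
  invFun
    | fwd a => Sum.inl a
    | rev a => Sum.inr a
  left_inv := by rintro (a | a) <;> rfl
  right_inv := by rintro (a | a) <;> rfl

instance instFintype [Fintype E] : Fintype (DArrow E) := Fintype.ofEquiv _ sumEquiv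

/-- `o(a,b)` is `1` if `a < b`, `-1` if `b < a`, and `0` if `a = b`. -/
def ord [LinearOrder (DArrow E)] (a b : DArrow E) : ℂ :=
  if a < b then 1 else if b < a then -1 else 0

/-- The skew-symmetric extension to the double, invariant under `a ↦ a*` in each index, of the
constants `z a b` given for original arrows `a < b` (the other values of `z` are not used). -/
def skewExt [LinearOrder (DArrow E)] (z : E → E → ℂ) (a b : DArrow E) : ℂ :=
  if fwd a.base < fwd b.base then z a.base b.base
  else if fwd b.base < fwd a.base then -z b.base a.base
  else 0

end DArrow

namespace FinQuiver

variable {I E : Type*}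

/-- Tails in the double quiver. -/
def dtail (Q : FinQuiver I E) : DArrow E → I
  | .fwd a => Q.tail a
  | .rev a => Q.head a

/-- Heads in the double quiver. -/
def dhead (Q : FinQuiver I E) (a : DArrow E) : I := Q.dtail a.star

end FinQuiver

/-! ### The localised path algebra -/

/-- Generators: the idempotents `e_s`, the arrows of the double, and formal inverses. -/
inductive PathGen (I E : Type*) where
  | vert (s : I) : PathGen I E
  | arr (a : DArrow E) : PathGen I E
  | inv (a : DArrow E) : PathGen I E

namespace PathGen

variable {I E : Type*}

/-- The generator `e_s` of the free algebra. -/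
noncomputable def fe (s : I) : FreeAlgebra ℂ (PathGen I E) := FreeAlgebra.ι ℂ (vert s)

/-- The generator `a` of the free algebra. -/
noncomputable def fa (a : DArrow E) : FreeAlgebra ℂ (PathGen I E) := FreeAlgebra.ι ℂ (arr a)

/-- The formal inverse attached to `a`, in the free algebra. -/
noncomputable def fw (a : DArrow E) : FreeAlgebra ℂ (PathGen I E) := FreeAlgebra.ι ℂ (inv a)

/-- The element to be inverted: `γ_a e + a a*` with `e = e_{t(a)}`, completed by `1 - e`. An
inverse of it is the same as an inverse of `γ_a e + a a*` in the corner algebra with unit `e`; if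
`γ_a ≠ 0`, it is also the same as an inverse of `γ_a 1 + a a*`. -/
noncomputable def fs (Q : FinQuiver I E) (γ : E → ℂ) (a : DArrow E) :
    FreeAlgebra ℂ (PathGen I E) :=
  1 - fe (Q.dtail a) + γ a.base • fe (Q.dtail a) + fa a * fa a.star

end PathGen

open PathGen in
/-- The relations of the path algebra of the double quiver (paths are read from left to right),
together with those that make each `fw a` the inverse of `fs a`. -/
inductive AQRel {I E : Type*} [Fintype I] (Q : FinQuiver I E) (γ : E → ℂ) :
    FreeAlgebra ℂ (PathGen I E) → FreeAlgebra ℂ (PathGen I E) → Prop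
  | idem (s : I) : AQRel Q γ (fe s * fe s) (fe s)
  | orth (r s : I) (h : r ≠ s) : AQRel Q γ (fe r * fe s) 0
  | complete : AQRel Q γ (∑ s, fe s) 1
  | arrow (a : DArrow E) : AQRel Q γ (fa a) (fe (Q.dtail a) * fa a * fe (Q.dhead a))
  | inv_mul (a : DArrow E) : AQRel Q γ (fw a * fs Q γ a) 1
  | mul_inv (a : DArrow E) : AQRel Q γ (fs Q γ a * fw a) 1

/-- The algebra `A_Q`: the path algebra of the double quiver, localised at the elements
`γ_a + a a*`. -/
abbrev AQ {I E : Type*} [Fintype I] (Q : FinQuiver I E) (γ : E → ℂ) : Type _ :=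
  RingQuot (AQRel Q γ)

namespace AQ

variable {I E : Type*} [Fintype I] (Q : FinQuiver I E) (γ : E → ℂ)

/-- The idempotent `e_s` in `A_Q`. -/
noncomputable def e (s : I) : AQ Q γ := RingQuot.mkAlgHom ℂ (AQRel Q γ) (PathGen.fe s)

/-- The arrow `a` in `A_Q`. -/
noncomputable def arr (a : DArrow E) : AQ Q γ := RingQuot.mkAlgHom ℂ (AQRel Q γ) (PathGen.fa a)

end AQ

/-! ### Double brackets and Poisson brackets -/

section Brackets

variable {A : Type*} [Ring A] [Algebra ℂ A]

/-- Outer double brackets on `A`. -/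
structure IsOuterDoubleBracket (D : A →ₗ[ℂ] A →ₗ[ℂ] A ⊗[ℂ] A) : Prop where
  skew : ∀ f g, D f g = -TensorProduct.comm ℂ A A (D g f)
  der_right : ∀ f g h, D f (g * h) = (g ⊗ₜ[ℂ] 1) * D f h + D f g * (1 ⊗ₜ[ℂ] h)
  der_left : ∀ f g h, D (f * g) h = (1 ⊗ₜ[ℂ] f) * D g h + D f h * (g ⊗ₜ[ℂ] 1)

/-- Right double brackets on `A`. -/
structure IsRightDoubleBracket (D : A →ₗ[ℂ] A →ₗ[ℂ] A ⊗[ℂ] A) : Prop where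
  skew : ∀ f g, D f g = -TensorProduct.comm ℂ A A (D g f)
  der_right : ∀ f g h, D f (g * h) = (1 ⊗ₜ[ℂ] g) * D f h + D f g * (1 ⊗ₜ[ℂ] h)
  der_left : ∀ f g h, D (f * g) h = (f ⊗ₜ[ℂ] 1) * D g h + D f h * (g ⊗ₜ[ℂ] 1)

variable (A) in
/-- The subspace `[A, A]` spanned by commutators. -/
def commutatorSpan : Submodule ℂ A := Submodule.span ℂ {x | ∃ f g : A, x = f * g - g * f}

variable (A) in
/-- `H_0(A) = A / [A, A]`. -/
abbrev HZero : Type _ := A ⧸ commutatorSpan A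

/-- The projection `tr : A → H_0(A)`, followed by the inclusion of `H_0(A)` in its symmetric
algebra. -/
noncomputable def symTr : A →ₗ[ℂ] SymmetricAlgebra ℂ (HZero A) :=
  SymmetricAlgebra.ι ℂ (HZero A) ∘ₗ (commutatorSpan A).mkQ

/-- Poisson brackets on a commutative algebra. -/
structure IsPoissonBracket {R : Type*} [CommRing R] [Algebra ℂ R]
    (b : R →ₗ[ℂ] R →ₗ[ℂ] R) : Prop where
  skew : ∀ f g, b f g = -b g f
  leibniz : ∀ f g h, b f (g * h) = b f g * h + g * b f h
  jacobi : ∀ f g h, b f (b g h) + b g (b h f) + b h (b f g) = 0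

/-- The condition `{tr f, tr g} = tr (m (D f g))`, with `m` the multiplication of `A`. -/
def IsInducedByOuter (D : A →ₗ[ℂ] A →ₗ[ℂ] A ⊗[ℂ] A)
    (b : SymmetricAlgebra ℂ (HZero A) →ₗ[ℂ] SymmetricAlgebra ℂ (HZero A) →ₗ[ℂ]
      SymmetricAlgebra ℂ (HZero A)) : Prop :=
  ∀ f g : A, b (symTr f) (symTr g) = symTr (LinearMap.mul' ℂ A (D f g))

/-- The condition `{tr f, tr g} = (tr ⊗ tr) (D f g)`, where `tr x ⊗ tr y` is read as the product
of `tr x` and `tr y` in the symmetric algebra. -/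
def IsInducedByRight (D : A →ₗ[ℂ] A →ₗ[ℂ] A ⊗[ℂ] A)
    (b : SymmetricAlgebra ℂ (HZero A) →ₗ[ℂ] SymmetricAlgebra ℂ (HZero A) →ₗ[ℂ]
      SymmetricAlgebra ℂ (HZero A)) : Prop :=
  ∀ f g : A, b (symTr f) (symTr g) =
    LinearMap.mul' ℂ (SymmetricAlgebra ℂ (HZero A)) (TensorProduct.map symTr symTr (D f g))

end Brackets

section QuiverBrackets

variable {I E : Type*} [Fintype I] [LinearOrder (DArrow E)] (Q : FinQuiver I E) (γ : E → ℂ)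

open AQ in
/-- The value on a pair of arrows of Van den Bergh's outer double bracket. -/
noncomputable def outerValue (a b : DArrow E) : AQ Q γ ⊗[ℂ] AQ Q γ :=
  (if b = a.star then
    a.sign • (γ a.base • (e Q γ (Q.dhead a) ⊗ₜ[ℂ] e Q γ (Q.dtail a))
      + (1 / 2 : ℂ) • ((arr Q γ b * arr Q γ a) ⊗ₜ[ℂ] e Q γ (Q.dtail a))
      + (1 / 2 : ℂ) • (e Q γ (Q.dhead a) ⊗ₜ[ℂ] (arr Q γ a * arr Q γ b)))
    else 0)
  - ((1 / 2 : ℂ) * a.ord b) •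
      ((e Q γ (Q.dtail b) * arr Q γ a) ⊗ₜ[ℂ] (e Q γ (Q.dtail a) * arr Q γ b))
  - ((1 / 2 : ℂ) * a.star.ord b.star) •
      ((arr Q γ b * e Q γ (Q.dhead a)) ⊗ₜ[ℂ] (arr Q γ a * e Q γ (Q.dhead b)))
  + ((1 / 2 : ℂ) * a.ord b.star) • ((arr Q γ b * arr Q γ a) ⊗ₜ[ℂ] e Q γ (Q.dtail a))
  + ((1 / 2 : ℂ) * a.star.ord b) • (e Q γ (Q.dhead a) ⊗ₜ[ℂ] (arr Q γ a * arr Q γ b))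

/-- `D` is the outer double bracket of Van den Bergh: an outer double bracket which is linear over
the span of the idempotents and has the prescribed values on arrows. -/
structure IsVdBOuter (D : AQ Q γ →ₗ[ℂ] AQ Q γ →ₗ[ℂ] AQ Q γ ⊗[ℂ] AQ Q γ) : Prop where
  outer : IsOuterDoubleBracket D
  vert : ∀ f s, D f (AQ.e Q γ s) = 0
  value : ∀ a b, D (AQ.arr Q γ a) (AQ.arr Q γ b) = outerValue Q γ a b

/-- `D` is a right double bracket which is linear over the span of the idempotents and has the
values `ε(a) ε(b) z_{ab} a ⊗ b` on arrows. -/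
structure IsQuiverRight (z : E → E → ℂ)
    (D : AQ Q γ →ₗ[ℂ] AQ Q γ →ₗ[ℂ] AQ Q γ ⊗[ℂ] AQ Q γ) : Prop where
  right : IsRightDoubleBracket D
  vert : ∀ f s, D f (AQ.e Q γ s) = 0
  value : ∀ a b, D (AQ.arr Q γ a) (AQ.arr Q γ b) =
    (a.sign * b.sign * DArrow.skewExt z a b) • (AQ.arr Q γ a ⊗ₜ[ℂ] AQ.arr Q γ b)

end QuiverBrackets

/-! ### The representation space -/

/-- Indices of the standard basis of `⨁ s, ℂ ^ (n s)`. -/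
abbrev DimIdx {I : Type*} (n : I → ℕ) : Type _ := Σ s : I, Fin (n s)

section RepSpace

variable {I E : Type*} [Fintype I] [DecidableEq I] (n : I → ℕ)

/-- The projection on the summand of the vertex `s`. -/
def vertexProj (R : Type*) [Zero R] [One R] (s : I) : Matrix (DimIdx n) (DimIdx n) R :=
  Matrix.diagonal fun i => if i.1 = s then 1 else 0

variable (Q : FinQuiver I E) (γ : E → ℂ)

/-- The matrix `γ_a Id + X_a X_{a*}` on the summand of `t(a)`, completed by the identity on the
other summands. -/
def locMat {R : Type*} [CommRing R] [Algebra ℂ R]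
    (X : DArrow E → Matrix (DimIdx n) (DimIdx n) R) (a : DArrow E) :
    Matrix (DimIdx n) (DimIdx n) R :=
  1 - vertexProj n R (Q.dtail a) + γ a.base • vertexProj n R (Q.dtail a) + X a * X a.star

/-- The open representation space `M^γ` of dimension `n`: matrices `X_a` whose only nonzero block
is the one of size `n_{t(a)} × n_{h(a)}`, such that all `γ_a Id + X_a X_{a*}` are invertible. -/
def repSpace : Set (DArrow E → Matrix (DimIdx n) (DimIdx n) ℂ) :=
  {X | (∀ a, X a = vertexProj n ℂ (Q.dtail a) * X a * vertexProj n ℂ (Q.dhead a)) ∧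
    ∀ a, (locMat n Q γ X a).det ≠ 0}

/-- The coordinate ring `ℂ[M^γ]`, as the algebra of functions on points generated by the matrix
entries and the inverses of the determinants. -/
noncomputable def coordRing : Subalgebra ℂ (repSpace n Q γ → ℂ) :=
  Algebra.adjoin ℂ
    ({f | ∃ a i j, f = fun X => X.1 a i j} ∪
      {f | ∃ a, f = fun X => ((locMat n Q γ X.1 a).det)⁻¹})

/-- The block diagonal matrix of `g` in `∏ s, GL (n s)`. -/
def glMat (g : ∀ s, GL (Fin (n s)) ℂ) : Matrix (DimIdx n) (DimIdx n) ℂ :=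
  Matrix.blockDiagonal' fun s => (g s : Matrix (Fin (n s)) (Fin (n s)) ℂ)

section Action

variable {n} {Q γ}

theorem glMat_mul_inv (g : ∀ s, GL (Fin (n s)) ℂ) : glMat n g * glMat n g⁻¹ = 1 := by
  unfold glMat
  rw [← Matrix.blockDiagonal'_mul, ← Matrix.blockDiagonal'_one]
  congr 1
  funext s
  simp

theorem glMat_inv_mul (g : ∀ s, GL (Fin (n s)) ℂ) : glMat n g⁻¹ * glMat n g = 1 := by
  simpa using glMat_mul_inv g⁻¹

theorem glMat_comm_vertexProj (g : ∀ s, GL (Fin (n s)) ℂ) (s : I) :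
    glMat n g * vertexProj n ℂ s = vertexProj n ℂ s * glMat n g := by
  ext ⟨i, i'⟩ ⟨j, j'⟩
  simp only [vertexProj, Matrix.mul_diagonal, Matrix.diagonal_mul, glMat]
  by_cases h : i = j
  · subst h
    ring
  · rw [Matrix.blockDiagonal'_apply_ne _ _ _ h]
    simp

/-- Conjugation of all matrices by a block diagonal matrix. -/
def conjAll (g : ∀ s, GL (Fin (n s)) ℂ) (X : DArrow E → Matrix (DimIdx n) (DimIdx n) ℂ) :
    DArrow E → Matrix (DimIdx n) (DimIdx n) ℂ :=
  fun a => glMat n g * X a * glMat n g⁻¹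

theorem locMat_conjAll (g : ∀ s, GL (Fin (n s)) ℂ)
    (X : DArrow E → Matrix (DimIdx n) (DimIdx n) ℂ) (a : DArrow E) :
    locMat n Q γ (conjAll g X) a = glMat n g * locMat n Q γ X a * glMat n g⁻¹ := by
  have h1 := glMat_mul_inv g
  have h2 := glMat_inv_mul g
  have h3 := glMat_comm_vertexProj g (Q.dtail a)
  have h4 : glMat n g * vertexProj n ℂ (Q.dtail a) * glMat n g⁻¹ =
      vertexProj n ℂ (Q.dtail a) := by
    rw [h3, mul_assoc, h1, mul_one]
  have h5 : conjAll g X a * conjAll g X a.star = glMat n g * (X a * X a.star) * glMat n g⁻¹ := by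
    unfold conjAll
    calc _ = glMat n g * X a * (glMat n g⁻¹ * glMat n g) * X a.star * glMat n g⁻¹ := by
          simp only [mul_assoc]
      _ = _ := by rw [h2]; simp only [mul_assoc, one_mul]
  unfold locMat
  rw [h5]
  simp only [mul_add, add_mul, mul_sub, sub_mul, mul_one, h1, h4, Matrix.mul_smul,
    Matrix.smul_mul]

theorem conjAll_mem (g : ∀ s, GL (Fin (n s)) ℂ)
    {X : DArrow E → Matrix (DimIdx n) (DimIdx n) ℂ} (hX : X ∈ repSpace n Q γ) :
    conjAll g X ∈ repSpace n Q γ := by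
  refine ⟨fun a => ?_, fun a => ?_⟩
  · have h3 := glMat_comm_vertexProj g (Q.dtail a)
    have h4 := glMat_comm_vertexProj g⁻¹ (Q.dhead a)
    unfold conjAll
    conv_lhs => rw [hX.1 a]
    calc _ = (glMat n g * vertexProj n ℂ (Q.dtail a)) * X a *
          (vertexProj n ℂ (Q.dhead a) * glMat n g⁻¹) := by simp only [mul_assoc]
      _ = _ := by rw [h3, ← h4]; simp only [mul_assoc]
  · rw [locMat_conjAll, Matrix.det_mul, Matrix.det_mul, mul_right_comm, ← Matrix.det_mul,
      glMat_mul_inv, Matrix.det_one, one_mul]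
    exact hX.2 a

/-- The action of `∏ s, GL (n s)` on `M^γ`: `X_a` is sent to `g_{t(a)} X_a g_{h(a)}⁻¹`. -/
def act (g : ∀ s, GL (Fin (n s)) ℂ) (X : repSpace n Q γ) : repSpace n Q γ :=
  ⟨conjAll g X.1, conjAll_mem g X.2⟩

end Action

/-- The ring `ℂ[M^γ // GL_n]` of invariant regular functions. -/
noncomputable def invRing : Subalgebra ℂ (repSpace n Q γ → ℂ) where
  carrier := {f | f ∈ coordRing n Q γ ∧ ∀ g X, f (act g X) = f X}
  mul_mem' := fun hf hg => ⟨mul_mem hf.1 hg.1, fun g X => by simp [hf.2, hg.2]⟩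
  add_mem' := fun hf hg => ⟨add_mem hf.1 hg.1, fun g X => by simp [hf.2, hg.2]⟩
  algebraMap_mem' := fun c => ⟨Subalgebra.algebraMap_mem _ c, fun _ _ => rfl⟩

/-! ### The trace map -/

/-- The universal matrix `X_a`, with entries in `ℂ[M^γ]`. -/
noncomputable def univMat (a : DArrow E) :
    Matrix (DimIdx n) (DimIdx n) (coordRing n Q γ) :=
  fun i j => ⟨fun X => X.1 a i j, Algebra.subset_adjoin (Or.inl ⟨a, i, j, rfl⟩)⟩

/-- Evaluation of regular functions at a point. -/
noncomputable def evalAt (X : repSpace n Q γ) : coordRing n Q γ →ₐ[ℂ] ℂ :=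
  (Pi.evalAlgHom ℂ (fun _ => ℂ) X).comp (coordRing n Q γ).val

variable {n Q γ}

theorem evalAt_ext {f g : coordRing n Q γ} (h : ∀ X, evalAt n Q γ X f = evalAt n Q γ X g) :
    f = g :=
  Subtype.ext (funext h)

theorem map_vertexProj {R S : Type*} [CommRing R] [CommRing S] [Algebra ℂ R] [Algebra ℂ S]
    (φ : R →ₐ[ℂ] S) (s : I) : φ.mapMatrix (vertexProj n R s) = vertexProj n S s := by
  ext i j
  simp only [vertexProj, AlgHom.mapMatrix_apply, Matrix.map_apply, Matrix.diagonal_apply]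
  split_ifs <;> simp

theorem map_univMat (X : repSpace n Q γ) (a : DArrow E) :
    (evalAt n Q γ X).mapMatrix (univMat n Q γ a) = X.1 a := rfl

theorem map_locMat (X : repSpace n Q γ) (a : DArrow E) :
    (evalAt n Q γ X).mapMatrix (locMat n Q γ (univMat n Q γ) a) = locMat n Q γ X.1 a := by
  simp only [locMat, map_add, map_sub, map_one, map_smul, map_mul, map_vertexProj, map_univMat]

theorem matrix_evalAt_ext {M N : Matrix (DimIdx n) (DimIdx n) (coordRing n Q γ)}
    (h : ∀ X, (evalAt n Q γ X).mapMatrix M = (evalAt n Q γ X).mapMatrix N) : M = N := by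
  ext1 i j
  exact evalAt_ext fun X => congrFun (congrFun (h X) i) j

theorem isUnit_det_locMat (a : DArrow E) :
    IsUnit (locMat n Q γ (univMat n Q γ) a).det := by
  refine IsUnit.of_mul_eq_one
    ⟨fun X => ((locMat n Q γ X.1 a).det)⁻¹, Algebra.subset_adjoin (Or.inr ⟨a, rfl⟩)⟩ ?_
  refine evalAt_ext fun X => ?_
  rw [map_mul, AlgHom.map_det, map_locMat, map_one]
  exact mul_inv_cancel₀ (X.2.2 a)

theorem vertexProj_mul_vertexProj (R : Type*) [CommRing R] (r s : I) :
    vertexProj n R r * vertexProj n R s = if r = s then vertexProj n R s else 0 := by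
  unfold vertexProj
  rw [Matrix.diagonal_mul_diagonal]
  split_ifs with h
  · subst h
    congr 1
    funext i
    split_ifs <;> simp
  · ext i j
    by_cases hij : i = j
    · subst hij
      by_cases h1 : i.1 = r
      · have h2 : ¬ i.1 = s := fun h2 => h (h1.symm.trans h2)
        simp [h2]
      · simp [h1]
    · simp [hij]

theorem sum_vertexProj (R : Type*) [CommRing R] : ∑ s, vertexProj n R s = 1 := by
  ext i j
  rw [Matrix.sum_apply]
  by_cases hij : i = j
  · subst hij
    simp [vertexProj]
  · simp [vertexProj, hij]

variable (n Q γ)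

/-- The universal representation on the free algebra. -/
noncomputable def freeRep :
    FreeAlgebra ℂ (PathGen I E) →ₐ[ℂ] Matrix (DimIdx n) (DimIdx n) (coordRing n Q γ) :=
  FreeAlgebra.lift ℂ fun
    | .vert s => vertexProj n _ s
    | .arr a => univMat n Q γ a
    | .inv a => (locMat n Q γ (univMat n Q γ) a)⁻¹

theorem freeRep_rel {x y : FreeAlgebra ℂ (PathGen I E)} (h : AQRel Q γ x y) :
    freeRep n Q γ x = freeRep n Q γ y := by
  have hv : ∀ s, freeRep n Q γ (PathGen.fe s) = vertexProj n _ s := fun s => by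
    simp [freeRep, PathGen.fe]
  have ha : ∀ a, freeRep n Q γ (PathGen.fa a) = univMat n Q γ a := fun a => by
    simp [freeRep, PathGen.fa]
  have hw : ∀ a, freeRep n Q γ (PathGen.fw a) = (locMat n Q γ (univMat n Q γ) a)⁻¹ :=
    fun a => by simp [freeRep, PathGen.fw]
  have hs : ∀ a, freeRep n Q γ (PathGen.fs Q γ a) = locMat n Q γ (univMat n Q γ) a :=
    fun a => by simp only [PathGen.fs, locMat, map_add, map_sub, map_one, map_smul, map_mul, hv, ha]
  cases h with
  | idem s => simp only [map_mul, hv, vertexProj_mul_vertexProj, if_true]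
  | orth r s h => simp only [map_mul, hv, vertexProj_mul_vertexProj, if_neg h, map_zero]
  | complete => simp only [map_sum, hv, sum_vertexProj, map_one]
  | arrow a =>
    simp only [map_mul, hv, ha]
    refine matrix_evalAt_ext fun X => ?_
    simp only [map_mul, map_vertexProj, map_univMat]
    exact X.2.1 a
  | inv_mul a =>
    simp only [map_mul, hw, hs, map_one]
    exact Matrix.nonsing_inv_mul _ (isUnit_det_locMat a)
  | mul_inv a =>
    simp only [map_mul, hw, hs, map_one]
    exact Matrix.mul_nonsing_inv _ (isUnit_det_locMat a)

/-- The universal representation of `A_Q`: `e_s` acts by the projection on the summand of `s`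
and the arrow `a` by `X_a`. -/
noncomputable def univRep :
    AQ Q γ →ₐ[ℂ] Matrix (DimIdx n) (DimIdx n) (coordRing n Q γ) :=
  RingQuot.liftAlgHom ℂ ⟨freeRep n Q γ, fun _ _ h => freeRep_rel n Q γ h⟩

theorem univRep_arr (a : DArrow E) : univRep n Q γ (AQ.arr Q γ a) = univMat n Q γ a := by
  rw [univRep, AQ.arr, RingQuot.liftAlgHom_mkAlgHom_apply, freeRep, PathGen.fa,
    FreeAlgebra.lift_ι_apply]

theorem univRep_act (g : ∀ s, GL (Fin (n s)) ℂ) (X : repSpace n Q γ) (f : AQ Q γ) :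
    (evalAt n Q γ (act g X)).mapMatrix (univRep n Q γ f) =
      glMat n g * (evalAt n Q γ X).mapMatrix (univRep n Q γ f) * glMat n g⁻¹ := by
  have h1 := glMat_mul_inv g
  have h2 := glMat_inv_mul g
  obtain ⟨x, rfl⟩ := RingQuot.mkAlgHom_surjective ℂ (AQRel Q γ) f
  simp only [univRep, RingQuot.liftAlgHom_mkAlgHom_apply]
  induction x using FreeAlgebra.induction with
  | grade0 r =>
    simp only [AlgHom.commutes]
    rw [Algebra.algebraMap_eq_smul_one, Matrix.mul_smul, mul_one, Matrix.smul_mul, h1]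
  | grade1 x =>
    simp only [freeRep, FreeAlgebra.lift_ι_apply]
    cases x with
    | vert s =>
      simp only [map_vertexProj]
      rw [glMat_comm_vertexProj, mul_assoc, h1, mul_one]
    | arr a => rfl
    | inv a =>
      have key : ∀ Y : repSpace n Q γ,
          (evalAt n Q γ Y).mapMatrix (locMat n Q γ (univMat n Q γ) a)⁻¹ =
            (locMat n Q γ Y.1 a)⁻¹ := fun Y => by
        refine (Matrix.inv_eq_left_inv ?_).symm
        rw [← map_locMat, ← map_mul, Matrix.nonsing_inv_mul _ (isUnit_det_locMat a), map_one]
      simp only [key]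
      refine Matrix.inv_eq_left_inv ?_
      have h3 := Matrix.nonsing_inv_mul (locMat n Q γ X.1 a) (X.2.2 a).isUnit
      show _ * locMat n Q γ (conjAll g X.1) a = 1
      rw [locMat_conjAll]
      calc _ = glMat n g * (locMat n Q γ X.1 a)⁻¹ * (glMat n g⁻¹ * glMat n g) *
            locMat n Q γ X.1 a * glMat n g⁻¹ := by simp only [mul_assoc]
        _ = glMat n g * ((locMat n Q γ X.1 a)⁻¹ * locMat n Q γ X.1 a) * glMat n g⁻¹ := by
            rw [h2]; simp only [mul_assoc, one_mul]
        _ = 1 := by rw [h3, mul_one, h1]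
  | mul x y hx hy =>
    simp only [map_mul, hx, hy]
    calc _ = glMat n g * (evalAt n Q γ X).mapMatrix (freeRep n Q γ x) *
          (glMat n g⁻¹ * glMat n g) * (evalAt n Q γ X).mapMatrix (freeRep n Q γ y) *
            glMat n g⁻¹ := by simp only [mul_assoc]
      _ = _ := by rw [h2]; simp only [mul_assoc, one_mul]
  | add x y hx hy => simp only [map_add, hx, hy, mul_add, add_mul]

/-- The linear map `f ↦ tr (X_f)` from `A_Q` to invariant functions. -/
noncomputable def traceFun : AQ Q γ →ₗ[ℂ] invRing n Q γ :=
  LinearMap.codRestrict (Subalgebra.toSubmodule (invRing n Q γ))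
    ((coordRing n Q γ).val.toLinearMap ∘ₗ
      Matrix.traceLinearMap (DimIdx n) ℂ (coordRing n Q γ) ∘ₗ (univRep n Q γ).toLinearMap)
    (fun f => ⟨Subtype.property _, fun g X => by
      have key : ∀ Y : repSpace n Q γ,
          ((Matrix.trace (univRep n Q γ f) : coordRing n Q γ) : repSpace n Q γ → ℂ) Y =
            Matrix.trace ((evalAt n Q γ Y).mapMatrix (univRep n Q γ f)) := fun Y =>
        AddMonoidHom.map_trace (evalAt n Q γ Y) (univRep n Q γ f)
      show ((Matrix.trace (univRep n Q γ f) : coordRing n Q γ) : repSpace n Q γ → ℂ) _ =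
        ((Matrix.trace (univRep n Q γ f) : coordRing n Q γ) : repSpace n Q γ → ℂ) _
      rw [key, key, univRep_act, mul_assoc, Matrix.trace_mul_comm, mul_assoc, glMat_inv_mul,
        mul_one]⟩)

theorem traceFun_commutator (f : AQ Q γ) (hf : f ∈ commutatorSpan (AQ Q γ)) :
    traceFun n Q γ f = 0 := by
  have h : commutatorSpan (AQ Q γ) ≤ LinearMap.ker (traceFun n Q γ) := by
    refine Submodule.span_le.2 ?_
    rintro _ ⟨x, y, rfl⟩
    refine Subtype.ext ?_
    show ((Matrix.trace (univRep n Q γ (x * y - y * x)) : coordRing n Q γ) :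
      repSpace n Q γ → ℂ) = 0
    rw [map_sub, map_mul, map_mul, Matrix.trace_sub, Matrix.trace_mul_comm, sub_self]
    rfl
  exact h hf

/-- The morphism of algebras `Sym (H_0(A_Q)) → ℂ[M^γ // GL_n]` sending `tr f` to the function
`tr (X_f)`. -/
noncomputable def traceMap : SymmetricAlgebra ℂ (HZero (AQ Q γ)) →ₐ[ℂ] invRing n Q γ :=
  SymmetricAlgebra.lift
    ((commutatorSpan (AQ Q γ)).liftQ (traceFun n Q γ) (fun f hf => traceFun_commutator n Q γ f hf))

/-- On a product of arrows the trace map is `tr (a_1 ⋯ a_k) ↦ tr (X_{a_1} ⋯ X_{a_k})`. -/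
theorem traceMap_path (l : List (DArrow E)) (X : repSpace n Q γ) :
    (traceMap n Q γ (symTr (l.map (AQ.arr Q γ)).prod) : repSpace n Q γ → ℂ) X =
      Matrix.trace (l.map X.1).prod := by
  have h1 : traceMap n Q γ (symTr (l.map (AQ.arr Q γ)).prod) =
      traceFun n Q γ (l.map (AQ.arr Q γ)).prod := by
    simp only [traceMap, symTr, LinearMap.comp_apply, SymmetricAlgebra.lift_ι_apply]
    exact Submodule.liftQ_apply _ _ _
  rw [h1]
  show evalAt n Q γ X (Matrix.trace (univRep n Q γ (l.map (AQ.arr Q γ)).prod)) = _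
  rw [map_list_prod, List.map_map]
  have h2 : (univRep n Q γ) ∘ AQ.arr Q γ = univMat n Q γ := funext (univRep_arr n Q γ)
  rw [h2, AddMonoidHom.map_trace (evalAt n Q γ X)]
  congr 1
  show (evalAt n Q γ X).mapMatrix _ = _
  rw [map_list_prod, List.map_map]
  rfl

/-! ### The bivectors -/

/-- The wedge `V ∧ W = V ⊗ W - W ⊗ V` of two operators on functions, paired with `df ⊗ dg`. -/
def wedge {M : Type*} (V W : (M → ℂ) → M → ℂ) (f g : M → ℂ) : M → ℂ :=
  V f * W g - W f * V g

open Classical in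
/-- The vector field `(∂_a)_{ij} = ∂ / ∂ (X_a)_{ji}`, which is zero unless `i` is in the summand of
`h(a)` and `j` in that of `t(a)`. The function `f` is extended by zero outside the open subset
`M^γ`; this does not affect the derivative at a point of `M^γ`. -/
noncomputable def pder (a : DArrow E) (i j : DimIdx n) (f : repSpace n Q γ → ℂ)
    (X : repSpace n Q γ) : ℂ :=
  if i.1 = Q.dhead a ∧ j.1 = Q.dtail a then
    deriv (fun u : ℂ =>
      if h : (fun b => X.1 b + if b = a then Matrix.single j i u else 0) ∈ repSpace n Q γ then
        f ⟨_, h⟩ else 0) 0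
  else 0

/-- The entry `(i, j)` of the matrix of vector fields `∂_{a*} X_{a*} - X_a ∂_a`. -/
noncomputable def fusField (a : DArrow E) (i j : DimIdx n) (f : repSpace n Q γ → ℂ)
    (X : repSpace n Q γ) : ℂ :=
  ∑ k, (X.1 a.star k j * pder n Q γ a.star i k f X - X.1 a i k * pder n Q γ a k j f X)

/-- The vector field `tr (X_{a*} ∂_{a*} - X_a ∂_a)`. -/
noncomputable def scaleField (a : DArrow E) (f : repSpace n Q γ → ℂ) (X : repSpace n Q γ) : ℂ :=
  ∑ i, ∑ j, (X.1 a.star i j * pder n Q γ a.star j i f X - X.1 a i j * pder n Q γ a j i f X)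

section Bivectors

variable [Fintype E] [LinearOrder (DArrow E)]

/-- The quasi-Poisson bivector `P^γ`, evaluated on `df ⊗ dg`. -/
noncomputable def quasiPoisson (f g : repSpace n Q γ → ℂ) (X : repSpace n Q γ) : ℂ :=
  (1 / 2) * ∑ a : DArrow E, a.sign * ∑ i, ∑ j, ∑ k,
      (γ a.base • (1 : Matrix (DimIdx n) (DimIdx n) ℂ) + X.1 a.star * X.1 a) i j *
        wedge (pder n Q γ a j k) (pder n Q γ a.star k i) f g X
    - (1 / 2) * ∑ a : DArrow E, ∑ b : DArrow E, if a < b then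
        ∑ i, ∑ j, wedge (fusField n Q γ a i j) (fusField n Q γ b j i) f g X
      else 0

/-- The bivector `ψ_z`, evaluated on `df ⊗ dg`. -/
noncomputable def scaleBivector (z : E → E → ℂ) (f g : repSpace n Q γ → ℂ)
    (X : repSpace n Q γ) : ℂ :=
  ∑ a : E, ∑ b : E, if DArrow.fwd a < DArrow.fwd b then
      z a b * wedge (scaleField n Q γ (.fwd a)) (scaleField n Q γ (.fwd b)) f g X
    else 0

end Bivectors

end RepSpace

/-! Derivations control everything. A derivation of `A_Q` into a bimodule is the corner entry of an
algebra map into triangular 2×2 matrices. It therefore exists for all values on arrows that lie in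
the right block (`exists_twistedDer`). Its kernel is closed under inverses, so it is determined by
those values (`der_ext`). Using this once in each argument constructs the outer bracket
(`exists_outer`), proves that both double brackets are unique, and reduces every later identity on
the algebra to arrows. `IsLocalizedPathAlgebra` abstracts exactly the facts needed.

The outer bracket `D` does not satisfy the double Jacobi identity. It is quasi-Poisson: its triple
bracket is the explicit expression `cartanTriple`. Both sides are cyclic and are derivations in the
last argument, so arrows suffice. There `D = D₀ + D₁`, where `D₀` pairs only an arrow with its
opposite and `D₁` carries the terms in `o(-,-)` created by fusing vertices. The mixed terms cancel.
The part quadratic in `D₁` has as coefficients the sums `o(x,y)o(y,z) + o(y,z)o(z,x) +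
o(z,x)o(x,y)`, which equal -1 except at `x = y = z`, where they are 0 (`ord_cyclic`). This is
`cartanTriple` with some words missing, and `D₀` supplies precisely those words (`triple_arrow`).

Two consequences follow. Multiplication kills `cartanTriple`, because its words become equal and
cancel in sign, so the induced bracket of traces satisfies Jacobi (`trace_mulBracket_jacobi`). On
the representation space, the bracket of matrix entries given by the bivector `P^γ` is the matrix
form of `D`, which again is checked on coordinates only. Its Jacobiator is then the trivector built
from the infinitesimal action of `GL_n` (`jacobiator_eq_cartanDer`). This trivector vanishes as soon
as one argument is an invariant function. Equivariance keeps brackets of invariants invariant, so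
`P^γ` restricts to a Poisson bracket on them.

For the part in `z`, let `d_i` be the derivation of weight -1 on the arrow `i` and +1 on its
opposite. The `d_i` commute and preserve `D`, whose values on arrows are homogeneous. The right
bracket is `∑ z_ij d_i ∧ d_j`, the bracket on the symmetric algebra is the same sum for the induced
derivations, and `ψ_z` is the same sum for the scaling vector fields. Adding wedges of commuting
derivations that preserve a Poisson bracket gives a Poisson bracket (`add_wedgeSum`), which covers
all `z₀` and `z` both upstairs and downstairs. The trace map intertwines the two brackets because it
intertwines `D` with `P^γ` and each `d_i` with its vector field on traces, and traces generate. -/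

/-! ### Twisted derivations -/

/-- `d` is a derivation for the bimodule structure on `T` given by two algebra morphisms. -/
def IsTwistedDer {A T : Type*} [Ring A] [Algebra ℂ A] [Ring T] [Algebra ℂ T]
    (l r : A →ₐ[ℂ] T) (d : A →ₗ[ℂ] T) : Prop :=
  ∀ g h, d (g * h) = l g * d h + d g * r h

namespace IsTwistedDer

variable {A T : Type*} [Ring A] [Algebra ℂ A] [Ring T] [Algebra ℂ T] {l r : A →ₐ[ℂ] T}
  {d d' : A →ₗ[ℂ] T}

theorem map_one (hd : IsTwistedDer l r d) : d 1 = 0 := by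
  have h := hd 1 1
  simpa using h

theorem sub (hd : IsTwistedDer l r d) (hd' : IsTwistedDer l r d') : IsTwistedDer l r (d - d') := by
  intro g h
  simp only [LinearMap.sub_apply, hd g h, hd' g h, mul_sub, sub_mul]
  abel

theorem add (hd : IsTwistedDer l r d) (hd' : IsTwistedDer l r d') : IsTwistedDer l r (d + d') := by
  intro g h
  simp only [LinearMap.add_apply, hd g h, hd' g h, mul_add, add_mul]
  abel

theorem smul (c : ℂ) (hd : IsTwistedDer l r d) : IsTwistedDer l r (c • d) := by
  intro g h
  simp only [LinearMap.smul_apply, hd g h, smul_add, mul_smul_comm, smul_mul_assoc]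

theorem zero : IsTwistedDer l r (0 : A →ₗ[ℂ] T) := by
  intro g h
  simp

/-- Since `d x = 0`, one has `0 = d (y * x) = d y * r x`, and `r x` is invertible. -/
theorem inv_eq_zero (hd : IsTwistedDer l r d) {x y : A} (hxy : x * y = 1) (hyx : y * x = 1)
    (hx : d x = 0) : d y = 0 := by
  have h := hd y x
  rw [hyx, hd.map_one, hx, mul_zero, zero_add] at h
  calc d y = d y * r (x * y) := by rw [hxy, _root_.map_one, mul_one]
    _ = 0 := by rw [map_mul, ← mul_assoc, ← h, zero_mul]

/-- The subalgebra on which a twisted derivation vanishes. -/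
def kernel (hd : IsTwistedDer l r d) : Subalgebra ℂ A where
  carrier := {x | d x = 0}
  mul_mem' := fun {x y} hx hy => by
    simp only [Set.mem_ofPred_eq] at *
    rw [hd, hx, hy, mul_zero, zero_mul, add_zero]
  add_mem' := fun {x y} hx hy => by
    simp only [Set.mem_ofPred_eq] at *
    rw [map_add, hx, hy, add_zero]
  algebraMap_mem' := fun c => by
    simp only [Set.mem_ofPred_eq]
    rw [Algebra.algebraMap_eq_smul_one, map_smul, hd.map_one, smul_zero]

end IsTwistedDer

/-! ### Relations of the localised path algebra and derivations out of it -/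

namespace AQ

variable {I E : Type*} [Fintype I] (Q : FinQuiver I E) (γ : E → ℂ)

/-- The inverse adjoined for the arrow `a`. -/
noncomputable def inv (a : DArrow E) : AQ Q γ := RingQuot.mkAlgHom ℂ (AQRel Q γ) (PathGen.fw a)

/-- The element inverted for the arrow `a`. -/
noncomputable def loc (a : DArrow E) : AQ Q γ :=
  1 - e Q γ (Q.dtail a) + γ a.base • e Q γ (Q.dtail a) + arr Q γ a * arr Q γ a.star

variable {Q γ}

theorem mk_fs (a : DArrow E) :
    RingQuot.mkAlgHom ℂ (AQRel Q γ) (PathGen.fs Q γ a) = loc Q γ a := by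
  simp only [PathGen.fs, loc, map_add, map_sub, map_one, map_smul, map_mul]
  rfl

theorem inv_mul_loc (a : DArrow E) : inv Q γ a * loc Q γ a = 1 := by
  rw [inv, ← mk_fs, ← map_mul, RingQuot.mkAlgHom_rel ℂ (AQRel.inv_mul a), map_one]

theorem loc_mul_inv (a : DArrow E) : loc Q γ a * inv Q γ a = 1 := by
  rw [inv, ← mk_fs, ← map_mul, RingQuot.mkAlgHom_rel ℂ (AQRel.mul_inv a), map_one]

theorem e_mul_self (s : I) : e Q γ s * e Q γ s = e Q γ s := by
  rw [e, ← map_mul, RingQuot.mkAlgHom_rel ℂ (AQRel.idem s)]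

theorem e_mul_e_of_ne {r s : I} (h : r ≠ s) : e Q γ r * e Q γ s = 0 := by
  rw [e, e, ← map_mul, RingQuot.mkAlgHom_rel ℂ (AQRel.orth r s h), map_zero]

theorem sum_e : ∑ s, e Q γ s = 1 := by
  simp only [e]
  rw [← map_sum, RingQuot.mkAlgHom_rel ℂ AQRel.complete, map_one]

theorem arr_eq (a : DArrow E) :
    arr Q γ a = e Q γ (Q.dtail a) * arr Q γ a * e Q γ (Q.dhead a) := by
  conv_lhs => rw [arr, RingQuot.mkAlgHom_rel ℂ (AQRel.arrow a), map_mul, map_mul]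
  rfl

theorem subalgebra_eq_top' (S : Subalgebra ℂ (AQ Q γ)) (he : ∀ s, e Q γ s ∈ S)
    (ha : ∀ a, arr Q γ a ∈ S) (hw : ∀ a, inv Q γ a ∈ S) : S = ⊤ := by
  refine Algebra.eq_top_iff.2 fun x => ?_
  obtain ⟨y, rfl⟩ := RingQuot.mkAlgHom_surjective ℂ (AQRel Q γ) x
  induction y using FreeAlgebra.induction with
  | grade0 r =>
    rw [AlgHom.commutes]
    exact S.algebraMap_mem r
  | grade1 x =>
    cases x with
    | vert s => exact he s
    | arr a => exact ha a
    | inv a => exact hw a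
  | mul x y hx hy => rw [map_mul]; exact mul_mem hx hy
  | add x y hx hy => rw [map_add]; exact add_mem hx hy

/-- A subalgebra of `A_Q` containing idempotents and arrows and closed under inverses is full. -/
theorem subalgebra_eq_top (S : Subalgebra ℂ (AQ Q γ)) (he : ∀ s, e Q γ s ∈ S)
    (ha : ∀ a, arr Q γ a ∈ S) (hS : ∀ x y, x * y = 1 → y * x = 1 → x ∈ S → y ∈ S) : S = ⊤ :=
  subalgebra_eq_top' S he ha fun a => hS _ _ (loc_mul_inv a) (inv_mul_loc a)
    (add_mem (add_mem (sub_mem (one_mem _) (he _)) (Subalgebra.smul_mem _ (he _) _))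
      (mul_mem (ha _) (ha _)))

section Derivations

variable {T : Type*} [Ring T] [Algebra ℂ T] {l r : AQ Q γ →ₐ[ℂ] T}

variable (l r) in
/-- The triangular matrices attached to the generators of `A_Q`. -/
noncomputable def triangularGen (v : DArrow E → T) : PathGen I E → Matrix (Fin 2) (Fin 2) T
  | .vert s => !![l (e Q γ s), 0; 0, r (e Q γ s)]
  | .arr a => !![l (arr Q γ a), v a; 0, r (arr Q γ a)]
  | .inv a => !![l (inv Q γ a), -(l (inv Q γ a) *
      (l (arr Q γ a) * v a.star + v a * r (arr Q γ a.star)) * r (inv Q γ a)); 0, r (inv Q γ a)]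

/-- A twisted derivation `d` is the same as the algebra map sending `x` to the triangular matrix
with diagonal `l x`, `r x` and corner `d x`. Prescribing these matrices on generators leaves only
the defining relations to check. The corner attached to a formal inverse is forced by inverting a
triangular matrix. -/
theorem exists_twistedDer (l r : AQ Q γ →ₐ[ℂ] T) (v : DArrow E → T)
    (hv : ∀ a, v a = l (e Q γ (Q.dtail a)) * v a * r (e Q γ (Q.dhead a))) :
    ∃ d : AQ Q γ →ₗ[ℂ] T, IsTwistedDer l r d ∧ (∀ s, d (e Q γ s) = 0) ∧
      ∀ a, d (arr Q γ a) = v a := by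
  classical
  let F : FreeAlgebra ℂ (PathGen I E) →ₐ[ℂ] Matrix (Fin 2) (Fin 2) T :=
    FreeAlgebra.lift ℂ (triangularGen l r v)
  have Fe : ∀ s, F (PathGen.fe s) = !![l (e Q γ s), 0; 0, r (e Q γ s)] := fun s => by
    simp [F, PathGen.fe, triangularGen]
  have Fa : ∀ a, F (PathGen.fa a) = !![l (arr Q γ a), v a; 0, r (arr Q γ a)] := fun a => by
    simp [F, PathGen.fa, triangularGen]
  have Fw : ∀ a, F (PathGen.fw a) = !![l (inv Q γ a), -(l (inv Q γ a) *
      (l (arr Q γ a) * v a.star + v a * r (arr Q γ a.star)) * r (inv Q γ a)); 0, r (inv Q γ a)] :=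
    fun a => by simp [F, PathGen.fw, triangularGen]
  have Fs : ∀ a, F (PathGen.fs Q γ a) = !![l (loc Q γ a),
      l (arr Q γ a) * v a.star + v a * r (arr Q γ a.star); 0, r (loc Q γ a)] := fun a => by
    simp only [PathGen.fs, map_add, map_sub, map_one, map_smul, map_mul, Fe, Fa, loc]
    ext i j
    fin_cases i <;> fin_cases j <;> simp [Matrix.one_fin_two]
  have hF : ∀ ⦃x y⦄, AQRel Q γ x y → F x = F y := by
    intro x y h
    cases h with
    | idem s =>
      simp only [map_mul, Fe]
      ext i j
      fin_cases i <;> fin_cases j <;> simp [← map_mul, e_mul_self]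
    | orth p s h =>
      simp only [map_mul, Fe]
      ext i j
      fin_cases i <;> fin_cases j <;> simp [← map_mul, e_mul_e_of_ne h]
    | complete =>
      simp only [map_sum, Fe, map_one]
      ext i j
      rw [Matrix.sum_apply]
      fin_cases i <;> fin_cases j <;> simp [← map_sum, sum_e]
    | arrow a =>
      simp only [map_mul, Fe, Fa]
      ext i j
      fin_cases i <;> fin_cases j <;> simp [← map_mul, ← arr_eq]
      -- The corner of the arrow relation is the only place where the values must lie in the right
      -- block.
      exact hv a
    | inv_mul a =>
      simp only [map_mul, Fw, Fs, map_one]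
      have h1 : l (inv Q γ a) * l (loc Q γ a) = 1 := by rw [← map_mul, inv_mul_loc, map_one]
      have h2 : r (inv Q γ a) * r (loc Q γ a) = 1 := by rw [← map_mul, inv_mul_loc, map_one]
      ext i j
      fin_cases i <;> fin_cases j <;> simp [h1, h2, mul_assoc]
    | mul_inv a =>
      simp only [map_mul, Fw, Fs, map_one]
      have h1 : l (loc Q γ a) * l (inv Q γ a) = 1 := by rw [← map_mul, loc_mul_inv, map_one]
      have h2 : r (loc Q γ a) * r (inv Q γ a) = 1 := by rw [← map_mul, loc_mul_inv, map_one]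
      ext i j
      fin_cases i <;> fin_cases j <;> simp [h1, h2, mul_assoc]
      rw [← mul_assoc, h1, one_mul, neg_add_cancel]
  let G : AQ Q γ →ₐ[ℂ] Matrix (Fin 2) (Fin 2) T := RingQuot.liftAlgHom ℂ ⟨F, hF⟩
  have GF : ∀ x, G (RingQuot.mkAlgHom ℂ (AQRel Q γ) x) = F x := fun x =>
    RingQuot.liftAlgHom_mkAlgHom_apply ℂ F hF x
  have key : ∀ x, G x 0 0 = l x ∧ G x 1 0 = 0 ∧ G x 1 1 = r x := by
    intro x
    obtain ⟨y, rfl⟩ := RingQuot.mkAlgHom_surjective ℂ (AQRel Q γ) x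
    induction y using FreeAlgebra.induction with
    | grade0 c =>
      simp only [AlgHom.commutes]
      simp [Matrix.algebraMap_matrix_apply]
    | grade1 x =>
      rw [GF]
      cases x with
      | vert s =>
        change F (PathGen.fe s) 0 0 = l (e Q γ s) ∧ F (PathGen.fe s) 1 0 = 0 ∧
          F (PathGen.fe s) 1 1 = r (e Q γ s)
        simp [Fe]
      | arr a =>
        change F (PathGen.fa a) 0 0 = l (arr Q γ a) ∧ F (PathGen.fa a) 1 0 = 0 ∧
          F (PathGen.fa a) 1 1 = r (arr Q γ a)
        simp [Fa]
      | inv a =>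
        change F (PathGen.fw a) 0 0 = l (inv Q γ a) ∧ F (PathGen.fw a) 1 0 = 0 ∧
          F (PathGen.fw a) 1 1 = r (inv Q γ a)
        simp [Fw]
    | mul x y hx hy =>
      simp only [map_mul, Matrix.mul_apply, Fin.sum_univ_two, hx, hy]
      simp
    | add x y hx hy => simp [map_add, hx, hy]
  refine ⟨{ toFun := fun x => G x 0 1, map_add' := fun x y => by simp,
            map_smul' := fun c x => by simp }, fun x y => ?_, fun s => ?_, fun a => ?_⟩
  · simp only [LinearMap.coe_mk, AddHom.coe_mk, map_mul, Matrix.mul_apply, Fin.sum_univ_two,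
      (key x).1, (key y).2.2]
  · exact congrFun (congrFun ((GF _).trans (Fe s)) 0) 1
  · exact congrFun (congrFun ((GF _).trans (Fa a)) 0) 1

end Derivations

end AQ

universe u

/-! ### Existence and uniqueness of outer double brackets -/

section TensorAlgebra

variable {A : Type*} [Ring A] [Algebra ℂ A]

variable (A) in
/-- The morphism `x ↦ x ⊗ 1`. -/
noncomputable def inclL : A →ₐ[ℂ] A ⊗[ℂ] A := Algebra.TensorProduct.includeLeft

variable (A) in
/-- The morphism `x ↦ 1 ⊗ x`. -/
noncomputable def inclR : A →ₐ[ℂ] A ⊗[ℂ] A := Algebra.TensorProduct.includeRight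

theorem inclL_apply (x : A) : inclL A x = x ⊗ₜ[ℂ] 1 := rfl

theorem inclR_apply (x : A) : inclR A x = 1 ⊗ₜ[ℂ] x := rfl

theorem inclL_comm_inclR (x y : A) : inclL A x * inclR A y = inclR A y * inclL A x := by
  simp [inclL_apply, inclR_apply, Algebra.TensorProduct.tmul_mul_tmul]

theorem tensorComm_mul (x y : A ⊗[ℂ] A) :
    TensorProduct.comm ℂ A A (x * y) = TensorProduct.comm ℂ A A x * TensorProduct.comm ℂ A A y :=
  map_mul (Algebra.TensorProduct.comm ℂ A A) x y

theorem tensorComm_inclL (x : A) : TensorProduct.comm ℂ A A (inclL A x) = inclR A x := rfl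

theorem tensorComm_inclR (x : A) : TensorProduct.comm ℂ A A (inclR A x) = inclL A x := rfl

end TensorAlgebra

section TwistedDerOps

variable {A T : Type*} [Ring A] [Algebra ℂ A] [Ring T] [Algebra ℂ T] {l r : A →ₐ[ℂ] T}
  {d d' : A →ₗ[ℂ] T}

/-- Multiplications by `p` and `q` commuting with the actions through `l` and `r` are bimodule maps.
For the outer structure on `A ⊗ A` these are the inner multiplications. They serve to compare
derivations block by block. -/
theorem IsTwistedDer.sandwich (hd : IsTwistedDer l r d) (p q : T) (hp : ∀ g, p * l g = l g * p)
    (hq : ∀ g, r g * q = q * r g) :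
    IsTwistedDer l r (LinearMap.mulLeft ℂ p ∘ₗ LinearMap.mulRight ℂ q ∘ₗ d) := by
  intro g h
  simp only [LinearMap.comp_apply, LinearMap.mulRight_apply, LinearMap.mulLeft_apply, hd g h,
    add_mul, mul_add]
  congr 1
  · rw [mul_assoc (l g), ← mul_assoc p, hp, mul_assoc]
  · rw [mul_assoc (d g), hq, mul_assoc p, mul_assoc (d g)]

theorem IsOuterDoubleBracket.right {D : A →ₗ[ℂ] A →ₗ[ℂ] A ⊗[ℂ] A} (hD : IsOuterDoubleBracket D)
    (f : A) : IsTwistedDer (inclL A) (inclR A) (D f) := fun g h => hD.der_right f g h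

theorem IsOuterDoubleBracket.left {D : A →ₗ[ℂ] A →ₗ[ℂ] A ⊗[ℂ] A} (hD : IsOuterDoubleBracket D)
    (f : A) : IsTwistedDer (inclR A) (inclL A) (D.flip f) := fun g h => hD.der_left g h f

theorem IsRightDoubleBracket.right {D : A →ₗ[ℂ] A →ₗ[ℂ] A ⊗[ℂ] A} (hD : IsRightDoubleBracket D)
    (f : A) : IsTwistedDer (inclR A) (inclR A) (D f) := fun g h => hD.der_right f g h

theorem IsRightDoubleBracket.left {D : A →ₗ[ℂ] A →ₗ[ℂ] A ⊗[ℂ] A} (hD : IsRightDoubleBracket D)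
    (f : A) : IsTwistedDer (inclL A) (inclL A) (D.flip f) := fun g h => hD.der_left g h f

end TwistedDerOps

theorem doubleBracket_left_eq_zero {A : Type*} [Ring A] [Algebra ℂ A]
    {D : A →ₗ[ℂ] A →ₗ[ℂ] A ⊗[ℂ] A} (hs : ∀ f g, D f g = -TensorProduct.comm ℂ _ _ (D g f)) {x : A}
    (hv : ∀ f, D f x = 0) (f : A) : D x f = 0 := by
  rw [hs, hv, map_zero, neg_zero]

/-- The properties of the localised path algebra `A_Q` with its idempotents and arrows which
determine its brackets: the relations of the path algebra, generation up to inverses, and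
existence of derivations with prescribed values on arrows. -/
structure IsLocalizedPathAlgebra {I E : Type*} [Fintype I] (Q : FinQuiver I E) {A : Type u} [Ring A]
    [Algebra ℂ A] (ve : I → A) (ar : DArrow E → A) : Prop where
  idem : ∀ s, ve s * ve s = ve s
  orth : ∀ r s, r ≠ s → ve r * ve s = 0
  sum_vert : ∑ s, ve s = 1
  arrow : ∀ a, ar a = ve (Q.dtail a) * ar a * ve (Q.dhead a)
  generates : ∀ S : Subalgebra ℂ A, (∀ s, ve s ∈ S) → (∀ a, ar a ∈ S) →
    (∀ x y, x * y = 1 → y * x = 1 → x ∈ S → y ∈ S) → S = ⊤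
  exists_der : ∀ (T : Type u) [Ring T] [Algebra ℂ T] (l r : A →ₐ[ℂ] T) (v : DArrow E → T),
    (∀ a, v a = l (ve (Q.dtail a)) * v a * r (ve (Q.dhead a))) →
    ∃ d : A →ₗ[ℂ] T, IsTwistedDer l r d ∧ (∀ s, d (ve s) = 0) ∧ ∀ a, d (ar a) = v a

theorem AQ.isLocalizedPathAlgebra {I E : Type*} [Fintype I] (Q : FinQuiver I E) (γ : E → ℂ) :
    IsLocalizedPathAlgebra Q (AQ.e Q γ) (AQ.arr Q γ) where
  idem := e_mul_self
  orth _ _ h := e_mul_e_of_ne h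
  sum_vert := sum_e
  arrow := arr_eq
  generates := subalgebra_eq_top
  exists_der _ _ _ l r v hv := exists_twistedDer l r v hv

namespace IsLocalizedPathAlgebra

variable {I E : Type*} [Fintype I] {Q : FinQuiver I E} {A : Type u} [Ring A] [Algebra ℂ A]
  {ve : I → A} {ar : DArrow E → A}

theorem vert_mul_arrow (hA : IsLocalizedPathAlgebra Q ve ar) (a : DArrow E) :
    ve (Q.dtail a) * ar a = ar a := by
  conv_lhs => rw [hA.arrow]
  conv_rhs => rw [hA.arrow]
  rw [← mul_assoc, ← mul_assoc, hA.idem]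

theorem arrow_mul_vert (hA : IsLocalizedPathAlgebra Q ve ar) (a : DArrow E) :
    ar a * ve (Q.dhead a) = ar a := by
  conv_lhs => rw [hA.arrow]
  conv_rhs => rw [hA.arrow]
  rw [mul_assoc, hA.idem]

theorem vert_mul_vert [DecidableEq I] (hA : IsLocalizedPathAlgebra Q ve ar) (r s : I) :
    ve r * ve s = if r = s then ve s else 0 := by
  split_ifs with h
  · rw [h, hA.idem]
  · exact hA.orth r s h

section Derivations

variable {T : Type*} [Ring T] [Algebra ℂ T] {l r : A →ₐ[ℂ] T} {d d' : A →ₗ[ℂ] T}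

/-- The kernel of `d` is a subalgebra containing the generators and closed under inverses, hence
everything. -/
theorem der_eq_zero (hA : IsLocalizedPathAlgebra Q ve ar) (hd : IsTwistedDer l r d)
    (he : ∀ s, d (ve s) = 0) (ha : ∀ a, d (ar a) = 0) : d = 0 := by
  have h := hA.generates hd.kernel he ha fun x y h1 h2 hx => hd.inv_eq_zero h1 h2 hx
  ext1 x
  exact (Algebra.eq_top_iff.1 h x : _)

theorem der_ext (hA : IsLocalizedPathAlgebra Q ve ar) (hd : IsTwistedDer l r d)
    (hd' : IsTwistedDer l r d') (he : ∀ s, d (ve s) = d' (ve s)) (ha : ∀ a, d (ar a) = d' (ar a)) :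
    d = d' :=
  sub_eq_zero.1 (hA.der_eq_zero (hd.sub hd')
    (fun s => by rw [LinearMap.sub_apply, he, sub_self])
    (fun a => by rw [LinearMap.sub_apply, ha, sub_self]))

end Derivations

/-- A pairing which is a twisted derivation in each argument is determined by its values on
arrows. -/
theorem pairing_ext {T : Type*} [Ring T] [Algebra ℂ T] {l r l' r' : A →ₐ[ℂ] T}
    {D D' : A →ₗ[ℂ] A →ₗ[ℂ] T}
    (hA : IsLocalizedPathAlgebra Q ve ar)
    (hr : ∀ f, IsTwistedDer l r (D f)) (hr' : ∀ f, IsTwistedDer l r (D' f))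
    (hl : ∀ f, IsTwistedDer l' r' (D.flip f)) (hl' : ∀ f, IsTwistedDer l' r' (D'.flip f))
    (he : ∀ f s, D f (ve s) = D' f (ve s)) (he' : ∀ f s, D (ve s) f = D' (ve s) f)
    (ha : ∀ a b, D (ar a) (ar b) = D' (ar a) (ar b)) : D = D' := by
  have h1 : ∀ a, D (ar a) = D' (ar a) := fun a =>
    hA.der_ext (hr _) (hr' _) (he _) (ha a)
  have h2 : ∀ g, D.flip g = D'.flip g := fun g =>
    hA.der_ext (hl g) (hl' g) (he' g) fun a => LinearMap.congr_fun (h1 a) g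
  ext1 f
  ext1 g
  exact LinearMap.congr_fun (h2 g) f

theorem outer_ext (hA : IsLocalizedPathAlgebra Q ve ar)
    {D D' : A →ₗ[ℂ] A →ₗ[ℂ] A ⊗[ℂ] A}
    (hD : IsOuterDoubleBracket D) (hD' : IsOuterDoubleBracket D')
    (hv : ∀ f s, D f (ve s) = 0) (hv' : ∀ f s, D' f (ve s) = 0)
    (ha : ∀ a b, D (ar a) (ar b) = D' (ar a) (ar b)) : D = D' :=
  hA.pairing_ext hD.right hD'.right hD.left hD'.left (fun f s => by rw [hv, hv'])
    (fun f s => by rw [doubleBracket_left_eq_zero hD.skew (fun f => hv f s),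
      doubleBracket_left_eq_zero hD'.skew (fun f => hv' f s)]) ha

theorem right_ext (hA : IsLocalizedPathAlgebra Q ve ar)
    {D D' : A →ₗ[ℂ] A →ₗ[ℂ] A ⊗[ℂ] A}
    (hD : IsRightDoubleBracket D) (hD' : IsRightDoubleBracket D')
    (hv : ∀ f s, D f (ve s) = 0) (hv' : ∀ f s, D' f (ve s) = 0)
    (ha : ∀ a b, D (ar a) (ar b) = D' (ar a) (ar b)) : D = D' :=
  hA.pairing_ext hD.right hD'.right hD.left hD'.left (fun f s => by rw [hv, hv'])
    (fun f s => by rw [doubleBracket_left_eq_zero hD.skew (fun f => hv f s),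
      doubleBracket_left_eq_zero hD'.skew (fun f => hv' f s)]) ha

/-- Extend the values first in the second argument (`R`) and then in the first (`S`). The second
extension requires `R a g` to lie in the block of `a` for every `g`. On arrows this follows from
`hskew` and `hblk`, and in general by uniqueness of derivations. The remaining Leibniz rule and
skewness are then identities between derivations that agree on arrows. -/
theorem exists_outer (hA : IsLocalizedPathAlgebra Q ve ar)
    (v : DArrow E → DArrow E → A ⊗[ℂ] A)
    (hblk : ∀ a b, v a b = inclL _ (ve (Q.dtail b)) * v a b * inclR _ (ve (Q.dhead b)))
    (hskew : ∀ a b, v a b = -TensorProduct.comm ℂ _ _ (v b a)) :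
    ∃ D : A →ₗ[ℂ] A →ₗ[ℂ] A ⊗[ℂ] A, IsOuterDoubleBracket D ∧
      (∀ f s, D f (ve s) = 0) ∧ ∀ a b, D (ar a) (ar b) = v a b := by
  have hblk' : ∀ a b,
      v a b = inclR _ (ve (Q.dtail a)) * v a b * inclL _ (ve (Q.dhead a)) := fun a b => by
    rw [hskew a b]
    conv_lhs => rw [hblk b a, tensorComm_mul, tensorComm_mul, tensorComm_inclL, tensorComm_inclR]
    simp only [mul_neg, neg_mul]
  choose R hR hRe hRa using fun a => hA.exists_der _ (inclL _) (inclR _) (v a) (hblk a)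
  have hRblk : ∀ a g,
      R a g = inclR _ (ve (Q.dtail a)) * R a g * inclL _ (ve (Q.dhead a)) := fun a g => by
    -- Projecting `R a` to the block of `a` uses the inner multiplications, so the result is again a
    -- derivation for the outer structure and can be compared with `R a` on arrows.
    have h := hA.der_ext (hR a) ((hR a).sandwich (inclR _ (ve (Q.dtail a)))
      (inclL _ (ve (Q.dhead a))) (fun g => (inclL_comm_inclR _ _).symm)
      (fun g => (inclL_comm_inclR _ _).symm))
      (fun s => by simp [hRe])
      (fun b => by
        simp only [LinearMap.comp_apply, LinearMap.mulRight_apply, LinearMap.mulLeft_apply, hRa]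
        rw [← mul_assoc]
        exact hblk' a b)
    conv_lhs => rw [h]
    simp only [LinearMap.comp_apply, LinearMap.mulRight_apply, LinearMap.mulLeft_apply, mul_assoc]
  choose S hS hSe hSa using fun g => hA.exists_der _ (inclR _) (inclL _) (fun a => R a g)
    (fun a => hRblk a g)
  have Sadd : ∀ g h, S (g + h) = S g + S h := fun g h =>
    hA.der_ext (hS _) ((hS g).add (hS h)) (fun s => by simp [hSe]) (fun a => by simp [hSa])
  have Ssmul : ∀ (c : ℂ) g, S (c • g) = c • S g := fun c g =>
    hA.der_ext (hS _) ((hS g).smul c) (fun s => by simp [hSe]) (fun a => by simp [hSa])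
  let D : A →ₗ[ℂ] A →ₗ[ℂ] A ⊗[ℂ] A :=
    LinearMap.flip { toFun := S, map_add' := Sadd, map_smul' := Ssmul }
  have hD : ∀ f g, D f g = S g f := fun f g => rfl
  -- Fix `g` and `h`: both sides are derivations in `f`, and on an arrow the identity is the Leibniz
  -- rule of `R a`.
  have Dr : ∀ f g h, D f (g * h) = inclL _ g * D f h + D f g * inclR _ h := fun f g h => by
    have hl := ((hS h).sandwich (inclL _ g) 1 (fun x => inclL_comm_inclR _ _) (by simp)).add
      ((hS g).sandwich 1 (inclR _ h) (by simp) (fun x => inclL_comm_inclR _ _))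
    have := hA.der_ext (hS (g * h)) hl (fun s => by simp [hSe])
      (fun a => by simp [hSa, (hR a) g h])
    rw [hD, this, hD, hD]
    simp
  have Dl : ∀ f g h, D (f * g) h = inclR _ f * D g h + D f h * inclL _ g := fun f g h => hS h f g
  have De : ∀ f s, D f (ve s) = 0 := fun f s => by
    have := hA.der_eq_zero (hS (ve s)) (hSe _) (fun a => by rw [hSa, hRe])
    rw [hD, this, LinearMap.zero_apply]
  have De' : ∀ f s, D (ve s) f = 0 := fun f s => hSe f s
  have Da : ∀ a b, D (ar a) (ar b) = v a b := fun a b => by rw [hD, hSa, hRa]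
  refine ⟨D, ⟨?_, Dr, Dl⟩, De, Da⟩
  -- The opposite of the flipped bracket obeys the same two Leibniz rules, so skewness amounts to `D
  -- = D'`, which can be tested on arrows.
  let D' : A →ₗ[ℂ] A →ₗ[ℂ] A ⊗[ℂ] A :=
    -(D.flip.compr₂ (TensorProduct.comm ℂ (A) (A)).toLinearMap)
  have hD' : ∀ f g, D' f g = -TensorProduct.comm ℂ _ _ (D g f) := fun f g => rfl
  have key : D = D' := by
    refine hA.pairing_ext (l := inclL _) (r := inclR _) (l' := inclR _) (r' := inclL _)
      Dr (fun f g h => ?_) (fun f g h => Dl g h f) (fun f g h => ?_) (fun f s => ?_)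
      (fun f s => ?_) (fun a b => ?_)
    · rw [hD', hD', hD', Dl, map_add, tensorComm_mul, tensorComm_mul, tensorComm_inclL,
        tensorComm_inclR]
      simp only [mul_neg, neg_mul, neg_add]
    · simp only [LinearMap.flip_apply]
      rw [hD', hD', hD', Dr, map_add, tensorComm_mul, tensorComm_mul, tensorComm_inclL,
        tensorComm_inclR]
      simp only [mul_neg, neg_mul, neg_add]
    · rw [De, hD', De', map_zero, neg_zero]
    · rw [De', hD', De, map_zero, neg_zero]
    · rw [Da, hD', Da]
      exact hskew a b
  intro f g
  rw [← hD', ← key]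

end IsLocalizedPathAlgebra

/-! ### Triple brackets -/

section Triple

variable {A : Type*} [Ring A] [Algebra ℂ A]

variable (A) in
/-- The rotation `x ⊗ y ⊗ z ↦ z ⊗ x ⊗ y`. -/
noncomputable def rot : (A ⊗[ℂ] A) ⊗[ℂ] A ≃ₐ[ℂ] (A ⊗[ℂ] A) ⊗[ℂ] A :=
  (Algebra.TensorProduct.comm ℂ (A ⊗[ℂ] A) A).trans
    (Algebra.TensorProduct.assoc ℂ ℂ ℂ A A A).symm

@[simp]
theorem rot_tmul (x y z : A) : rot A ((x ⊗ₜ y) ⊗ₜ z) = (z ⊗ₜ x) ⊗ₜ y := rfl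

/-- Two linear maps on a threefold tensor product agree if they agree on pure tensors. -/
theorem tensor3_ext {M : Type*} [AddCommMonoid M] [Module ℂ M] {p q : (A ⊗[ℂ] A) ⊗[ℂ] A →ₗ[ℂ] M}
    (h : ∀ x y z, p ((x ⊗ₜ y) ⊗ₜ z) = q ((x ⊗ₜ y) ⊗ₜ z)) : p = q := by
  ext x y z
  exact h x y z

theorem rot_rot_rot (x : (A ⊗[ℂ] A) ⊗[ℂ] A) : rot A (rot A (rot A x)) = x := by
  have h : (rot A).toLinearMap ∘ₗ (rot A).toLinearMap ∘ₗ (rot A).toLinearMap = LinearMap.id :=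
    tensor3_ext fun x y z => rfl
  exact LinearMap.congr_fun h x

variable (A) in
/-- The morphism `x ↦ x ⊗ 1 ⊗ 1`. -/
noncomputable def incl1 : A →ₐ[ℂ] (A ⊗[ℂ] A) ⊗[ℂ] A :=
  Algebra.TensorProduct.includeLeft.comp (inclL A)

variable (A) in
/-- The morphism `x ↦ 1 ⊗ x ⊗ 1`. -/
noncomputable def incl2 : A →ₐ[ℂ] (A ⊗[ℂ] A) ⊗[ℂ] A :=
  Algebra.TensorProduct.includeLeft.comp (inclR A)

variable (A) in
/-- The morphism `x ↦ 1 ⊗ 1 ⊗ x`. -/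
noncomputable def incl3 : A →ₐ[ℂ] (A ⊗[ℂ] A) ⊗[ℂ] A := Algebra.TensorProduct.includeRight

theorem rot_incl1 (x : A) : rot A (incl1 A x) = incl2 A x := rfl

theorem rot_incl2 (x : A) : rot A (incl2 A x) = incl3 A x := rfl

theorem rot_incl3 (x : A) : rot A (incl3 A x) = incl1 A x := rfl

theorem incl1_apply (x : A) : incl1 A x = (x ⊗ₜ 1) ⊗ₜ 1 := rfl

theorem incl2_apply (x : A) : incl2 A x = (1 ⊗ₜ x) ⊗ₜ 1 := rfl

theorem incl3_apply (x : A) : incl3 A x = 1 ⊗ₜ x := rfl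

variable (A) in
/-- The morphism `x ⊗ y ↦ x ⊗ y ⊗ 1`. -/
noncomputable def incl12 : A ⊗[ℂ] A →ₐ[ℂ] (A ⊗[ℂ] A) ⊗[ℂ] A := Algebra.TensorProduct.includeLeft

theorem incl12_apply (x : A ⊗[ℂ] A) : incl12 A x = x ⊗ₜ 1 := rfl

/-- The map `x ⊗ y ↦ D f x ⊗ y`. -/
noncomputable def leftExt (D : A →ₗ[ℂ] A →ₗ[ℂ] A ⊗[ℂ] A) :
    A →ₗ[ℂ] A ⊗[ℂ] A →ₗ[ℂ] (A ⊗[ℂ] A) ⊗[ℂ] A :=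
  LinearMap.rTensorHom A ∘ₗ D

@[simp]
theorem leftExt_tmul (D : A →ₗ[ℂ] A →ₗ[ℂ] A ⊗[ℂ] A) (f u v : A) :
    leftExt D f (u ⊗ₜ v) = D f u ⊗ₜ v := rfl

/-- The cyclic sum which for `D' = D` is the triple bracket associated with a double bracket. -/
noncomputable def triple (D D' : A →ₗ[ℂ] A →ₗ[ℂ] A ⊗[ℂ] A) (f g : A) :
    A →ₗ[ℂ] (A ⊗[ℂ] A) ⊗[ℂ] A :=
  leftExt D f ∘ₗ D' g + (rot A).toLinearMap ∘ₗ leftExt D g ∘ₗ D'.flip f +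
    (rot A).toLinearMap ∘ₗ (rot A).toLinearMap ∘ₗ (leftExt D).flip (D' f g)

theorem triple_apply (D D' : A →ₗ[ℂ] A →ₗ[ℂ] A ⊗[ℂ] A) (f g h : A) :
    triple D D' f g h = leftExt D f (D' g h) + rot A (leftExt D g (D' h f)) +
      rot A (rot A (leftExt D h (D' f g))) := rfl

theorem triple_rot (D D' : A →ₗ[ℂ] A →ₗ[ℂ] A ⊗[ℂ] A) (f g h : A) :
    triple D D' f g h = rot A (triple D D' g h f) := by
  simp only [triple_apply, map_add, rot_rot_rot]
  abel

section Leibniz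

variable {D : A →ₗ[ℂ] A →ₗ[ℂ] A ⊗[ℂ] A}

/-- Besides the expected term, the Leibniz rule of `D f` in the first factor leaves a cross term,
which cancels in the cyclic sum of `triple_der`. -/
theorem leftExt_inclL_mul (hD : IsOuterDoubleBracket D) (f c : A) (x : A ⊗[ℂ] A) :
    leftExt D f (inclL A c * x) =
      incl1 A c * leftExt D f x + incl12 A (D f c) * rot A (incl12 A x) := by
  induction x with
  | zero => simp
  | add x y hx hy => simp only [mul_add, map_add, hx, hy]; abel
  | tmul u v =>
    rw [inclL_apply, Algebra.TensorProduct.tmul_mul_tmul, one_mul, leftExt_tmul, hD.der_right,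
      TensorProduct.add_tmul, leftExt_tmul, incl12_apply, incl12_apply, rot_tmul, incl1_apply,
      Algebra.TensorProduct.tmul_mul_tmul, Algebra.TensorProduct.tmul_mul_tmul, one_mul]

theorem leftExt_mul_inclR (f d : A) (x : A ⊗[ℂ] A) :
    leftExt D f (x * inclR A d) = leftExt D f x * incl3 A d := by
  induction x with
  | zero => simp
  | add x y hx hy => simp only [add_mul, map_add, hx, hy]
  | tmul u v =>
    rw [inclR_apply, Algebra.TensorProduct.tmul_mul_tmul, mul_one, leftExt_tmul, leftExt_tmul,
      incl3_apply, Algebra.TensorProduct.tmul_mul_tmul, mul_one]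

theorem leftExt_inclR_mul (f c : A) (x : A ⊗[ℂ] A) :
    leftExt D f (inclR A c * x) = incl3 A c * leftExt D f x := by
  induction x with
  | zero => simp
  | add x y hx hy => simp only [mul_add, map_add, hx, hy]
  | tmul u v =>
    rw [inclR_apply, Algebra.TensorProduct.tmul_mul_tmul, one_mul, leftExt_tmul, leftExt_tmul,
      incl3_apply, Algebra.TensorProduct.tmul_mul_tmul, one_mul]

theorem leftExt_mul_inclL (hD : IsOuterDoubleBracket D) (g d : A) (x : A ⊗[ℂ] A) :
    rot A (leftExt D g (x * inclL A d)) =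
      incl12 A (TensorProduct.comm ℂ A A x) * rot A (incl12 A (D g d)) +
        rot A (leftExt D g x) * incl3 A d := by
  induction x with
  | zero => simp
  | add x y hx hy => simp only [add_mul, map_add, hx, hy]; abel
  | tmul u v =>
    rw [inclL_apply, Algebra.TensorProduct.tmul_mul_tmul, mul_one, leftExt_tmul, hD.der_right,
      TensorProduct.add_tmul, leftExt_tmul, TensorProduct.comm_tmul, ← rot_incl2,
      map_add, ← map_mul, incl2_apply, Algebra.TensorProduct.tmul_mul_tmul, mul_one]
    congr 1
    have h : incl12 A (v ⊗ₜ[ℂ] u) = rot A ((u ⊗ₜ 1) ⊗ₜ v) := rfl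
    rw [h, ← map_mul, incl12_apply, Algebra.TensorProduct.tmul_mul_tmul, mul_one]

theorem leftExt_mul_left (hD : IsOuterDoubleBracket D) (c d : A) (x : A ⊗[ℂ] A) :
    leftExt D (c * d) x = incl2 A c * leftExt D d x + leftExt D c x * incl1 A d := by
  induction x with
  | zero => simp
  | add x y hx hy => simp only [mul_add, add_mul, map_add, hx, hy]; abel
  | tmul u v =>
    rw [leftExt_tmul, hD.der_left, TensorProduct.add_tmul, leftExt_tmul, leftExt_tmul,
      incl1_apply, incl2_apply, Algebra.TensorProduct.tmul_mul_tmul,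
      Algebra.TensorProduct.tmul_mul_tmul, one_mul, mul_one]

/-- The products of `D f c` with `D g d` appear in the first two summands of the cyclic sum with
opposite signs, by skewness of `D`. The third summand is a derivation on its own. -/
theorem triple_der (hD : IsOuterDoubleBracket D) (f g : A) :
    IsTwistedDer (incl1 A) (incl3 A) (triple D D f g) := by
  intro c d
  have h1 : leftExt D f (D g (c * d)) = incl1 A c * leftExt D f (D g d) +
      incl12 A (D f c) * rot A (incl12 A (D g d)) + leftExt D f (D g c) * incl3 A d := by
    rw [hD.der_right, ← inclL_apply, ← inclR_apply, map_add, leftExt_inclL_mul hD,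
      leftExt_mul_inclR]
  have h2 : rot A (leftExt D g (D (c * d) f)) = incl1 A c * rot A (leftExt D g (D d f)) -
      incl12 A (D f c) * rot A (incl12 A (D g d)) + rot A (leftExt D g (D c f)) * incl3 A d := by
    rw [hD.der_left, ← inclL_apply, ← inclR_apply, map_add, map_add, leftExt_inclR_mul, map_mul,
      leftExt_mul_inclL hD, rot_incl3]
    have hs : incl12 A (D f c) = (-1 : ℂ) • incl12 A (TensorProduct.comm ℂ A A (D c f)) := by
      rw [← map_smul]
      exact congrArg _ ((hD.skew f c).trans (neg_one_smul ℂ _).symm)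
    rw [hs, smul_mul_assoc]
    module
  have h3 : rot A (rot A (leftExt D (c * d) (D f g))) =
      incl1 A c * rot A (rot A (leftExt D d (D f g))) +
        rot A (rot A (leftExt D c (D f g))) * incl3 A d := by
    rw [leftExt_mul_left hD]
    simp only [map_add, map_mul, rot_incl1, rot_incl2, rot_incl3]
  rw [triple_apply, triple_apply, triple_apply, h1, h2, h3]
  simp only [mul_add, add_mul]
  abel

end Leibniz

/-! ### The quasi-Poisson trivector -/

/-- Auxiliary factor in the trivector attached to an element `e`. -/
noncomputable def cartanAux (e f g : A) : (A ⊗[ℂ] A) ⊗[ℂ] A :=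
  ((e * f) ⊗ₜ (e * g)) ⊗ₜ e - ((e * f) ⊗ₜ e) ⊗ₜ (g * e) - (e ⊗ₜ (f * e * g)) ⊗ₜ e +
    (e ⊗ₜ (f * e)) ⊗ₜ (g * e)

/-- The triple bracket which measures the failure of the double Jacobi identity for a double
quasi-Poisson bracket, for a family of idempotents `e`. -/
noncomputable def cartanTriple {I : Type*} [Fintype I] (e : I → A) (f g : A) :
    A →ₗ[ℂ] (A ⊗[ℂ] A) ⊗[ℂ] A :=
  (1 / 4 : ℂ) • ∑ v, (LinearMap.mulRight ℂ (cartanAux (e v) f g) ∘ₗ (incl1 A).toLinearMap -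
    LinearMap.mulLeft ℂ (cartanAux (e v) f g) ∘ₗ (incl3 A).toLinearMap)

theorem cartanTriple_apply {I : Type*} [Fintype I] (e : I → A) (f g h : A) :
    cartanTriple e f g h = (1 / 4 : ℂ) • ∑ v, (incl1 A h * cartanAux (e v) f g -
      cartanAux (e v) f g * incl3 A h) := by
  simp [cartanTriple]

theorem cartanTriple_der {I : Type*} [Fintype I] (e : I → A) (f g : A) :
    IsTwistedDer (incl1 A) (incl3 A) (cartanTriple e f g) := by
  intro c d
  simp only [cartanTriple_apply, map_mul, mul_smul_comm, smul_mul_assoc, Finset.mul_sum,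
    Finset.sum_mul, ← smul_add, ← Finset.sum_add_distrib]
  congr 1
  refine Finset.sum_congr rfl fun v _ => ?_
  simp only [mul_sub, sub_mul, mul_assoc]
  abel

theorem cartanAux_terms (e f g h : A) :
    incl1 A h * cartanAux e f g - cartanAux e f g * incl3 A h =
      ((h * e * f) ⊗ₜ (e * g)) ⊗ₜ e - ((h * e * f) ⊗ₜ e) ⊗ₜ (g * e) -
        ((h * e) ⊗ₜ (f * e * g)) ⊗ₜ e + ((h * e) ⊗ₜ (f * e)) ⊗ₜ (g * e) -
      (((e * f) ⊗ₜ (e * g)) ⊗ₜ (e * h) - ((e * f) ⊗ₜ e) ⊗ₜ (g * e * h) -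
        (e ⊗ₜ (f * e * g)) ⊗ₜ (e * h) + (e ⊗ₜ (f * e)) ⊗ₜ (g * e * h)) := by
  simp only [cartanAux, incl1_apply, incl3_apply, mul_add, mul_sub, add_mul, sub_mul,
    Algebra.TensorProduct.tmul_mul_tmul, Algebra.TensorProduct.one_def, one_mul, mul_one, mul_assoc]

theorem cartanTriple_rot {I : Type*} [Fintype I] (e : I → A) (f g h : A) :
    cartanTriple e f g h = rot A (cartanTriple e g h f) := by
  simp only [cartanTriple_apply, cartanAux_terms, map_smul, map_sum, map_add, map_sub, rot_tmul]
  congr 1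
  refine Finset.sum_congr rfl fun v _ => ?_
  abel

variable (A) in
/-- The multiplication `x ⊗ y ⊗ z ↦ x y z`. -/
noncomputable def mul3 : (A ⊗[ℂ] A) ⊗[ℂ] A →ₗ[ℂ] A :=
  LinearMap.mul' ℂ A ∘ₗ (LinearMap.mul' ℂ A).rTensor A

@[simp]
theorem mul3_tmul (x : A ⊗[ℂ] A) (y : A) : mul3 A (x ⊗ₜ y) = LinearMap.mul' ℂ A x * y := by
  simp [mul3]

/-- After multiplication the first four words all become `hefege` and the last four `efegeh`. Within
each group the signs are +, -, -, +. -/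
theorem mul3_cartanTriple {I : Type*} [Fintype I] (e : I → A) (f g h : A) :
    mul3 A (cartanTriple e f g h) = 0 := by
  simp only [cartanTriple_apply, cartanAux_terms, map_smul, map_sum, map_add, map_sub, mul3_tmul,
    LinearMap.mul'_apply, mul_assoc]
  simp

theorem trace_mul3_rot {V : Type*} [AddCommGroup V] [Module ℂ V] (t : A →ₗ[ℂ] V)
    (ht : ∀ x y, t (x * y) = t (y * x)) (x : (A ⊗[ℂ] A) ⊗[ℂ] A) :
    t (mul3 A (rot A x)) = t (mul3 A x) := by
  have h : t ∘ₗ mul3 A ∘ₗ (rot A).toLinearMap = t ∘ₗ mul3 A := by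
    refine tensor3_ext fun x y z => ?_
    simp only [LinearMap.comp_apply, AlgEquiv.toLinearMap_apply, rot_tmul, mul3_tmul,
      LinearMap.mul'_apply]
    rw [mul_assoc, ht]
  exact LinearMap.congr_fun h x

/-- The bracket `m ∘ D` on the algebra. -/
noncomputable def mulBracket (D : A →ₗ[ℂ] A →ₗ[ℂ] A ⊗[ℂ] A) : A →ₗ[ℂ] A →ₗ[ℂ] A :=
  D.compr₂ (LinearMap.mul' ℂ A)

theorem mulBracket_apply (D : A →ₗ[ℂ] A →ₗ[ℂ] A ⊗[ℂ] A) (f g : A) :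
    mulBracket D f g = LinearMap.mul' ℂ A (D f g) := rfl

/-- The bracket can hit either factor of the product. Cyclicity of the trace brings the factor that
is hit to the front, which exchanges the tensor factors in the second term. -/
theorem trace_mulBracket_mul' {D : A →ₗ[ℂ] A →ₗ[ℂ] A ⊗[ℂ] A} (hD : IsOuterDoubleBracket D)
    {V : Type*} [AddCommGroup V] [Module ℂ V] (t : A →ₗ[ℂ] V)
    (ht : ∀ x y, t (x * y) = t (y * x)) (f : A) (x : A ⊗[ℂ] A) :
    t (mulBracket D f (LinearMap.mul' ℂ A x)) =
      t (mul3 A (leftExt D f x)) + t (mul3 A (leftExt D f (TensorProduct.comm ℂ A A x))) := by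
  induction x with
  | zero => simp
  | add x y hx hy => simp only [map_add, hx, hy]; abel
  | tmul u v =>
    have h1 : ∀ y : A ⊗[ℂ] A, LinearMap.mul' ℂ A ((u ⊗ₜ 1) * y) = u * LinearMap.mul' ℂ A y := by
      intro y
      induction y with
      | zero => simp
      | add x y hx hy => simp only [mul_add, map_add, hx, hy]
      | tmul p q => simp [mul_assoc]
    have h2 : ∀ y : A ⊗[ℂ] A, LinearMap.mul' ℂ A (y * (1 ⊗ₜ v)) = LinearMap.mul' ℂ A y * v := by
      intro y
      induction y with
      | zero => simp
      | add x y hx hy => simp only [add_mul, map_add, hx, hy]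
      | tmul p q => simp [mul_assoc]
    rw [mulBracket_apply, LinearMap.mul'_apply, hD.der_right, map_add, h1, h2, map_add,
      TensorProduct.comm_tmul, leftExt_tmul, leftExt_tmul, mul3_tmul, mul3_tmul, ht u, add_comm]

/-- The bracket induced on traces by an outer double bracket whose triple bracket is killed by
the multiplication satisfies the Jacobi identity. -/
theorem trace_mulBracket_jacobi {D : A →ₗ[ℂ] A →ₗ[ℂ] A ⊗[ℂ] A} (hD : IsOuterDoubleBracket D)
    (hT : ∀ f g h, mul3 A (triple D D f g h) = 0)
    {V : Type*} [AddCommGroup V] [Module ℂ V] (t : A →ₗ[ℂ] V)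
    (ht : ∀ x y, t (x * y) = t (y * x)) (f g h : A) :
    t (mulBracket D f (mulBracket D g h)) + t (mulBracket D g (mulBracket D h f)) +
      t (mulBracket D h (mulBracket D f g)) = 0 := by
  have key : ∀ f g h, t (mulBracket D f (mulBracket D g h)) =
      t (mul3 A (leftExt D f (D g h))) - t (mul3 A (leftExt D f (D h g))) := fun f g h => by
    rw [mulBracket_apply D g h, trace_mulBracket_mul' hD t ht, hD.skew h g]
    simp only [map_neg, sub_neg_eq_add]
  -- Expanding the double brackets gives the trace of the triple bracket in the order `f, g, h`
  -- minus that in the order `f, h, g`. Rotations are invisible to the trace, and both triple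
  -- brackets multiply to zero.
  have h1 := congrArg t (hT f g h)
  have h2 := congrArg t (hT f h g)
  simp only [triple_apply, map_add, trace_mul3_rot t ht, map_zero] at h1 h2
  rw [key, key, key]
  have h3 := congrArg₂ (· - ·) h1 h2
  simp only [sub_self] at h3
  rw [← h3]
  abel

end Triple

/-! ### Reduction of the triple bracket to arrows -/

namespace IsLocalizedPathAlgebra

variable {I E : Type*} [Fintype I] {Q : FinQuiver I E} {A : Type*} [Ring A] [Algebra ℂ A]
  {ve : I → A} {ar : DArrow E → A}

/-- All words of `cartanAux` start with `e` in the first factor and end with `e` in the third.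
Multiplying there by the same idempotent changes nothing and multiplying by another one gives zero,
so the two terms of the difference agree. -/
theorem cartanTriple_vert (hA : IsLocalizedPathAlgebra Q ve ar) (f g : A) (s : I) :
    cartanTriple ve f g (ve s) = 0 := by
  classical
  rw [cartanTriple_apply]
  refine smul_eq_zero_of_right _ (Finset.sum_eq_zero fun v _ => ?_)
  simp only [cartanAux, incl1_apply, incl3_apply, mul_add, mul_sub, add_mul, sub_mul,
    Algebra.TensorProduct.tmul_mul_tmul, Algebra.TensorProduct.one_def, one_mul, mul_one]
  by_cases h : s = v
  · subst h
    simp only [mul_assoc, hA.idem, ← mul_assoc (ve s) (ve s)]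
    simp
  · simp only [mul_assoc, hA.orth _ _ h, hA.orth _ _ (Ne.symm h), ← mul_assoc (ve s) (ve v)]
    simp

/-- To compute the triple bracket of an outer double bracket it is enough to do so on arrows. -/
theorem triple_eq_cartanTriple (hA : IsLocalizedPathAlgebra Q ve ar)
    {D : A →ₗ[ℂ] A →ₗ[ℂ] A ⊗[ℂ] A} (hD : IsOuterDoubleBracket D) (hv : ∀ f s, D f (ve s) = 0)
    (ha : ∀ a b c, triple D D (ar a) (ar b) (ar c) = cartanTriple ve (ar a) (ar b) (ar c))
    (f g : A) :
    triple D D f g = cartanTriple ve f g := by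
  have hv' : ∀ s f, D (ve s) f = 0 := fun s =>
    doubleBracket_left_eq_zero hD.skew fun f => hv f s
  have hT : ∀ f g s, triple D D f g (ve s) = 0 := fun f g s => by
    have h0 : leftExt D (ve s) = 0 := by
      have h1 : D (ve s) = 0 := LinearMap.ext (hv' s)
      simp [leftExt, h1]
    rw [triple_apply, hv, hv', h0]
    simp
  have step : ∀ f g, (∀ c, triple D D f g (ar c) = cartanTriple ve f g (ar c)) →
      ∀ h, triple D D f g h = cartanTriple ve f g h := fun f g H =>
    LinearMap.congr_fun (hA.der_ext (triple_der hD f g) (cartanTriple_der ve f g)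
      (fun s => by rw [hT, hA.cartanTriple_vert]) H)
  -- Each step makes the last argument arbitrary. Cyclic symmetry then moves the next arrow into
  -- last position.
  have s1 : ∀ a b h, triple D D (ar a) (ar b) h = cartanTriple ve (ar a) (ar b) h :=
    fun a b => step _ _ fun c => ha a b c
  have s2 : ∀ a g h, triple D D g (ar a) h = cartanTriple ve g (ar a) h :=
    fun a g => step _ _ fun c => by
      rw [triple_rot, cartanTriple_rot, s1]
  have s3 : ∀ f g h, triple D D f g h = cartanTriple ve f g h :=
    fun f g => step _ _ fun c => by
      rw [triple_rot, cartanTriple_rot, s2]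
  exact LinearMap.ext (s3 f g)

end IsLocalizedPathAlgebra

/-! ### Van den Bergh's double bracket -/

namespace DArrow

variable {E : Type*}

@[simp]
theorem star_star (a : DArrow E) : a.star.star = a := by cases a <;> rfl

@[simp]
theorem base_star (a : DArrow E) : a.star.base = a.base := by cases a <;> rfl

@[simp]
theorem sign_star (a : DArrow E) : a.star.sign = -a.sign := by cases a <;> simp [star, sign]

theorem star_ne (a : DArrow E) : a.star ≠ a := by cases a <;> simp [star]

theorem star_inj {a b : DArrow E} : a.star = b.star ↔ a = b :=
  ⟨fun h => by rw [← star_star a, h, star_star], fun h => by rw [h]⟩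

theorem sign_eq_or (a : DArrow E) : a.sign = 1 ∨ a.sign = -1 := by cases a <;> simp [sign]

variable [LinearOrder (DArrow E)]

theorem ord_neg (a b : DArrow E) : ord a b = -ord b a := by
  unfold ord
  rcases lt_trichotomy a b with h | h | h
  · simp [h, h.not_gt]
  · simp [h]
  · simp [h, h.not_gt]

/-- For distinct elements, two of the three products are -1 and one is +1. When exactly two
coincide, only one product survives and it is -1. This is the numerical source of the factor in
`cartanTriple`. -/
theorem ord_cyclic (a b c : DArrow E) :
    ord a b * ord b c + ord b c * ord c a + ord c a * ord a b =
      if a = b ∧ b = c then 0 else -1 := by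
  unfold ord
  rcases lt_trichotomy a b with h | h | h <;> rcases lt_trichotomy b c with h' | h' | h' <;>
    rcases lt_trichotomy a c with h'' | h'' | h'' <;> (try subst h) <;> (try subst h') <;>
    (try subst h'') <;> first
    | (exfalso; order)
    | simp_all [not_lt_of_gt, ne_of_gt, ne_of_lt]

end DArrow

namespace FinQuiver

variable {I E : Type*} (Q : FinQuiver I E)

@[simp]
theorem dtail_star (a : DArrow E) : Q.dtail a.star = Q.dhead a := rfl

@[simp]
theorem dhead_star (a : DArrow E) : Q.dhead a.star = Q.dtail a := by
  rw [dhead, DArrow.star_star]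

end FinQuiver

section Values

variable {I E : Type*} [Fintype I] (Q : FinQuiver I E) (γ : E → ℂ)
  {A : Type*} [Ring A] [Algebra ℂ A] (ve : I → A) (ar : DArrow E → A)

open Classical in
/-- The double bracket of an arrow with its opposite before fusion. -/
noncomputable def edgeValue (a b : DArrow E) : A ⊗[ℂ] A :=
  if b = a.star then
    a.sign • (γ a.base • (ve (Q.dhead a) ⊗ₜ[ℂ] ve (Q.dtail a))
      + (1 / 2 : ℂ) • ((ar b * ar a) ⊗ₜ[ℂ] ve (Q.dtail a))
      + (1 / 2 : ℂ) • (ve (Q.dhead a) ⊗ₜ[ℂ] (ar a * ar b)))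
  else 0

/-- The terms added by fusion to the double bracket of two arrows. -/
noncomputable def fusionValue [LinearOrder (DArrow E)] (a b : DArrow E) : A ⊗[ℂ] A :=
  -((1 / 2 : ℂ) * a.ord b) • ∑ v, ((ve v * ar a) ⊗ₜ[ℂ] (ve v * ar b))
  - ((1 / 2 : ℂ) * a.star.ord b.star) • ∑ v, ((ar b * ve v) ⊗ₜ[ℂ] (ar a * ve v))
  + ((1 / 2 : ℂ) * a.ord b.star) • ∑ v, ((ar b * ve v * ar a) ⊗ₜ[ℂ] ve v)
  + ((1 / 2 : ℂ) * a.star.ord b) • ∑ v, (ve v ⊗ₜ[ℂ] (ar a * ve v * ar b))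

end Values

section Skew

variable {I E : Type*} {Q : FinQuiver I E} {A : Type*} [Ring A] [Algebra ℂ A]
  {ve : I → A} {ar : DArrow E → A}

theorem edgeValue_skew (γ : E → ℂ) (a b : DArrow E) :
    edgeValue Q γ ve ar a b = -TensorProduct.comm ℂ A A (edgeValue Q γ ve ar b a) := by
  unfold edgeValue
  by_cases h : b = a.star
  · subst h
    simp only [DArrow.star_star, if_true, DArrow.sign_star, DArrow.base_star, FinQuiver.dtail_star,
      FinQuiver.dhead_star, map_smul, map_add, TensorProduct.comm_tmul]
    module
  · have h' : a ≠ b.star := fun h' => h (by rw [h', DArrow.star_star])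
    simp [h, h']

theorem fusionValue_skew [Fintype I] [LinearOrder (DArrow E)] (a b : DArrow E) :
    fusionValue ve ar a b = -TensorProduct.comm ℂ A A (fusionValue ve ar b a) := by
  simp only [fusionValue, map_add, map_sub, map_smul, map_sum, TensorProduct.comm_tmul]
  rw [DArrow.ord_neg b a, DArrow.ord_neg b.star a.star, DArrow.ord_neg b a.star,
    DArrow.ord_neg b.star a]
  module

end Skew

namespace IsLocalizedPathAlgebra

variable {I E : Type*} [Fintype I] {Q : FinQuiver I E} {A : Type*} [Ring A] [Algebra ℂ A]
  {ve : I → A} {ar : DArrow E → A}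

theorem vert_mul_arrow_eq [DecidableEq I] (hA : IsLocalizedPathAlgebra Q ve ar) (v : I)
    (a : DArrow E) : ve v * ar a = if v = Q.dtail a then ar a else 0 := by
  rw [← hA.vert_mul_arrow a, ← mul_assoc, hA.vert_mul_vert]
  split_ifs <;> simp

theorem arrow_mul_vert_eq [DecidableEq I] (hA : IsLocalizedPathAlgebra Q ve ar) (v : I)
    (a : DArrow E) : ar a * ve v = if v = Q.dhead a then ar a else 0 := by
  rw [← hA.arrow_mul_vert a, mul_assoc, hA.vert_mul_vert]
  by_cases h : v = Q.dhead a
  · simp [h]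
  · simp [h, Ne.symm h]

/-- Only the tail of `b` contributes. Keeping such sums over all vertices unevaluated makes the
fusion terms uniform, without case distinctions on which vertices coincide. -/
theorem sum_vert_tail (hA : IsLocalizedPathAlgebra Q ve ar) {M : Type*} [AddCommMonoid M]
    [Module ℂ M] (p : I → A →ₗ[ℂ] M) (b : DArrow E) :
    ∑ v, p v (ve v * ar b) = p (Q.dtail b) (ar b) := by
  classical
  rw [Finset.sum_eq_single (Q.dtail b)]
  · rw [hA.vert_mul_arrow]
  · intro v _ hv
    rw [hA.vert_mul_arrow_eq, if_neg hv, map_zero]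
  · simp

theorem sum_vert_head (hA : IsLocalizedPathAlgebra Q ve ar) {M : Type*} [AddCommMonoid M]
    [Module ℂ M] (p : I → A →ₗ[ℂ] M) (b : DArrow E) :
    ∑ v, p v (ar b * ve v) = p (Q.dhead b) (ar b) := by
  classical
  rw [Finset.sum_eq_single (Q.dhead b)]
  · rw [hA.arrow_mul_vert]
  · intro v _ hv
    rw [hA.arrow_mul_vert_eq, if_neg hv, map_zero]
  · simp

theorem sum_tail_tail (hA : IsLocalizedPathAlgebra Q ve ar) (x : A) (b : DArrow E) :
    ∑ v, (ve v * x) ⊗ₜ[ℂ] (ve v * ar b) = (ve (Q.dtail b) * x) ⊗ₜ[ℂ] ar b :=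
  hA.sum_vert_tail (fun v => TensorProduct.mk ℂ A A (ve v * x)) b

theorem sum_head_head (hA : IsLocalizedPathAlgebra Q ve ar) (x : A) (b : DArrow E) :
    ∑ v, (ar b * ve v) ⊗ₜ[ℂ] (x * ve v) = ar b ⊗ₜ[ℂ] (x * ve (Q.dhead b)) :=
  hA.sum_vert_head (fun v => (TensorProduct.mk ℂ A A).flip (x * ve v)) b

theorem sum_tail_head (hA : IsLocalizedPathAlgebra Q ve ar) (x : A) (b : DArrow E) :
    ∑ v, (ar b * ve v * x) ⊗ₜ[ℂ] ve v = (ar b * x) ⊗ₜ[ℂ] ve (Q.dhead b) :=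
  hA.sum_vert_head
    (fun v => (TensorProduct.mk ℂ A A).flip (ve v) ∘ₗ LinearMap.mulRight ℂ x) b

theorem sum_head_tail (hA : IsLocalizedPathAlgebra Q ve ar) (x : A) (b : DArrow E) :
    ∑ v, ve v ⊗ₜ[ℂ] (x * ve v * ar b) = ve (Q.dtail b) ⊗ₜ[ℂ] (x * ar b) := by
  have h := hA.sum_vert_tail
    (fun v => TensorProduct.mk ℂ A A (ve v) ∘ₗ LinearMap.mulLeft ℂ x) b
  simpa [← mul_assoc] using h

section Fusion

variable [LinearOrder (DArrow E)]

theorem fusionValue_eq (hA : IsLocalizedPathAlgebra Q ve ar) (a b : DArrow E) :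
    fusionValue ve ar a b =
      -((1 / 2 : ℂ) * a.ord b) • ((ve (Q.dtail b) * ar a) ⊗ₜ[ℂ] ar b)
      - ((1 / 2 : ℂ) * a.star.ord b.star) • (ar b ⊗ₜ[ℂ] (ar a * ve (Q.dhead b)))
      + ((1 / 2 : ℂ) * a.ord b.star) • ((ar b * ar a) ⊗ₜ[ℂ] ve (Q.dhead b))
      + ((1 / 2 : ℂ) * a.star.ord b) • (ve (Q.dtail b) ⊗ₜ[ℂ] (ar a * ar b)) := by
  rw [fusionValue, hA.sum_tail_tail, hA.sum_head_head, hA.sum_tail_head, hA.sum_head_tail]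

theorem fusionValue_block (hA : IsLocalizedPathAlgebra Q ve ar) (a b : DArrow E) :
    fusionValue ve ar a b =
      inclL A (ve (Q.dtail b)) * fusionValue ve ar a b * inclR A (ve (Q.dhead b)) := by
  simp only [hA.fusionValue_eq, mul_add, add_mul, mul_sub, sub_mul, inclL_apply, inclR_apply,
    mul_smul_comm, smul_mul_assoc, Algebra.TensorProduct.tmul_mul_tmul, one_mul, mul_one,
    ← mul_assoc, hA.idem, hA.vert_mul_arrow, hA.arrow_mul_vert]
  simp only [mul_assoc, hA.idem, hA.arrow_mul_vert]

end Fusion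

theorem edgeValue_block (hA : IsLocalizedPathAlgebra Q ve ar) (γ : E → ℂ) (a b : DArrow E) :
    edgeValue Q γ ve ar a b =
      inclL A (ve (Q.dtail b)) * edgeValue Q γ ve ar a b * inclR A (ve (Q.dhead b)) := by
  unfold edgeValue
  split_ifs with h
  · subst h
    simp only [mul_add, add_mul, inclL_apply, inclR_apply, FinQuiver.dtail_star,
      FinQuiver.dhead_star,
      mul_smul_comm, smul_mul_assoc, Algebra.TensorProduct.tmul_mul_tmul, one_mul, mul_one]
    have h1 := hA.vert_mul_arrow a.star
    have h2 := hA.arrow_mul_vert a.star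
    simp only [FinQuiver.dtail_star, FinQuiver.dhead_star] at h1 h2
    simp only [mul_assoc, h2, hA.idem]
    simp only [← mul_assoc, h1]
  · simp

end IsLocalizedPathAlgebra

/-! ### Bookkeeping of threefold words and the triple bracket of the fusion part -/

section Words

variable {I A : Type*} [Fintype I] [Ring A] [Algebra ℂ A] (ve : I → A)

/-- Threefold tensors in which one idempotent is inserted in each factor. -/
noncomputable def triWord (x x' y y' z z' : A) : (A ⊗[ℂ] A) ⊗[ℂ] A :=
  ∑ v, ((x * ve v * x') ⊗ₜ (y * ve v * y')) ⊗ₜ (z * ve v * z')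

/-- Threefold tensors in which idempotents link the first factor to the two others. -/
noncomputable def linkWord (x m x' y y' z z' : A) : (A ⊗[ℂ] A) ⊗[ℂ] A :=
  ∑ v, ∑ w, ((x * ve v * m * ve w * x') ⊗ₜ (y * ve w * y')) ⊗ₜ (z * ve v * z')

theorem rot_triWord (x x' y y' z z' : A) :
    rot A (triWord ve x x' y y' z z') = triWord ve z z' x x' y y' := by
  simp only [triWord, map_sum, rot_tmul]

theorem cartanTriple_eq_triWord (a b c : A) :
    cartanTriple ve a b c = (1 / 4 : ℂ) • (triWord ve c a 1 b 1 1 - triWord ve c a 1 1 b 1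
      - triWord ve c 1 a b 1 1 + triWord ve c 1 a 1 b 1 - triWord ve 1 a 1 b 1 c
      + triWord ve 1 a 1 1 b c + triWord ve 1 1 a b 1 c - triWord ve 1 1 a 1 b c) := by
  simp only [cartanTriple_apply, cartanAux_terms, triWord, one_mul, mul_one,
    Finset.sum_add_distrib, Finset.sum_sub_distrib]
  congr 1
  abel

end Words

namespace IsLocalizedPathAlgebra

variable {I E : Type*} [Fintype I] {Q : FinQuiver I E} {A : Type*} [Ring A] [Algebra ℂ A]
  {ve : I → A} {ar : DArrow E → A}

theorem sum_vert_mul (hA : IsLocalizedPathAlgebra Q ve ar) {M : Type*} [AddCommMonoid M]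
    [Module ℂ M] (p : I → I → A →ₗ[ℂ] M) :
    ∑ v, ∑ w, p v w (ve v * ve w) = ∑ v, p v v (ve v) := by
  classical
  refine Finset.sum_congr rfl fun v _ => ?_
  rw [Finset.sum_eq_single v]
  · rw [hA.idem]
  · intro w _ hw
    rw [hA.orth _ _ hw.symm, map_zero]
  · simp

section Fusion

variable [LinearOrder (DArrow E)]

/-- Inserting a fusion value into another one gives two kinds of words. When two idempotents meet
they merge, leaving one vertex shared by all three factors (`triWord`). Otherwise an arrow stays
between them (`linkWord`). -/
theorem leftExt_fusion_left (hA : IsLocalizedPathAlgebra Q ve ar) (x z : A) (a b : DArrow E) :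
    ∑ v, (inclL A (x * ve v) * fusionValue ve ar a b) ⊗ₜ[ℂ] (ve v * z) =
      -((1 / 2 : ℂ) * a.ord b) • triWord ve x (ar a) 1 (ar b) 1 z
      - ((1 / 2 : ℂ) * a.star.ord b.star) • linkWord ve x (ar b) 1 (ar a) 1 1 z
      + ((1 / 2 : ℂ) * a.ord b.star) • linkWord ve x (ar b) (ar a) 1 1 1 z
      + ((1 / 2 : ℂ) * a.star.ord b) • triWord ve x 1 (ar a) (ar b) 1 z := by
  have h1 := hA.sum_vert_mul fun v w =>
    (TensorProduct.mk ℂ (A ⊗[ℂ] A) A).flip (ve v * z) ∘ₗ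
      (TensorProduct.mk ℂ A A).flip (ve w * ar b) ∘ₗ LinearMap.mulLeft ℂ x ∘ₗ
        LinearMap.mulRight ℂ (ar a)
  have h2 := hA.sum_vert_mul fun v w =>
    (TensorProduct.mk ℂ (A ⊗[ℂ] A) A).flip (ve v * z) ∘ₗ
      (TensorProduct.mk ℂ A A).flip (ar a * ve w * ar b) ∘ₗ LinearMap.mulLeft ℂ x
  simp only [LinearMap.comp_apply, LinearMap.mulRight_apply, LinearMap.mulLeft_apply,
    LinearMap.flip_apply, TensorProduct.mk_apply, ← mul_assoc] at h1 h2
  simp only [fusionValue, inclL_apply, mul_add, mul_sub, mul_smul_comm, Finset.mul_sum,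
    Algebra.TensorProduct.tmul_mul_tmul, TensorProduct.add_tmul, TensorProduct.sub_tmul,
    ← TensorProduct.smul_tmul', TensorProduct.sum_tmul, Finset.sum_add_distrib,
    Finset.sum_sub_distrib, ← Finset.smul_sum, one_mul, mul_one, triWord, linkWord, ← mul_assoc,
    h1, h2]

theorem leftExt_fusion_right (hA : IsLocalizedPathAlgebra Q ve ar) (y z : A) (a c : DArrow E) :
    ∑ v, (fusionValue ve ar a c * inclR A (ve v * y)) ⊗ₜ[ℂ] (z * ve v) =
      -((1 / 2 : ℂ) * a.ord c) • rot A (linkWord ve 1 (ar c) y z 1 1 (ar a))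
      - ((1 / 2 : ℂ) * a.star.ord c.star) • triWord ve (ar c) 1 (ar a) y z 1
      + ((1 / 2 : ℂ) * a.ord c.star) • triWord ve (ar c) (ar a) 1 y z 1
      + ((1 / 2 : ℂ) * a.star.ord c) • rot A (linkWord ve (ar a) (ar c) y z 1 1 1) := by
  have h1 := hA.sum_vert_mul fun w v =>
    (TensorProduct.mk ℂ (A ⊗[ℂ] A) A).flip (z * ve v) ∘ₗ
      TensorProduct.mk ℂ A A (ar c * ve w) ∘ₗ LinearMap.mulLeft ℂ (ar a) ∘ₗ
        LinearMap.mulRight ℂ y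
  have h2 := hA.sum_vert_mul fun w v =>
    (TensorProduct.mk ℂ (A ⊗[ℂ] A) A).flip (z * ve v) ∘ₗ
      TensorProduct.mk ℂ A A (ar c * ve w * ar a) ∘ₗ LinearMap.mulRight ℂ y
  rw [Finset.sum_comm] at h1 h2
  simp only [LinearMap.comp_apply, LinearMap.mulRight_apply, LinearMap.mulLeft_apply,
    LinearMap.flip_apply, TensorProduct.mk_apply, ← mul_assoc] at h1 h2
  simp only [fusionValue, inclR_apply, add_mul, sub_mul, smul_mul_assoc, Finset.sum_mul,
    Algebra.TensorProduct.tmul_mul_tmul, TensorProduct.add_tmul, TensorProduct.sub_tmul,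
    ← TensorProduct.smul_tmul', TensorProduct.sum_tmul, Finset.sum_add_distrib,
    Finset.sum_sub_distrib, ← Finset.smul_sum, one_mul, mul_one, triWord, linkWord, ← mul_assoc,
    h1, h2, map_sum, rot_tmul]
  have h3 : ∑ v, ∑ w, ((ve w * ar a) ⊗ₜ[ℂ] (ve w * ar c * ve v * y)) ⊗ₜ[ℂ] (z * ve v) =
      ∑ v, ∑ w, ((ve v * ar a) ⊗ₜ[ℂ] (ve v * ar c * ve w * y)) ⊗ₜ[ℂ] (z * ve w) :=
    Finset.sum_comm
  have h4 : ∑ v, ∑ w, (ve w ⊗ₜ[ℂ] (ar a * ve w * ar c * ve v * y)) ⊗ₜ[ℂ] (z * ve v) =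
      ∑ v, ∑ w, (ve v ⊗ₜ[ℂ] (ar a * ve v * ar c * ve w * y)) ⊗ₜ[ℂ] (z * ve w) :=
    Finset.sum_comm
  rw [h3, h4]

/-- The extension to `D' a b` of a double bracket with fusion values. -/
theorem leftExt_fusionValue {D : A →ₗ[ℂ] A →ₗ[ℂ] A ⊗[ℂ] A}
    (hD : IsOuterDoubleBracket D) (hv : ∀ f s, D f (ve s) = 0) (f : A) (b c : DArrow E) :
    leftExt D f (fusionValue ve ar b c) =
      -((1 / 2 : ℂ) * b.ord c) • ∑ v, (inclL A (1 * ve v) * D f (ar b)) ⊗ₜ[ℂ] (ve v * ar c)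
      - ((1 / 2 : ℂ) * b.star.ord c.star) •
        ∑ v, (D f (ar c) * inclR A (ve v * 1)) ⊗ₜ[ℂ] (ar b * ve v)
      + ((1 / 2 : ℂ) * b.ord c.star) •
        (∑ v, (inclL A (ar c * ve v) * D f (ar b)) ⊗ₜ[ℂ] (ve v * 1) +
          ∑ v, (D f (ar c) * inclR A (ve v * ar b)) ⊗ₜ[ℂ] (1 * ve v)) := by
  simp only [fusionValue, map_add, map_sub, map_smul, map_sum, leftExt_tmul, hD.der_right, hv,
    mul_zero, zero_mul, zero_add, add_zero, TensorProduct.zero_tmul, Finset.sum_const_zero,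
    smul_zero, one_mul, mul_one, TensorProduct.add_tmul, Finset.sum_add_distrib]
  have h2 : ∀ x y : A, ((1 : A) ⊗ₜ[ℂ] x) * ((1 : A) ⊗ₜ[ℂ] y) = 1 ⊗ₜ[ℂ] (x * y) := fun x y => by
    rw [Algebra.TensorProduct.tmul_mul_tmul, one_mul]
  simp only [inclL_apply, inclR_apply, mul_assoc, h2]

/-- In the cyclic sum the words `linkWord` cancel by skewness of `ord`. Each of the eight remaining
words collects three products of values of `ord`, whose sum is `S` at the three arrows, starred or
not according to the side on which they are joined. The signs are those of `cartanTriple`. -/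
theorem triple_fusion (hA : IsLocalizedPathAlgebra Q ve ar) {D : A →ₗ[ℂ] A →ₗ[ℂ] A ⊗[ℂ] A}
    (hD : IsOuterDoubleBracket D) (hv : ∀ f s, D f (ve s) = 0)
    (ha : ∀ a b, D (ar a) (ar b) = fusionValue ve ar a b) (S : DArrow E → DArrow E → DArrow E → ℂ)
    (hS : ∀ x y z, DArrow.ord x y * DArrow.ord y z + DArrow.ord y z * DArrow.ord z x +
      DArrow.ord z x * DArrow.ord x y = S x y z) (a b c : DArrow E) :
    triple D D (ar a) (ar b) (ar c) = -(1 / 4 : ℂ) • (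
      S a b c.star • triWord ve (ar c) (ar a) 1 (ar b) 1 1
      - S a b.star c.star • triWord ve (ar c) (ar a) 1 1 (ar b) 1
      - S a.star b c.star • triWord ve (ar c) 1 (ar a) (ar b) 1 1
      + S a.star b.star c.star • triWord ve (ar c) 1 (ar a) 1 (ar b) 1
      - S a b c • triWord ve 1 (ar a) 1 (ar b) 1 (ar c)
      + S a b.star c • triWord ve 1 (ar a) 1 1 (ar b) (ar c)
      + S a.star b c • triWord ve 1 1 (ar a) (ar b) 1 (ar c)
      - S a.star b.star c • triWord ve 1 1 (ar a) 1 (ar b) (ar c)) := by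
  rw [triple_apply, ha, ha, ha]
  simp only [leftExt_fusionValue hD hv, ha, hA.leftExt_fusion_left, hA.leftExt_fusion_right,
    map_add, map_sub, map_smul, rot_triWord, rot_rot_rot, ← hS]
  rw [DArrow.ord_neg a c, DArrow.ord_neg a c.star, DArrow.ord_neg a.star c,
    DArrow.ord_neg a.star c.star, DArrow.ord_neg b a, DArrow.ord_neg b a.star,
    DArrow.ord_neg b.star a, DArrow.ord_neg b.star a.star, DArrow.ord_neg c b,
    DArrow.ord_neg c b.star, DArrow.ord_neg c.star b, DArrow.ord_neg c.star b.star]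
  module

end Fusion

end IsLocalizedPathAlgebra

/-! ### The bracket before fusion -/

section EdgeValue

variable {I E : Type*} {Q : FinQuiver I E} {A : Type*} [Ring A] [Algebra ℂ A]
  {ve : I → A} {ar : DArrow E → A} {γ : E → ℂ}

theorem edgeValue_of_ne {a b : DArrow E} (h : b ≠ a.star) : edgeValue Q γ ve ar a b = 0 :=
  if_neg h

theorem edgeValue_star (a : DArrow E) : edgeValue Q γ ve ar a a.star =
    a.sign • (γ a.base • (ve (Q.dhead a) ⊗ₜ[ℂ] ve (Q.dtail a))
      + (1 / 2 : ℂ) • ((ar a.star * ar a) ⊗ₜ[ℂ] ve (Q.dtail a))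
      + (1 / 2 : ℂ) • (ve (Q.dhead a) ⊗ₜ[ℂ] (ar a * ar a.star))) :=
  if_pos rfl

theorem edgeValue_star_left (a : DArrow E) : edgeValue Q γ ve ar a.star a =
    -a.sign • (γ a.base • (ve (Q.dtail a) ⊗ₜ[ℂ] ve (Q.dhead a))
      + (1 / 2 : ℂ) • ((ar a * ar a.star) ⊗ₜ[ℂ] ve (Q.dhead a))
      + (1 / 2 : ℂ) • (ve (Q.dtail a) ⊗ₜ[ℂ] (ar a.star * ar a))) := by
  have h := edgeValue_star (Q := Q) (γ := γ) (ve := ve) (ar := ar) a.star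
  simpa using h

theorem leftExt_edgeValue {D : A →ₗ[ℂ] A →ₗ[ℂ] A ⊗[ℂ] A}
    (hD : IsOuterDoubleBracket D) (hv : ∀ f s, D f (ve s) = 0) (f : A) (a : DArrow E) :
    leftExt D f (edgeValue Q γ ve ar a a.star) = (a.sign * (1 / 2)) •
      ((inclL A (ar a.star) * D f (ar a) + D f (ar a.star) * inclR A (ar a)) ⊗ₜ[ℂ]
        ve (Q.dtail a)) := by
  rw [edgeValue_star]
  simp only [map_smul, map_add, leftExt_tmul, hv, hD.der_right, TensorProduct.zero_tmul, smul_zero,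
    zero_add, add_zero, inclL_apply, inclR_apply, mul_smul]

theorem leftExt_edgeValue_of_ne {D : A →ₗ[ℂ] A →ₗ[ℂ] A ⊗[ℂ] A}
    (hD : IsOuterDoubleBracket D) (hv : ∀ f s, D f (ve s) = 0)
    (ha : ∀ a b, D (ar a) (ar b) = edgeValue Q γ ve ar a b) {a b c : DArrow E}
    (h : c ≠ b.star ∨ (a ≠ b ∧ a ≠ b.star)) :
    leftExt D (ar a) (edgeValue Q γ ve ar b c) = 0 := by
  by_cases hc : c = b.star
  · have h' : a ≠ b ∧ a ≠ b.star := h.resolve_left (not_not.2 hc)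
    have h1 : b ≠ a.star := fun h1 => h'.2 (by rw [h1, DArrow.star_star])
    have h2 : b.star ≠ a.star := fun h2 => h'.1 (DArrow.star_inj.1 h2).symm
    rw [hc, leftExt_edgeValue hD hv, ha, ha, edgeValue_of_ne h1, edgeValue_of_ne h2]
    simp
  · rw [edgeValue_of_ne hc, map_zero]

/-- Before fusion a double application is nonzero only if the two inner arrows are opposite and the
outer one is one of them. The hypotheses exclude this for each cyclic rotation. -/
theorem triple_edge_self {D : A →ₗ[ℂ] A →ₗ[ℂ] A ⊗[ℂ] A}
    (hD : IsOuterDoubleBracket D) (hv : ∀ f s, D f (ve s) = 0)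
    (ha : ∀ a b, D (ar a) (ar b) = edgeValue Q γ ve ar a b) {a b c : DArrow E}
    (h1 : b = a.star → c ≠ a ∧ c ≠ b) (h2 : c = b.star → a ≠ b ∧ a ≠ c)
    (h3 : a = c.star → b ≠ c ∧ b ≠ a) : triple D D (ar a) (ar b) (ar c) = 0 := by
  have key : ∀ {a b c : DArrow E}, (c = b.star → a ≠ b ∧ a ≠ c) →
      leftExt D (ar a) (edgeValue Q γ ve ar b c) = 0 := fun {a b c} h => by
    refine leftExt_edgeValue_of_ne hD hv ha ?_
    by_cases hc : c = b.star
    · exact Or.inr (hc ▸ h hc)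
    · exact Or.inl hc
  rw [triple_apply, ha, ha, ha, key h1, key h2, key h3]
  simp

end EdgeValue

namespace IsLocalizedPathAlgebra

variable {I E : Type*} [Fintype I] {Q : FinQuiver I E} {A : Type*} [Ring A] [Algebra ℂ A]
  {ve : I → A} {ar : DArrow E → A} {γ : E → ℂ}

theorem star_mul_vert (hA : IsLocalizedPathAlgebra Q ve ar) (a : DArrow E) :
    ar a.star * ve (Q.dtail a) = ar a.star := by
  simpa using hA.arrow_mul_vert a.star

theorem vert_mul_star (hA : IsLocalizedPathAlgebra Q ve ar) (a : DArrow E) :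
    ve (Q.dhead a) * ar a.star = ar a.star := by
  simpa using hA.vert_mul_arrow a.star

theorem sum_edgeValue_left (hA : IsLocalizedPathAlgebra Q ve ar) (x z : A) (a : DArrow E) :
    ∑ v, (inclL A (x * ve v) * edgeValue Q γ ve ar a a.star) ⊗ₜ[ℂ] (ve v * z) =
      a.sign • (γ a.base •
          (((x * ve (Q.dhead a)) ⊗ₜ[ℂ] ve (Q.dtail a)) ⊗ₜ[ℂ] (ve (Q.dhead a) * z))
        + (1 / 2 : ℂ) • (((x * ar a.star * ar a) ⊗ₜ[ℂ] ve (Q.dtail a)) ⊗ₜ[ℂ] (ve (Q.dhead a) * z))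
        + (1 / 2 : ℂ) •
          (((x * ve (Q.dhead a)) ⊗ₜ[ℂ] (ar a * ar a.star)) ⊗ₜ[ℂ] (ve (Q.dhead a) * z))) := by
  rw [edgeValue_star]
  have key : ∀ p q : A, ve (Q.dhead a) * p = p →
      ∑ v, ((x * ve v * p) ⊗ₜ[ℂ] q) ⊗ₜ[ℂ] (ve v * z) =
        ((x * p) ⊗ₜ[ℂ] q) ⊗ₜ[ℂ] (ve (Q.dhead a) * z) := by
    intro p q hp
    rw [Finset.sum_eq_single (Q.dhead a)]
    · rw [mul_assoc, hp]
    · intro v _ hne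
      rw [← hp, mul_assoc, ← mul_assoc (ve v), hA.orth _ _ hne]
      simp
    · simp
  have h1 := key _ (ve (Q.dtail a)) (hA.idem (Q.dhead a))
  have h2 := key (ar a.star * ar a) (ve (Q.dtail a)) (by rw [← mul_assoc, hA.vert_mul_star])
  have h3 := key _ (ar a * ar a.star) (hA.idem (Q.dhead a))
  rw [← mul_assoc x] at h2
  simp only [inclL_apply, mul_add, mul_smul_comm, smul_add,
    Algebra.TensorProduct.tmul_mul_tmul, TensorProduct.add_tmul,
    ← TensorProduct.smul_tmul', Finset.sum_add_distrib, ← Finset.smul_sum, one_mul, h1, h2, h3]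

theorem sum_edgeValue_right (hA : IsLocalizedPathAlgebra Q ve ar) (y z : A) (a : DArrow E) :
    ∑ v, (edgeValue Q γ ve ar a.star a * inclR A (ve v * y)) ⊗ₜ[ℂ] (z * ve v) =
      -a.sign • (γ a.base •
          ((ve (Q.dtail a) ⊗ₜ[ℂ] (ve (Q.dhead a) * y)) ⊗ₜ[ℂ] (z * ve (Q.dhead a)))
        + (1 / 2 : ℂ) •
          (((ar a * ar a.star) ⊗ₜ[ℂ] (ve (Q.dhead a) * y)) ⊗ₜ[ℂ] (z * ve (Q.dhead a)))
        + (1 / 2 : ℂ) •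
          ((ve (Q.dtail a) ⊗ₜ[ℂ] (ar a.star * ar a * y)) ⊗ₜ[ℂ] (z * ve (Q.dhead a)))) := by
  rw [edgeValue_star_left]
  have key : ∀ p q : A, q * ve (Q.dhead a) = q →
      ∑ v, (p ⊗ₜ[ℂ] (q * (ve v * y))) ⊗ₜ[ℂ] (z * ve v) =
        (p ⊗ₜ[ℂ] (q * y)) ⊗ₜ[ℂ] (z * ve (Q.dhead a)) := by
    intro p q hq
    rw [Finset.sum_eq_single (Q.dhead a)]
    · rw [← mul_assoc, hq]
    · intro v _ hne
      rw [← hq, mul_assoc, ← mul_assoc (ve _) (ve v), hA.orth _ _ hne.symm]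
      simp
    · simp
  have h1 := key (ve (Q.dtail a)) _ (hA.idem (Q.dhead a))
  have h2 := key (ar a * ar a.star) _ (hA.idem (Q.dhead a))
  have h3 := key (ve (Q.dtail a)) (ar a.star * ar a) (by rw [mul_assoc, hA.arrow_mul_vert])
  simp only [inclR_apply, add_mul, smul_mul_assoc, smul_add,
    Algebra.TensorProduct.tmul_mul_tmul, TensorProduct.add_tmul,
    ← TensorProduct.smul_tmul', Finset.sum_add_distrib, ← Finset.smul_sum, mul_one, h1, h2, h3]

/-! ### Cancellation of the terms mixing edge and fusion values -/

section Mixed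

variable [LinearOrder (DArrow E)]

/-- The contribution of a pair of arrows to the mixed triple brackets. -/
noncomputable def mixedTerm (ve : I → A) (ar : DArrow E → A) (D₀ D₁ : A →ₗ[ℂ] A →ₗ[ℂ] A ⊗[ℂ] A)
    (a b c : DArrow E) : (A ⊗[ℂ] A) ⊗[ℂ] A :=
  -((1 / 2 : ℂ) * b.ord c) • ∑ v, (inclL A (1 * ve v) * D₀ (ar a) (ar b)) ⊗ₜ[ℂ] (ve v * ar c)
  + ((1 / 2 : ℂ) * b.ord c.star) •
    ∑ v, (inclL A (ar c * ve v) * D₀ (ar a) (ar b)) ⊗ₜ[ℂ] (ve v * 1)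
  + rot A (-((1 / 2 : ℂ) * c.star.ord a.star) •
      ∑ v, (D₀ (ar b) (ar a) * inclR A (ve v * 1)) ⊗ₜ[ℂ] (ar c * ve v)
    + ((1 / 2 : ℂ) * c.ord a.star) •
      ∑ v, (D₀ (ar b) (ar a) * inclR A (ve v * ar c)) ⊗ₜ[ℂ] (1 * ve v))
  + rot A (rot A (leftExt D₁ (ar c) (D₀ (ar a) (ar b))))

/-- If `b` is not opposite to `a`, all edge brackets involved vanish. If it is, everything is an
explicit combination of words in `a`, its opposite and `c`, and the two groups of coefficients are
opposite because `ord` is skew. -/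
theorem mixedTerm_eq_zero (hA : IsLocalizedPathAlgebra Q ve ar)
    {D₀ D₁ : A →ₗ[ℂ] A →ₗ[ℂ] A ⊗[ℂ] A}
    (h₁ : IsOuterDoubleBracket D₁) (hv₁ : ∀ f s, D₁ f (ve s) = 0)
    (ha₀ : ∀ a b, D₀ (ar a) (ar b) = edgeValue Q γ ve ar a b)
    (ha₁ : ∀ a b, D₁ (ar a) (ar b) = fusionValue ve ar a b) (a b c : DArrow E) :
    mixedTerm ve ar D₀ D₁ a b c = 0 := by
  by_cases hb : b = a.star
  · subst hb
    rw [mixedTerm]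
    simp only [ha₀, hA.sum_edgeValue_left, hA.sum_edgeValue_right, leftExt_edgeValue h₁ hv₁, ha₁,
      hA.fusionValue_eq, FinQuiver.dtail_star, FinQuiver.dhead_star, DArrow.star_star]
    have hsa : ∀ x, ar a.star * (ve (Q.dtail a) * x) = ar a.star * x := fun x => by
      rw [← mul_assoc, hA.star_mul_vert]
    simp only [inclL_apply, inclR_apply, mul_add, add_mul, mul_sub, sub_mul, mul_smul_comm,
      smul_mul_assoc, Algebra.TensorProduct.tmul_mul_tmul, one_mul, mul_one,
      TensorProduct.add_tmul, TensorProduct.sub_tmul, ← TensorProduct.smul_tmul', map_add, map_sub,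
      map_smul, rot_tmul, mul_assoc, hsa, hA.vert_mul_arrow, hA.star_mul_vert]
    rw [DArrow.ord_neg a.star c, DArrow.ord_neg a.star c.star]
    module
  · have hb' : a ≠ b.star := fun h => hb (by rw [h, DArrow.star_star])
    simp only [mixedTerm, ha₀, edgeValue_of_ne hb, edgeValue_of_ne hb', mul_zero, zero_mul,
      TensorProduct.zero_tmul, Finset.sum_const_zero, smul_zero, map_zero, add_zero]

/-- The terms of the two cyclic sums are regrouped according to the pair of arrows on which the edge
bracket is evaluated. Each group is zero by itself. -/
theorem triple_mixed (hA : IsLocalizedPathAlgebra Q ve ar) {D₀ D₁ : A →ₗ[ℂ] A →ₗ[ℂ] A ⊗[ℂ] A}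
    (h₀ : IsOuterDoubleBracket D₀) (h₁ : IsOuterDoubleBracket D₁)
    (hv₀ : ∀ f s, D₀ f (ve s) = 0) (hv₁ : ∀ f s, D₁ f (ve s) = 0)
    (ha₀ : ∀ a b, D₀ (ar a) (ar b) = edgeValue Q γ ve ar a b)
    (ha₁ : ∀ a b, D₁ (ar a) (ar b) = fusionValue ve ar a b) (a b c : DArrow E) :
    triple D₀ D₁ (ar a) (ar b) (ar c) + triple D₁ D₀ (ar a) (ar b) (ar c) = 0 := by
  have h : triple D₀ D₁ (ar a) (ar b) (ar c) + triple D₁ D₀ (ar a) (ar b) (ar c) =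
      mixedTerm ve ar D₀ D₁ a b c + rot A (mixedTerm ve ar D₀ D₁ b c a) +
        rot A (rot A (mixedTerm ve ar D₀ D₁ c a b)) := by
    rw [triple_apply, triple_apply, ha₁, ha₁, ha₁]
    simp only [leftExt_fusionValue h₀ hv₀, mixedTerm, map_add, map_sub, map_smul, rot_rot_rot]
    module
  rw [h]
  simp only [hA.mixedTerm_eq_zero h₁ hv₁ ha₀ ha₁, map_zero, add_zero]

end Mixed

theorem triWord_sum_head (hA : IsLocalizedPathAlgebra Q ve ar) (y y' z z' x' : A) (a : DArrow E) :
    triWord ve (ar a) x' y y' z z' = ((ar a * x') ⊗ₜ[ℂ] (y * ve (Q.dhead a) * y')) ⊗ₜ[ℂ]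
      (z * ve (Q.dhead a) * z') :=
  hA.sum_vert_head (fun v => (TensorProduct.mk ℂ _ A).flip (z * ve v * z') ∘ₗ
    (TensorProduct.mk ℂ A A).flip (y * ve v * y') ∘ₗ LinearMap.mulRight ℂ x') a

theorem triWord_sum_tail (hA : IsLocalizedPathAlgebra Q ve ar) (y y' z z' : A) (a : DArrow E) :
    triWord ve 1 (ar a) y y' z z' = (ar a ⊗ₜ[ℂ] (y * ve (Q.dtail a) * y')) ⊗ₜ[ℂ]
      (z * ve (Q.dtail a) * z') := by
  have h := hA.sum_vert_tail (fun v => (TensorProduct.mk ℂ _ A).flip (z * ve v * z') ∘ₗ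
    (TensorProduct.mk ℂ A A).flip (y * ve v * y')) a
  simpa [triWord] using h

/-! ### The nonzero triple brackets before fusion, and the quasi-Poisson identity -/

section Edge

variable {D : A →ₗ[ℂ] A →ₗ[ℂ] A ⊗[ℂ] A}

/-- Up to rotation and exchange of an arrow with its opposite, this is the only nonzero triple
bracket before fusion. The contributions of `γ` cancel. -/
theorem triple_edge_star (hA : IsLocalizedPathAlgebra Q ve ar) (hD : IsOuterDoubleBracket D)
    (hv : ∀ f s, D f (ve s) = 0)
    (ha : ∀ a b, D (ar a) (ar b) = edgeValue Q γ ve ar a b) (a : DArrow E) :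
    triple D D (ar a) (ar a.star) (ar a) = (1 / 4 : ℂ) •
      (triWord ve 1 (ar a) 1 1 (ar a.star) (ar a) -
        triWord ve (ar a) 1 (ar a) (ar a.star) 1 1) := by
  have e1 := leftExt_edgeValue (γ := γ) (Q := Q) (ar := ar) hD hv (ar a) a.star
  have e2 : leftExt D (ar a.star) (edgeValue Q γ ve ar a a) = 0 := by
    rw [edgeValue_of_ne (DArrow.star_ne a).symm, map_zero]
  have e3 := leftExt_edgeValue (γ := γ) (Q := Q) (ar := ar) hD hv (ar a) a
  have z : D (ar a) (ar a) = 0 := by rw [ha, edgeValue_of_ne (DArrow.star_ne a).symm]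
  rw [DArrow.star_star] at e1
  rw [triple_apply, ha, ha, ha, e1, e2, e3, z, ha, edgeValue_star, hA.triWord_sum_tail,
    hA.triWord_sum_head]
  simp only [inclL_apply, inclR_apply, mul_add, add_mul, mul_smul_comm, mul_zero, zero_mul,
    smul_mul_assoc, Algebra.TensorProduct.tmul_mul_tmul, one_mul, mul_one, add_zero, zero_add,
    TensorProduct.add_tmul, ← TensorProduct.smul_tmul', map_add, map_zero,
    map_smul, rot_tmul, mul_assoc, hA.arrow_mul_vert, hA.vert_mul_arrow, DArrow.sign_star,
    FinQuiver.dtail_star, hA.star_mul_vert, smul_add, smul_smul]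
  obtain h | h := DArrow.sign_eq_or a <;> rw [h] <;> module

end Edge

section QuasiPoisson

variable [LinearOrder (DArrow E)]

/-- The fusion part equals the right hand side except for the words whose three (possibly starred)
arrows coincide, where the coefficient is 0 instead of -1. This can occur only if `b` and `c` both
lie in `{a, a*}`, and the cases below restore these words. -/
theorem triple_arrow (hA : IsLocalizedPathAlgebra Q ve ar) {D₀ D₁ : A →ₗ[ℂ] A →ₗ[ℂ] A ⊗[ℂ] A}
    (h₀ : IsOuterDoubleBracket D₀) (h₁ : IsOuterDoubleBracket D₁)
    (hv₀ : ∀ f s, D₀ f (ve s) = 0) (hv₁ : ∀ f s, D₁ f (ve s) = 0)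
    (ha₀ : ∀ a b, D₀ (ar a) (ar b) = edgeValue Q γ ve ar a b)
    (ha₁ : ∀ a b, D₁ (ar a) (ar b) = fusionValue ve ar a b) (a b c : DArrow E) :
    triple (D₀ + D₁) (D₀ + D₁) (ar a) (ar b) (ar c) = cartanTriple ve (ar a) (ar b) (ar c) := by
  classical
  have h : triple (D₀ + D₁) (D₀ + D₁) (ar a) (ar b) (ar c) =
      triple D₀ D₀ (ar a) (ar b) (ar c) + triple D₁ D₁ (ar a) (ar b) (ar c) +
        (triple D₀ D₁ (ar a) (ar b) (ar c) + triple D₁ D₀ (ar a) (ar b) (ar c)) := by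
    simp only [triple_apply, LinearMap.add_apply, leftExt, LinearMap.comp_add, map_add]
    abel
  rw [h, hA.triple_mixed h₀ h₁ hv₀ hv₁ ha₀ ha₁, hA.triple_fusion h₁ hv₁ ha₁ _ DArrow.ord_cyclic,
    cartanTriple_eq_triWord]
  have hne := DArrow.star_ne (E := E)
  have hne' : ∀ x : DArrow E, x ≠ x.star := fun x => (hne x).symm
  by_cases hb : b = a
  · subst hb
    by_cases hc : c = b
    · subst hc
      -- For three equal arrows the two missing words, one with no star and one with all stars, are
      -- equal and have opposite signs in `cartanTriple`.
      have hw : triWord ve (ar c) 1 (ar c) 1 (ar c) 1 = triWord ve 1 (ar c) 1 (ar c) 1 (ar c) := by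
        rw [hA.triWord_sum_head, hA.triWord_sum_tail]
        simp only [mul_one, one_mul, hA.arrow_mul_vert, hA.vert_mul_arrow]
      rw [triple_edge_self h₀ hv₀ ha₀ (fun h => absurd h (hne' _)) (fun h => absurd h (hne' _))
        (fun h => absurd h (hne' _)), hw]
      simp only [hne, hne', if_true, if_false, and_true, and_false, and_self]
      module
    · by_cases hc' : c = b.star
      · subst hc'
        -- A rotation brings this triple to the form arrow, opposite, arrow.
        have e := triple_rot D₀ D₀ (ar b) (ar b) (ar b.star)
        rw [hA.triple_edge_star h₀ hv₀ ha₀] at e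
        rw [e]
        simp only [map_smul, map_sub, rot_triWord, hne, hne', DArrow.star_star, if_true, if_false,
          and_true, and_false, and_self]
        module
      · rw [triple_edge_self h₀ hv₀ ha₀ (fun h => absurd h (hne' _)) (fun h => absurd h hc')
          (fun h => absurd (by rw [h, DArrow.star_star]) hc')]
        have g1 : b ≠ c := Ne.symm hc
        have g2 : b ≠ c.star := fun h => hc' (by rw [h, DArrow.star_star])
        have g3 : b.star ≠ c := Ne.symm hc'
        have g4 : b.star ≠ c.star := fun h => g1 (DArrow.star_inj.1 h)
        simp only [g1, g2, g3, g4, if_false, and_false]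
        module
  · by_cases hb' : b = a.star
    · subst hb'
      by_cases hc : c = a
      · subst hc
        rw [hA.triple_edge_star h₀ hv₀ ha₀]
        simp only [hne, hne', DArrow.star_star, if_true, if_false, and_true, and_false, and_self]
        module
      · by_cases hc' : c = a.star
        · subst hc'
          have e := triple_rot D₀ D₀ (ar a) (ar a.star) (ar a.star)
          have e' := hA.triple_edge_star h₀ hv₀ ha₀ a.star
          rw [DArrow.star_star] at e'
          rw [triple_rot D₀ D₀ (ar a.star) (ar a.star) (ar a), e'] at e
          rw [e]
          simp only [map_smul, map_sub, rot_triWord, hne, hne', DArrow.star_star, if_true, if_false,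
            and_true, and_false, and_self]
          module
        · rw [triple_edge_self h₀ hv₀ ha₀ (fun _ => ⟨hc, hc'⟩)
            (fun h => absurd (h.trans (DArrow.star_star a)) hc)
            (fun h => absurd (by rw [h, DArrow.star_star]) hc')]
          have g1 : a ≠ c := Ne.symm hc
          have g2 : a ≠ c.star := fun h => hc' (by rw [h, DArrow.star_star])
          have g3 : a.star ≠ c := Ne.symm hc'
          have g4 : a.star ≠ c.star := fun h => g1 (DArrow.star_inj.1 h)
          simp only [hne, hne', DArrow.star_star, g1, g2, g3, g4, if_false, and_false]
          module
    · have g1 : a ≠ b := Ne.symm hb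
      have g2 : a ≠ b.star := fun h => hb' (by rw [h, DArrow.star_star])
      have g3 : a.star ≠ b := Ne.symm hb'
      have g4 : a.star ≠ b.star := fun h => g1 (DArrow.star_inj.1 h)
      rw [triple_edge_self h₀ hv₀ ha₀ (fun h => absurd h hb') (fun h => ⟨g1, h ▸ g2⟩)
        (fun h => ⟨fun h' => g2 (h' ▸ h), hb⟩)]
      simp only [g1, g2, g3, g4, if_false, false_and]
      module

/-- Existence of Van den Bergh's double quasi-Poisson bracket. -/
theorem exists_quasiPoisson_bracket {A : Type*} [Ring A] [Algebra ℂ A] {ve : I → A}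
    {ar : DArrow E → A} (hA : IsLocalizedPathAlgebra Q ve ar) (γ : E → ℂ) :
    ∃ D : A →ₗ[ℂ] A →ₗ[ℂ] A ⊗[ℂ] A, IsOuterDoubleBracket D ∧ (∀ f s, D f (ve s) = 0) ∧
      (∀ a b, D (ar a) (ar b) = edgeValue Q γ ve ar a b + fusionValue ve ar a b) ∧
      ∀ f g, triple D D f g = cartanTriple ve f g := by
  obtain ⟨D₀, h₀, hv₀, ha₀⟩ := hA.exists_outer (edgeValue Q γ ve ar) (hA.edgeValue_block γ)
    (edgeValue_skew γ)
  obtain ⟨D₁, h₁, hv₁, ha₁⟩ := hA.exists_outer (fusionValue ve ar) hA.fusionValue_block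
    (fusionValue_skew)
  have hD : IsOuterDoubleBracket (D₀ + D₁) :=
    { skew := fun f g => by
        simp only [LinearMap.add_apply, map_add]
        rw [h₀.skew f g, h₁.skew f g]
        abel
      der_right := fun f => (h₀.right f).add (h₁.right f)
      der_left := fun f g h => (h₀.left h).add (h₁.left h) f g }
  have hv : ∀ f s, (D₀ + D₁) f (ve s) = 0 := fun f s => by
    simp only [LinearMap.add_apply, hv₀, hv₁, add_zero]
  refine ⟨D₀ + D₁, hD, hv, fun a b => ?_, ?_⟩
  · simp only [LinearMap.add_apply, ha₀, ha₁]
  · exact hA.triple_eq_cartanTriple hD hv fun a b c =>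
      hA.triple_arrow h₀ h₁ hv₀ hv₁ ha₀ ha₁ a b c

end QuasiPoisson

end IsLocalizedPathAlgebra

/-! ### Poisson brackets on commutative algebras -/

/-- Skew-symmetric biderivations. -/
structure IsSkewBiderivation {R : Type*} [CommRing R] [Algebra ℂ R]
    (b : R →ₗ[ℂ] R →ₗ[ℂ] R) : Prop where
  skew : ∀ f g, b f g = -b g f
  leibniz : ∀ f g h, b f (g * h) = b f g * h + g * b f h

section Poisson

variable {R : Type*} [CommRing R] [Algebra ℂ R] {b : R →ₗ[ℂ] R →ₗ[ℂ] R}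

theorem IsPoissonBracket.isSkewBiderivation (hb : IsPoissonBracket b) : IsSkewBiderivation b :=
  ⟨hb.skew, hb.leibniz⟩

namespace IsSkewBiderivation

/-- The derivation `b f`. -/
noncomputable def ham (hb : IsSkewBiderivation b) (f : R) : Derivation ℂ R R :=
  Derivation.mk' (b f) fun g h => by
    rw [hb.leibniz, smul_eq_mul, smul_eq_mul]
    ring

@[simp]
theorem ham_apply (hb : IsSkewBiderivation b) (f g : R) : hb.ham f g = b f g := rfl

theorem leibniz_left (hb : IsSkewBiderivation b) (f g h : R) :
    b (f * g) h = b f h * g + f * b g h := by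
  rw [hb.skew, hb.leibniz, hb.skew f h, hb.skew g h]
  ring

/-- The Jacobiator of a skew biderivation, which is a derivation in its last argument. -/
noncomputable def jacobiator (hb : IsSkewBiderivation b) (f g : R) : Derivation ℂ R R :=
  ⁅hb.ham f, hb.ham g⁆ - hb.ham (b f g)

theorem jacobiator_apply (hb : IsSkewBiderivation b) (f g h : R) :
    hb.jacobiator f g h = b f (b g h) + b g (b h f) + b h (b f g) := by
  simp only [jacobiator, Derivation.sub_apply, Derivation.commutator_apply, ham_apply]
  rw [hb.skew h f, hb.skew h (b f g), map_neg]
  ring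

theorem jacobiator_cyclic (hb : IsSkewBiderivation b) (f g h : R) :
    hb.jacobiator f g h = hb.jacobiator g h f := by
  rw [jacobiator_apply, jacobiator_apply]
  ring

end IsSkewBiderivation

/-- Derivations are determined by their values on `G`. -/
def DeterminesDerivations (G : Set R) : Prop :=
  ∀ d : Derivation ℂ R R, (∀ x ∈ G, d x = 0) → d = 0

theorem DeterminesDerivations.ext {G : Set R} (hG : DeterminesDerivations G)
    {d d' : Derivation ℂ R R} (h : ∀ x ∈ G, d x = d' x) : d = d' :=
  sub_eq_zero.1 (hG _ fun x hx => by rw [Derivation.sub_apply, h x hx, sub_self])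

/-- Replace the arguments by arbitrary elements one at a time: each is moved into the derivation
slot by cyclic symmetry. -/
theorem DeterminesDerivations.ext3 {G : Set R} (hG : DeterminesDerivations G)
    {T T' : R → R → Derivation ℂ R R} (hT : ∀ f g h, T f g h = T g h f)
    (hT' : ∀ f g h, T' f g h = T' g h f)
    (h : ∀ x ∈ G, ∀ y ∈ G, ∀ z ∈ G, T x y z = T' x y z) (f g k : R) : T f g k = T' f g k := by
  have h1 : ∀ x ∈ G, ∀ y ∈ G, ∀ f, T x y f = T' x y f := fun x hx y hy f => by
    rw [hG.ext (h x hx y hy)]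
  have h2 : ∀ x ∈ G, ∀ f g, T f x g = T' f x g := fun x hx f g => by
    rw [hG.ext (d := T f x) (d' := T' f x) fun y hy => by rw [hT, hT', h1 x hx y hy]]
  rw [hG.ext (d := T f g) (d' := T' f g) fun y hy => by rw [hT, hT', h2 y hy]]

theorem DeterminesDerivations.ext2 {G : Set R} (hG : DeterminesDerivations G)
    {b b' : R →ₗ[ℂ] R →ₗ[ℂ] R} (hb : IsSkewBiderivation b) (hb' : IsSkewBiderivation b')
    (h : ∀ x ∈ G, ∀ y ∈ G, b x y = b' x y) : b = b' := by
  have h1 : ∀ x ∈ G, ∀ f, b x f = b' x f := fun x hx f => by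
    have : hb.ham x = hb'.ham x := hG.ext (h x hx)
    exact DFunLike.congr_fun this f
  ext f g
  have : hb.ham f = hb'.ham f := hG.ext fun x hx => by
    rw [hb.ham_apply, hb'.ham_apply, hb.skew, hb'.skew, h1 x hx]
  exact DFunLike.congr_fun this g

theorem IsSkewBiderivation.isPoissonBracket {G : Set R} (hG : DeterminesDerivations G)
    (hb : IsSkewBiderivation b)
    (h : ∀ x ∈ G, ∀ y ∈ G, ∀ z ∈ G, b x (b y z) + b y (b z x) + b z (b x y) = 0) :
    IsPoissonBracket b where
  skew := hb.skew
  leibniz := hb.leibniz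
  jacobi f g k := by
    rw [← hb.jacobiator_apply]
    exact hG.ext3 (T' := fun _ _ => 0) hb.jacobiator_cyclic (fun _ _ _ => rfl)
      (fun x hx y hy z hz => by rw [hb.jacobiator_apply, h x hx y hy z hz]; rfl) f g k

/-! ### Deformation by commuting derivations -/

/-- The bracket defined by the wedge product of two derivations. -/
noncomputable def derWedge (V W : Derivation ℂ R R) : R →ₗ[ℂ] R →ₗ[ℂ] R :=
  (LinearMap.mul ℂ R).compl₁₂ (V : R →ₗ[ℂ] R) (W : R →ₗ[ℂ] R) -
    (LinearMap.mul ℂ R).compl₁₂ (W : R →ₗ[ℂ] R) (V : R →ₗ[ℂ] R)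

theorem derWedge_apply (V W : Derivation ℂ R R) (f g : R) :
    derWedge V W f g = V f * W g - W f * V g := rfl

theorem derWedge_isSkewBiderivation (V W : Derivation ℂ R R) :
    IsSkewBiderivation (derWedge V W) where
  skew f g := by simp only [derWedge_apply]; ring
  leibniz f g h := by
    simp only [derWedge_apply, Derivation.leibniz, smul_eq_mul]
    ring

theorem IsSkewBiderivation.add_smul {b' : R →ₗ[ℂ] R →ₗ[ℂ] R} (hb : IsSkewBiderivation b)
    (hb' : IsSkewBiderivation b') (c : ℂ) : IsSkewBiderivation (b + c • b') where
  skew f g := by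
    simp only [LinearMap.add_apply, LinearMap.smul_apply]
    rw [hb.skew, hb'.skew, smul_neg, neg_add]
  leibniz f g h := by
    simp only [LinearMap.add_apply, LinearMap.smul_apply, hb.leibniz, hb'.leibniz, smul_add,
      add_mul, mul_add, smul_mul_assoc, mul_smul_comm]
    ring

/-- `V` is a derivation of the bracket `b`. -/
def PreservesBracket (V : Derivation ℂ R R) (b : R →ₗ[ℂ] R →ₗ[ℂ] R) : Prop :=
  ∀ f g, V (b f g) = b (V f) g + b f (V g)

theorem add_derWedge_apply (V W : Derivation ℂ R R) (c : ℂ) (f g : R) :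
    (b + c • derWedge V W) f g = b f g + c • (V f * W g - W f * V g) := rfl

theorem PreservesBracket.add_wedge {U V W : Derivation ℂ R R} (hU : PreservesBracket U b)
    (hV : ∀ f, U (V f) = V (U f)) (hW : ∀ f, U (W f) = W (U f)) (c : ℂ) :
    PreservesBracket U (b + c • derWedge V W) := fun f g => by
  simp only [add_derWedge_apply, map_add, Derivation.map_smul, hU f g, map_sub,
    Derivation.leibniz, smul_eq_mul, hV, hW]
  simp only [Algebra.smul_def (A := R)]
  ring

/-- The terms of the Jacobiator linear in `c` cancel because `V` and `W` are derivations of `b`, and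
the quadratic ones because `V` and `W` commute. -/
theorem IsPoissonBracket.add_wedge (hb : IsPoissonBracket b) {V W : Derivation ℂ R R}
    (hV : PreservesBracket V b) (hW : PreservesBracket W b) (hVW : ∀ f, V (W f) = W (V f))
    (c : ℂ) : IsPoissonBracket (b + c • derWedge V W) where
  skew := (hb.isSkewBiderivation.add_smul (derWedge_isSkewBiderivation V W) c).skew
  leibniz := (hb.isSkewBiderivation.add_smul (derWedge_isSkewBiderivation V W) c).leibniz
  jacobi f g h := by
    have hs := hb.skew
    have hV' : ∀ f g, V (b f g) = b (V f) g + b f (V g) := hV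
    have hW' : ∀ f g, W (b f g) = b (W f) g + b f (W g) := hW
    simp only [add_derWedge_apply, map_add, map_sub, map_smul, hb.leibniz,
      Derivation.leibniz, smul_eq_mul, hVW, hV', hW']
    simp only [Algebra.smul_def (A := R)]
    -- This gives each bracket with one differentiated argument a fixed orientation, so that a
    -- purely polynomial identity remains.
    rw [hs (V g) h, hs (V h) f, hs (V f) g, hs (W g) h, hs (W h) f, hs (W f) g]
    linear_combination hb.jacobi f g h

theorem IsPoissonBracket.smul (hb : IsPoissonBracket b) (c : ℂ) : IsPoissonBracket (c • b) where
  skew f g := by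
    simp only [LinearMap.smul_apply]
    rw [hb.skew, smul_neg]
  leibniz f g h := by
    simp only [LinearMap.smul_apply, hb.leibniz, smul_add, smul_mul_assoc, mul_smul_comm]
  jacobi f g h := by
    simp only [LinearMap.smul_apply, map_smul, ← smul_add, hb.jacobi, smul_zero]

theorem PreservesBracket.smul {V : Derivation ℂ R R} (hV : PreservesBracket V b) (c : ℂ) :
    PreservesBracket V (c • b) := fun f g => by
  simp only [LinearMap.smul_apply, Derivation.map_smul, hV f g, smul_add]

/-- The bracket `∑ m_{ij} V_i ∧ V_j`. -/
noncomputable def wedgeSum {ι : Type*} [Fintype ι] (m : ι → ι → ℂ) (V : ι → Derivation ℂ R R) :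
    R →ₗ[ℂ] R →ₗ[ℂ] R :=
  ∑ p : ι × ι, m p.1 p.2 • derWedge (V p.1) (V p.2)

theorem wedgeSum_apply {ι : Type*} [Fintype ι] (m : ι → ι → ℂ) (V : ι → Derivation ℂ R R)
    (f g : R) :
    wedgeSum m V f g = ∑ i, ∑ j, m i j • (V i f * V j g - V j f * V i g) := by
  simp only [wedgeSum, LinearMap.sum_apply, LinearMap.smul_apply, derWedge_apply,
    Fintype.sum_prod_type]

theorem IsPoissonBracket.add_wedgeSum (hb : IsPoissonBracket b) {ι : Type*} [Fintype ι]
    (m : ι → ι → ℂ) (V : ι → Derivation ℂ R R) (hV : ∀ i, PreservesBracket (V i) b)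
    (hc : ∀ i j f, V i (V j f) = V j (V i f)) : IsPoissonBracket (b + wedgeSum m V) := by
  classical
  -- The induction must carry along that all `V i` preserve the partial sums, since this is the
  -- hypothesis for adding the next wedge.
  have key : ∀ s : Finset (ι × ι),
      IsPoissonBracket (b + ∑ p ∈ s, m p.1 p.2 • derWedge (V p.1) (V p.2)) ∧
        ∀ i, PreservesBracket (V i) (b + ∑ p ∈ s, m p.1 p.2 • derWedge (V p.1) (V p.2)) := by
    intro s
    induction s using Finset.induction_on with
    | empty => simpa using ⟨hb, hV⟩
    | insert p s hp ih =>
      rw [Finset.sum_insert hp, add_comm (m p.1 p.2 • _), ← add_assoc]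
      exact ⟨ih.1.add_wedge (ih.2 _) (ih.2 _) (hc _ _) _,
        fun i => (ih.2 i).add_wedge (hc _ _) (hc _ _) _⟩
  exact (key Finset.univ).1

theorem isPoissonBracket_zero : IsPoissonBracket (0 : R →ₗ[ℂ] R →ₗ[ℂ] R) where
  skew f g := by simp
  leibniz f g h := by simp
  jacobi f g h := by simp

/-- The failure of `U` to be a derivation of `b` is itself a skew biderivation, and it vanishes on
`G`. -/
theorem preservesBracket_of_determines {G : Set R} (hG : DeterminesDerivations G)
    (hb : IsSkewBiderivation b) {U : Derivation ℂ R R}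
    (h : ∀ x ∈ G, ∀ y ∈ G, U (b x y) = b (U x) y + b x (U y)) : PreservesBracket U b := by
  let b' : R →ₗ[ℂ] R →ₗ[ℂ] R :=
    b.compr₂ (U : R →ₗ[ℂ] R) - (b ∘ₗ (U : R →ₗ[ℂ] R) + b.compl₂ (U : R →ₗ[ℂ] R))
  have hb' : ∀ f g, b' f g = U (b f g) - (b (U f) g + b f (U g)) := fun f g => rfl
  have hs : IsSkewBiderivation b' :=
    { skew := fun f g => by
        rw [hb', hb', hb.skew f g, hb.skew (U f) g, hb.skew f (U g), map_neg]
        ring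
      leibniz := fun f g h => by
        simp only [hb', hb.leibniz, map_add, Derivation.leibniz, smul_eq_mul]
        ring }
  have h0 : b' = 0 := hG.ext2 hs isPoissonBracket_zero.isSkewBiderivation fun x hx y hy => by
    rw [hb', h x hx y hy, sub_self]
    rfl
  intro f g
  rw [← sub_eq_zero, ← hb', h0]
  rfl

theorem DeterminesDerivations.commute {G : Set R} (hG : DeterminesDerivations G)
    {V W : Derivation ℂ R R} (h : ∀ x ∈ G, V (W x) = W (V x)) (f : R) : V (W f) = W (V f) := by
  have h0 : ⁅V, W⁆ = 0 := hG _ fun x hx => by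
    rw [Derivation.commutator_apply, h x hx, sub_self]
  rw [← sub_eq_zero, ← Derivation.commutator_apply, h0]
  rfl

end Poisson

/-! ### Brackets on symmetric algebras -/

namespace SymmetricAlgebra

variable {V : Type*} [AddCommGroup V] [Module ℂ V]

theorem determinesDerivations : DeterminesDerivations (Set.range (ι ℂ V)) := by
  intro d hd
  ext x
  induction x using SymmetricAlgebra.induction with
  | algebraMap r => simp
  | ι x => simpa using hd _ ⟨x, rfl⟩
  | mul a b ha hb => rw [Derivation.leibniz, ha, hb]; simp
  | add a b ha hb => rw [map_add, ha, hb]; simp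

/-- A derivation is the nilpotent part of an algebra map to the trivial square-zero extension that
lifts the identity. Such a map is given by a linear map on `V`. -/
theorem exists_derivation (δ : V →ₗ[ℂ] SymmetricAlgebra ℂ V) :
    ∃ d : Derivation ℂ (SymmetricAlgebra ℂ V) (SymmetricAlgebra ℂ V), ∀ v, d (ι ℂ V v) = δ v := by
  let S := SymmetricAlgebra ℂ V
  let p : V →ₗ[ℂ] TrivSqZeroExt S S :=
    { toFun := fun v => TrivSqZeroExt.inl (ι ℂ V v) + TrivSqZeroExt.inr (δ v)
      map_add' := fun v w => by
        ext <;> simp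
      map_smul' := fun c v => by
        ext <;> simp }
  let F : S →ₐ[ℂ] TrivSqZeroExt S S := SymmetricAlgebra.lift p
  have hF : ∀ v, F (ι ℂ V v) = TrivSqZeroExt.inl (ι ℂ V v) + TrivSqZeroExt.inr (δ v) :=
    fun v => SymmetricAlgebra.lift_ι_apply p v
  have hfst : ∀ x, (F x).fst = x := by
    intro x
    have h : (TrivSqZeroExt.fstHom ℂ S S).comp F = AlgHom.id ℂ S := by
      refine SymmetricAlgebra.algHom_ext (LinearMap.ext fun v => ?_)
      change (F (ι ℂ V v)).fst = ι ℂ V v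
      rw [hF]
      simp
    exact DFunLike.congr_fun h x
  let D : S →ₗ[ℂ] S :=
    { toFun := fun x => (F x).snd
      map_add' := fun x y => by simp
      map_smul' := fun c x => by simp }
  refine ⟨Derivation.mk' D fun x y => ?_, fun v => ?_⟩
  · simp only [D, LinearMap.coe_mk, AddHom.coe_mk, map_mul, TrivSqZeroExt.snd_mul, hfst,
      MulOpposite.smul_eq_mul_unop, MulOpposite.unop_op, smul_eq_mul]
    ring
  · simp [D, hF]

/-- Extend in the second argument for fixed `v`, then in the first. Skewness spreads from generators
one argument at a time, by uniqueness of derivations. -/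
theorem exists_biderivation (β : V →ₗ[ℂ] V →ₗ[ℂ] SymmetricAlgebra ℂ V)
    (hβ : ∀ v w, β v w = -β w v) :
    ∃ b : SymmetricAlgebra ℂ V →ₗ[ℂ] SymmetricAlgebra ℂ V →ₗ[ℂ] SymmetricAlgebra ℂ V,
      IsSkewBiderivation b ∧ ∀ v w, b (ι ℂ V v) (ι ℂ V w) = β v w := by
  have hext := fun (d d' : Derivation ℂ (SymmetricAlgebra ℂ V) (SymmetricAlgebra ℂ V))
    (h : ∀ v, d (ι ℂ V v) = d' (ι ℂ V v)) =>
      determinesDerivations.ext (d := d) (d' := d') (by rintro _ ⟨v, rfl⟩; exact h v)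
  choose R hR using fun v => exists_derivation (β v)
  have Radd : ∀ v w, R (v + w) = R v + R w := fun v w => hext _ _ fun x => by simp [hR]
  have Rsmul : ∀ (c : ℂ) v, R (c • v) = c • R v := fun c v => hext _ _ fun x => by simp [hR]
  let Rl : SymmetricAlgebra ℂ V → V →ₗ[ℂ] SymmetricAlgebra ℂ V := fun g =>
    { toFun := fun v => R v g, map_add' := fun v w => by simp [Radd],
      map_smul' := fun c v => by simp [Rsmul] }
  choose S hS using fun g => exists_derivation (Rl g)
  have hS' : ∀ g v, S g (ι ℂ V v) = R v g := hS
  let b : SymmetricAlgebra ℂ V →ₗ[ℂ] SymmetricAlgebra ℂ V →ₗ[ℂ] SymmetricAlgebra ℂ V :=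
    LinearMap.mk₂ ℂ (fun f g => S g f) (fun f f' g => map_add _ _ _)
      (fun c f g => Derivation.map_smul _ _ _)
      (fun f g g' => by
        rw [hext (S (g + g')) (S g + S g') fun v => by simp [hS']]; rfl)
      (fun c f g => by rw [hext (S (c • g)) (c • S g) fun v => by simp [hS']]; rfl)
  have hb : ∀ f g, b f g = S g f := fun f g => rfl
  have hleib : ∀ f g h, b f (g * h) = b f g * h + g * b f h := fun f g h => by
    rw [hb, hb, hb, hext (S (g * h)) (g • S h + h • S g) fun v => by
      simp [hS', Derivation.leibniz]]
    simp only [Derivation.add_apply, Derivation.smul_apply, smul_eq_mul]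
    ring
  have hval : ∀ v w, b (ι ℂ V v) (ι ℂ V w) = β v w := fun v w => by rw [hb, hS', hR]
  let H : SymmetricAlgebra ℂ V → Derivation ℂ (SymmetricAlgebra ℂ V) (SymmetricAlgebra ℂ V) :=
    fun f => Derivation.mk' (b f) fun g h => by
      rw [hleib, smul_eq_mul, smul_eq_mul]
      ring
  have hH : ∀ f g, H f g = b f g := fun f g => rfl
  have h1 : ∀ v g, b (ι ℂ V v) g = -b g (ι ℂ V v) := fun v g => by
    have h2 : ∀ v, H (ι ℂ V v) = -S (ι ℂ V v) := fun v => hext _ _ fun w => by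
      rw [hH, Derivation.neg_apply, ← hb, hval, hval, hβ]
    have h3 := DFunLike.congr_fun (h2 v) g
    rwa [hH, Derivation.neg_apply, ← hb] at h3
  refine ⟨b, ⟨fun f g => ?_, hleib⟩, hval⟩
  have h2 : S g = -H g := hext _ _ fun v => by
    rw [← hb, Derivation.neg_apply, hH, h1]
  rw [hb, h2, Derivation.neg_apply, hH]

end SymmetricAlgebra

/-! ### Brackets on `Sym (H_0(A))` -/

section HZero

theorem Submodule.exists_liftQ₂ {M N : Type*} [AddCommGroup M] [Module ℂ M] [AddCommGroup N]
    [Module ℂ N] (W : Submodule ℂ M) (B : M →ₗ[ℂ] M →ₗ[ℂ] N) (h1 : ∀ f, ∀ w ∈ W, B f w = 0)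
    (h2 : ∀ f, ∀ w ∈ W, B w f = 0) :
    ∃ β : M ⧸ W →ₗ[ℂ] M ⧸ W →ₗ[ℂ] N, ∀ f g, β (W.mkQ f) (W.mkQ g) = B f g := by
  let C : M ⧸ W →ₗ[ℂ] M →ₗ[ℂ] N := W.liftQ B.flip fun w hw =>
    LinearMap.mem_ker.2 (LinearMap.ext fun f => h1 f w hw)
  have hC : ∀ f g, C (W.mkQ g) f = B f g := fun f g => rfl
  refine ⟨W.liftQ C.flip fun w hw => LinearMap.mem_ker.2 (LinearMap.ext fun g => ?_),
    fun f g => rfl⟩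
  obtain ⟨g, rfl⟩ := W.mkQ_surjective g
  exact h2 g w hw

variable {A : Type*} [Ring A] [Algebra ℂ A]

theorem mkQ_mul_comm (x y : A) :
    (commutatorSpan A).mkQ (x * y) = (commutatorSpan A).mkQ (y * x) := by
  rw [← sub_eq_zero, ← map_sub, Submodule.mkQ_apply, Submodule.Quotient.mk_eq_zero]
  exact Submodule.subset_span ⟨x, y, rfl⟩

theorem symTr_apply (x : A) :
    symTr x = SymmetricAlgebra.ι ℂ (HZero A) ((commutatorSpan A).mkQ x) := rfl

theorem symTr_mul_comm (x y : A) : symTr (x * y) = symTr (y * x) := by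
  rw [symTr_apply, symTr_apply, mkQ_mul_comm]

theorem determinesDerivations_symTr : DeterminesDerivations (Set.range (symTr (A := A))) := by
  intro d hd
  refine SymmetricAlgebra.determinesDerivations d ?_
  rintro _ ⟨v, rfl⟩
  obtain ⟨x, rfl⟩ := (commutatorSpan A).mkQ_surjective v
  exact hd _ ⟨x, rfl⟩

theorem symTr_mul'_comm (x : A ⊗[ℂ] A) :
    symTr (LinearMap.mul' ℂ A (TensorProduct.comm ℂ A A x)) = symTr (LinearMap.mul' ℂ A x) := by
  induction x with
  | zero => simp
  | add x y hx hy => simp only [map_add, hx, hy]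
  | tmul x y => simp [symTr_mul_comm x y]

variable {D : A →ₗ[ℂ] A →ₗ[ℂ] A ⊗[ℂ] A}

theorem mulBracket_der (hD : IsOuterDoubleBracket D) (f g h : A) :
    mulBracket D f (g * h) = g * mulBracket D f h + mulBracket D f g * h := by
  have h1 : ∀ y : A ⊗[ℂ] A, LinearMap.mul' ℂ A ((g ⊗ₜ 1) * y) = g * LinearMap.mul' ℂ A y := by
    intro y
    induction y with
    | zero => simp
    | add x y hx hy => simp only [mul_add, map_add, hx, hy]
    | tmul p q => simp [mul_assoc]
  have h2 : ∀ y : A ⊗[ℂ] A, LinearMap.mul' ℂ A (y * (1 ⊗ₜ h)) = LinearMap.mul' ℂ A y * h := by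
    intro y
    induction y with
    | zero => simp
    | add x y hx hy => simp only [add_mul, map_add, hx, hy]
    | tmul p q => simp [mul_assoc]
  rw [mulBracket_apply, hD.der_right, map_add, h1, h2]
  rfl

theorem symTr_mulBracket_skew (hD : IsOuterDoubleBracket D) (f g : A) :
    symTr (mulBracket D f g) = -symTr (mulBracket D g f) := by
  rw [mulBracket_apply, hD.skew, map_neg, map_neg, symTr_mul'_comm]
  rfl

theorem eq_zero_of_mem_commutatorSpan {M : Type*} [AddCommGroup M] [Module ℂ M] {t : A →ₗ[ℂ] M}
    (ht : ∀ x y, t (x * y) = t (y * x)) {w : A} (hw : w ∈ commutatorSpan A) : t w = 0 := by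
  have h : commutatorSpan A ≤ LinearMap.ker t := by
    refine Submodule.span_le.2 ?_
    rintro _ ⟨x, y, rfl⟩
    exact LinearMap.mem_ker.2 (by rw [map_sub, ht, sub_self])
  exact h hw

/-- The map `m ∘ D` is a derivation in its second argument, hence preserves commutators there.
Modulo commutators it is skew, so it descends in both arguments. Jacobi is needed only on traces. -/
theorem exists_inducedByOuter (hD : IsOuterDoubleBracket D)
    (hT : ∀ f g h, mul3 A (triple D D f g h) = 0) :
    ∃ b, IsPoissonBracket b ∧ IsInducedByOuter D b := by
  have h1 : ∀ f, ∀ w ∈ commutatorSpan A, (mulBracket D).compr₂ symTr f w = 0 := fun f w hw => by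
    refine eq_zero_of_mem_commutatorSpan (fun x y => ?_) hw
    simp only [LinearMap.compr₂_apply, mulBracket_der hD, map_add]
    rw [symTr_mul_comm x, symTr_mul_comm _ y, add_comm]
  have h2 : ∀ f, ∀ w ∈ commutatorSpan A, (mulBracket D).compr₂ symTr w f = 0 := fun f w hw => by
    rw [LinearMap.compr₂_apply, symTr_mulBracket_skew hD, ← LinearMap.compr₂_apply, h1 f w hw,
      neg_zero]
  obtain ⟨β, hβ⟩ := (commutatorSpan A).exists_liftQ₂ ((mulBracket D).compr₂ symTr) h1 h2
  obtain ⟨b, hb, hval⟩ := SymmetricAlgebra.exists_biderivation β fun v w => by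
    obtain ⟨x, rfl⟩ := (commutatorSpan A).mkQ_surjective v
    obtain ⟨y, rfl⟩ := (commutatorSpan A).mkQ_surjective w
    rw [hβ, hβ]
    exact symTr_mulBracket_skew hD x y
  have hind : ∀ f g, b (symTr f) (symTr g) = symTr (mulBracket D f g) := fun f g => by
    rw [symTr_apply, symTr_apply, hval, hβ]
    rfl
  refine ⟨b, hb.isPoissonBracket determinesDerivations_symTr ?_, hind⟩
  rintro _ ⟨x, rfl⟩ _ ⟨y, rfl⟩ _ ⟨z, rfl⟩
  simp only [hind]
  exact trace_mulBracket_jacobi hD hT symTr symTr_mul_comm x y z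

theorem inducedByOuter_unique {b b' : SymmetricAlgebra ℂ (HZero A) →ₗ[ℂ]
      SymmetricAlgebra ℂ (HZero A) →ₗ[ℂ] SymmetricAlgebra ℂ (HZero A)}
    (hb : IsPoissonBracket b) (hb' : IsPoissonBracket b') (h : IsInducedByOuter D b)
    (h' : IsInducedByOuter D b') : b = b' :=
  determinesDerivations_symTr.ext2 hb.isSkewBiderivation hb'.isSkewBiderivation <| by
    rintro _ ⟨x, rfl⟩ _ ⟨y, rfl⟩
    rw [h, h']

theorem inducedByRight_unique {b b' : SymmetricAlgebra ℂ (HZero A) →ₗ[ℂ]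
      SymmetricAlgebra ℂ (HZero A) →ₗ[ℂ] SymmetricAlgebra ℂ (HZero A)}
    (hb : IsPoissonBracket b) (hb' : IsPoissonBracket b') (h : IsInducedByRight D b)
    (h' : IsInducedByRight D b') : b = b' :=
  determinesDerivations_symTr.ext2 hb.isSkewBiderivation hb'.isSkewBiderivation <| by
    rintro _ ⟨x, rfl⟩ _ ⟨y, rfl⟩
    rw [h, h']

/-- A derivation of an algebra induces a derivation of `Sym (H_0(A))`. -/
theorem exists_symDerivation {d : A →ₗ[ℂ] A}
    (hd : IsTwistedDer (AlgHom.id ℂ A) (AlgHom.id ℂ A) d) :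
    ∃ U : Derivation ℂ (SymmetricAlgebra ℂ (HZero A)) (SymmetricAlgebra ℂ (HZero A)),
      ∀ f, U (symTr f) = symTr (d f) := by
  obtain ⟨U, hU⟩ := SymmetricAlgebra.exists_derivation
    ((commutatorSpan A).liftQ (symTr ∘ₗ d) fun w hw => LinearMap.mem_ker.2
      (eq_zero_of_mem_commutatorSpan (fun x y => by
        simp only [LinearMap.comp_apply, hd x y, hd y x, AlgHom.id_apply, map_add]
        rw [symTr_mul_comm x, symTr_mul_comm y, add_comm]) hw))
  exact ⟨U, fun f => hU _⟩

/-- The double bracket `∑ m_{ij} d_i ∧ d_j`. -/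
noncomputable def rightWedge {ι : Type*} [Fintype ι] (m : ι → ι → ℂ) (d : ι → A →ₗ[ℂ] A) :
    A →ₗ[ℂ] A →ₗ[ℂ] A ⊗[ℂ] A :=
  ∑ i, ∑ j, m i j • ((TensorProduct.mk ℂ A A).compl₁₂ (d i) (d j) -
    (TensorProduct.mk ℂ A A).compl₁₂ (d j) (d i))

theorem rightWedge_apply {ι : Type*} [Fintype ι] (m : ι → ι → ℂ) (d : ι → A →ₗ[ℂ] A) (f g : A) :
    rightWedge m d f g = ∑ i, ∑ j, m i j • (d i f ⊗ₜ[ℂ] d j g - d j f ⊗ₜ[ℂ] d i g) := by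
  simp [rightWedge]

theorem rightWedge_isRightDoubleBracket {ι : Type*} [Fintype ι] (m : ι → ι → ℂ)
    {d : ι → A →ₗ[ℂ] A} (hd : ∀ i, IsTwistedDer (AlgHom.id ℂ A) (AlgHom.id ℂ A) (d i)) :
    IsRightDoubleBracket (rightWedge m d) where
  skew f g := by
    simp only [rightWedge_apply, map_sum, map_smul, map_sub, TensorProduct.comm_tmul,
      ← Finset.sum_neg_distrib, ← smul_neg, neg_sub]
  der_right f g h := by
    simp only [rightWedge_apply, hd _ g h, AlgHom.id_apply, TensorProduct.tmul_add,
      Finset.mul_sum, Finset.sum_mul, mul_smul_comm, smul_mul_assoc, mul_sub, sub_mul,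
      Algebra.TensorProduct.tmul_mul_tmul, one_mul, mul_one, ← Finset.sum_add_distrib, ← smul_add]
    refine Finset.sum_congr rfl fun i _ => Finset.sum_congr rfl fun j _ => ?_
    congr 1
    abel
  der_left f g h := by
    simp only [rightWedge_apply, hd _ f g, AlgHom.id_apply, TensorProduct.add_tmul,
      Finset.mul_sum, Finset.sum_mul, mul_smul_comm, smul_mul_assoc, mul_sub, sub_mul,
      Algebra.TensorProduct.tmul_mul_tmul, one_mul, mul_one, ← Finset.sum_add_distrib, ← smul_add]
    refine Finset.sum_congr rfl fun i _ => Finset.sum_congr rfl fun j _ => ?_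
    congr 1
    abel

theorem wedgeSum_inducedByRight {ι : Type*} [Fintype ι] (m : ι → ι → ℂ) (d : ι → A →ₗ[ℂ] A)
    (U : ι → Derivation ℂ (SymmetricAlgebra ℂ (HZero A)) (SymmetricAlgebra ℂ (HZero A)))
    (hU : ∀ i f, U i (symTr f) = symTr (d i f)) :
    IsInducedByRight (rightWedge m d) (wedgeSum m U) := fun f g => by
  simp only [wedgeSum_apply, rightWedge_apply, hU, map_sum, map_smul, map_sub,
    TensorProduct.map_tmul, LinearMap.mul'_apply]

/-- The derivation of `A ⊗ A` induced by a derivation of `A`. -/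
noncomputable def tensorDer (d : A →ₗ[ℂ] A) : A ⊗[ℂ] A →ₗ[ℂ] A ⊗[ℂ] A :=
  d.rTensor A + d.lTensor A

theorem tensorDer_tmul (d : A →ₗ[ℂ] A) (x y : A) :
    tensorDer d (x ⊗ₜ y) = d x ⊗ₜ y + x ⊗ₜ d y := by
  simp [tensorDer]

theorem tensorDer_mul {d : A →ₗ[ℂ] A} (hd : IsTwistedDer (AlgHom.id ℂ A) (AlgHom.id ℂ A) d)
    (x y : A ⊗[ℂ] A) : tensorDer d (x * y) = tensorDer d x * y + x * tensorDer d y := by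
  induction x with
  | zero => simp
  | add x x' hx hx' => simp only [add_mul, map_add, hx, hx']; abel
  | tmul p q =>
    induction y with
    | zero => simp
    | add y y' hy hy' => simp only [mul_add, map_add, hy, hy']; abel
    | tmul p' q' =>
      simp only [Algebra.TensorProduct.tmul_mul_tmul, tensorDer_tmul, hd _ _, AlgHom.id_apply,
        TensorProduct.add_tmul, TensorProduct.tmul_add, add_mul, mul_add]
      abel

theorem mul'_tensorDer {d : A →ₗ[ℂ] A} (hd : IsTwistedDer (AlgHom.id ℂ A) (AlgHom.id ℂ A) d)
    (x : A ⊗[ℂ] A) : LinearMap.mul' ℂ A (tensorDer d x) = d (LinearMap.mul' ℂ A x) := by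
  induction x with
  | zero => simp
  | add x y hx hy => simp only [map_add, hx, hy]
  | tmul x y => simp [tensorDer_tmul, hd x y, add_comm]

end HZero

/-! ### Scaling derivations -/

namespace DArrow

variable {E : Type*}

open Classical in
/-- The weight of an arrow for the derivation which scales the arrow `i` and its opposite. -/
noncomputable def weight (i : E) (a : DArrow E) : ℂ := if a.base = i then -a.sign else 0

theorem weight_star (i : E) (a : DArrow E) : weight i a.star = -weight i a := by
  unfold weight
  rw [base_star, sign_star]
  split_ifs <;> simp

end DArrow

namespace IsLocalizedPathAlgebra

variable {I E : Type*} [Fintype I] {Q : FinQuiver I E} {A : Type*} [Ring A] [Algebra ℂ A]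
  {ve : I → A} {ar : DArrow E → A}

theorem exists_scaling (hA : IsLocalizedPathAlgebra Q ve ar) (i : E) :
    ∃ d : A →ₗ[ℂ] A, IsTwistedDer (AlgHom.id ℂ A) (AlgHom.id ℂ A) d ∧ (∀ s, d (ve s) = 0) ∧
      ∀ a, d (ar a) = DArrow.weight i a • ar a :=
  hA.exists_der A _ _ _ fun a => by
    rw [AlgHom.id_apply, AlgHom.id_apply, mul_smul_comm, smul_mul_assoc, ← hA.arrow]

/-- Scalings are derivations of a double bracket whose values are homogeneous. -/
theorem tensorDer_outer [LinearOrder (DArrow E)] (hA : IsLocalizedPathAlgebra Q ve ar)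
    {γ : E → ℂ} {D : A →ₗ[ℂ] A →ₗ[ℂ] A ⊗[ℂ] A} (hD : IsOuterDoubleBracket D)
    (hv : ∀ f s, D f (ve s) = 0)
    (ha : ∀ a b, D (ar a) (ar b) = edgeValue Q γ ve ar a b + fusionValue ve ar a b)
    {i : E} {d : A →ₗ[ℂ] A} (hd : IsTwistedDer (AlgHom.id ℂ A) (AlgHom.id ℂ A) d)
    (hd0 : ∀ s, d (ve s) = 0) (hda : ∀ a, d (ar a) = DArrow.weight i a • ar a) (f g : A) :
    tensorDer d (D f g) = D (d f) g + D f (d g) := by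
  have hv' : ∀ s f, D (ve s) f = 0 := fun s =>
    doubleBracket_left_eq_zero hD.skew fun f => hv f s
  have h1 : ∀ x, tensorDer d (inclL A x) = inclL A (d x) := fun x => by
    rw [inclL_apply, tensorDer_tmul, hd.map_one, TensorProduct.tmul_zero, add_zero]; rfl
  have h2 : ∀ x, tensorDer d (inclR A x) = inclR A (d x) := fun x => by
    rw [inclR_apply, tensorDer_tmul, hd.map_one, TensorProduct.zero_tmul, zero_add]; rfl
  -- The defect of `d` as a derivation of `D` obeys the outer Leibniz rules, so it suffices to see
  -- it vanish on arrows.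
  let G : A →ₗ[ℂ] A →ₗ[ℂ] A ⊗[ℂ] A := D.compr₂ (tensorDer d) - (D ∘ₗ d + D.compl₂ d)
  have hG : ∀ f g, G f g = tensorDer d (D f g) - (D (d f) g + D f (d g)) := fun f g => rfl
  have key : G = 0 := by
    refine hA.pairing_ext (l := inclL A) (r := inclR A) (l' := inclR A) (r' := inclL A)
      (fun f g h => ?_) (fun f => IsTwistedDer.zero) (fun h f g => ?_) (fun f => IsTwistedDer.zero)
      (fun f s => ?_) (fun f s => ?_) (fun a b => ?_)
    · simp only [hG, hd g h, AlgHom.id_apply, map_add, hD.right _ _ _, tensorDer_mul hd, h1, h2,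
        mul_sub, sub_mul, mul_add, add_mul]
      abel
    · simp only [LinearMap.flip_apply]
      have hl : ∀ f g h, D (f * g) h = inclR A f * D g h + D f h * inclL A g := hD.der_left
      simp only [hG, hd f g, AlgHom.id_apply, map_add, LinearMap.add_apply, hl,
        tensorDer_mul hd, h1, h2, mul_sub, sub_mul, mul_add, add_mul]
      abel
    · simp [hG, hv, hd0]
    · simp [hG, hv', hd0]
    · have hm : ∀ x y, d (x * y) = x * d y + d x * y := hd
      -- The values on arrows have weight equal to the sum of the two weights. The term in `γ` fits
      -- because opposite arrows have opposite weights.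
      have hs : tensorDer d (edgeValue Q γ ve ar a b + fusionValue ve ar a b) =
          (DArrow.weight i a + DArrow.weight i b) •
            (edgeValue Q γ ve ar a b + fusionValue ve ar a b) := by
        rw [map_add, smul_add]
        congr 1
        · unfold edgeValue
          split_ifs with h
          · subst h
            simp only [map_smul, map_add, tensorDer_tmul, hm, hd0, hda, mul_smul_comm,
              smul_mul_assoc, DArrow.weight_star, TensorProduct.add_tmul, TensorProduct.tmul_add,
              TensorProduct.zero_tmul, TensorProduct.tmul_zero, ← TensorProduct.smul_tmul',
              TensorProduct.tmul_smul]
            module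
          · simp
        · simp only [hA.fusionValue_eq, map_smul, map_add, map_sub, tensorDer_tmul, hm, hd0, hda,
            mul_smul_comm, smul_mul_assoc, zero_mul, mul_zero, zero_add, add_zero,
            TensorProduct.add_tmul, TensorProduct.tmul_add,
            TensorProduct.zero_tmul, TensorProduct.tmul_zero, ← TensorProduct.smul_tmul',
            TensorProduct.tmul_smul]
          module
      rw [hG, hda, hda, map_smul, LinearMap.smul_apply, map_smul, ha, hs, ← add_smul, sub_self]
      rfl
  rw [← sub_eq_zero, ← hG, key]
  rfl

end IsLocalizedPathAlgebra

/-! ### The brackets of a localised path algebra -/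

section Right

variable {I E : Type*} [Fintype I] [Fintype E] [LinearOrder (DArrow E)] {Q : FinQuiver I E}

/-- The constants `z a b` for `a < b`, extended by zero. -/
def DArrow.upper (z : E → E → ℂ) (i j : E) : ℂ :=
  if DArrow.fwd i < DArrow.fwd j then z i j else 0

theorem DArrow.sum_weight_mul_weight {E : Type*} [Fintype E] (p : E → E → ℂ) (a b : DArrow E) :
    ∑ i, ∑ j, p i j * (DArrow.weight i a * DArrow.weight j b) =
      p a.base b.base * (a.sign * b.sign) := by
  classical
  simp [DArrow.weight]

/-- The two minus signs in the weights multiply to `ε(a) ε(b)`. The wedge turns the upper triangular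
constants into their skew extension. -/
theorem DArrow.sum_upper_weight (z : E → E → ℂ) (a b : DArrow E) :
    ∑ i, ∑ j, DArrow.upper z i j * (DArrow.weight i a * DArrow.weight j b
      - DArrow.weight j a * DArrow.weight i b) = a.sign * b.sign * DArrow.skewExt z a b := by
  simp only [mul_sub, Finset.sum_sub_distrib, mul_comm (DArrow.weight _ a) (DArrow.weight _ b),
    DArrow.sum_weight_mul_weight]
  have h := DArrow.sum_weight_mul_weight (DArrow.upper z) a b
  simp only [mul_comm (DArrow.weight _ a)] at h
  rw [h]
  unfold DArrow.skewExt DArrow.upper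
  split_ifs with h h'
  · exact absurd h' h.not_gt
  · ring
  · ring
  · ring

theorem rightWedge_arrow {A : Type*} [Ring A] [Algebra ℂ A] {ar : DArrow E → A} (z : E → E → ℂ)
    {d : E → A →ₗ[ℂ] A} (hd : ∀ i a, d i (ar a) = DArrow.weight i a • ar a) (a b : DArrow E) :
    rightWedge (DArrow.upper z) d (ar a) (ar b) =
      (a.sign * b.sign * DArrow.skewExt z a b) • (ar a ⊗ₜ[ℂ] ar b) := by
  rw [← DArrow.sum_upper_weight, rightWedge_apply]
  simp only [hd, ← TensorProduct.smul_tmul', TensorProduct.tmul_smul, smul_smul, ← sub_smul,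
    ← Finset.sum_smul]
  congr 1
  refine Finset.sum_congr rfl fun i _ => Finset.sum_congr rfl fun j _ => ?_
  ring

end Right

namespace IsLocalizedPathAlgebra

variable {I E : Type*} [Fintype I] [LinearOrder (DArrow E)] {Q : FinQuiver I E} {A : Type*}
  [Ring A] [Algebra ℂ A] {ve : I → A} {ar : DArrow E → A}

/-- The two forms differ only in which idempotents are written out. When the relevant vertices
differ, the products involved vanish. -/
theorem edgeValue_add_fusionValue (hA : IsLocalizedPathAlgebra Q ve ar) (γ : E → ℂ)
    (a b : DArrow E) :
    edgeValue Q γ ve ar a b + fusionValue ve ar a b =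
      (if b = a.star then
        a.sign • (γ a.base • (ve (Q.dhead a) ⊗ₜ[ℂ] ve (Q.dtail a))
          + (1 / 2 : ℂ) • ((ar b * ar a) ⊗ₜ[ℂ] ve (Q.dtail a))
          + (1 / 2 : ℂ) • (ve (Q.dhead a) ⊗ₜ[ℂ] (ar a * ar b)))
        else 0)
      - ((1 / 2 : ℂ) * a.ord b) • ((ve (Q.dtail b) * ar a) ⊗ₜ[ℂ] (ve (Q.dtail a) * ar b))
      - ((1 / 2 : ℂ) * a.star.ord b.star) •
          ((ar b * ve (Q.dhead a)) ⊗ₜ[ℂ] (ar a * ve (Q.dhead b)))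
      + ((1 / 2 : ℂ) * a.ord b.star) • ((ar b * ar a) ⊗ₜ[ℂ] ve (Q.dtail a))
      + ((1 / 2 : ℂ) * a.star.ord b) • (ve (Q.dhead a) ⊗ₜ[ℂ] (ar a * ar b)) := by
  classical
  have h1 : (ve (Q.dtail b) * ar a) ⊗ₜ[ℂ] (ve (Q.dtail a) * ar b) =
      (ve (Q.dtail b) * ar a) ⊗ₜ[ℂ] ar b := by
    rw [hA.vert_mul_arrow_eq, hA.vert_mul_arrow_eq]
    by_cases h : Q.dtail b = Q.dtail a
    · simp [h]
    · simp [h, TensorProduct.zero_tmul]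
  have h2 : (ar b * ve (Q.dhead a)) ⊗ₜ[ℂ] (ar a * ve (Q.dhead b)) =
      ar b ⊗ₜ[ℂ] (ar a * ve (Q.dhead b)) := by
    rw [hA.arrow_mul_vert_eq, hA.arrow_mul_vert_eq]
    by_cases h : Q.dhead b = Q.dhead a
    · simp [h]
    · simp [h, TensorProduct.tmul_zero]
  have h0 : Q.dhead b ≠ Q.dtail a → ar b * ar a = 0 := fun h => by
    rw [← hA.vert_mul_arrow a, ← mul_assoc, hA.arrow_mul_vert_eq, if_neg h.symm, zero_mul]
  have h0' : Q.dtail b ≠ Q.dhead a → ar a * ar b = 0 := fun h => by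
    rw [← hA.vert_mul_arrow b, ← mul_assoc, hA.arrow_mul_vert_eq, if_neg h, zero_mul]
  have h3 : (ar b * ar a) ⊗ₜ[ℂ] ve (Q.dtail a) =
      (ar b * ar a) ⊗ₜ[ℂ] ve (Q.dhead b) := by
    by_cases h : Q.dhead b = Q.dtail a
    · rw [h]
    · rw [h0 h, TensorProduct.zero_tmul, TensorProduct.zero_tmul]
  have h4 : ve (Q.dhead a) ⊗ₜ[ℂ] (ar a * ar b) =
      ve (Q.dtail b) ⊗ₜ[ℂ] (ar a * ar b) := by
    by_cases h : Q.dtail b = Q.dhead a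
    · rw [h]
    · rw [h0' h, TensorProduct.tmul_zero, TensorProduct.tmul_zero]
  rw [hA.fusionValue_eq]
  unfold edgeValue
  rw [h1, h2, h3, h4]
  split_ifs with h
  · module
  · module

end IsLocalizedPathAlgebra

/-- Derivations which scale the arrows commute. -/
theorem IsLocalizedPathAlgebra.scaling_commute {I E : Type*} [Fintype I] {Q : FinQuiver I E}
    {A : Type*} [Ring A] [Algebra ℂ A] {ve : I → A} {ar : DArrow E → A}
    (hA : IsLocalizedPathAlgebra Q ve ar) {d d' : A →ₗ[ℂ] A} {w w' : DArrow E → ℂ}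
    (hd : IsTwistedDer (AlgHom.id ℂ A) (AlgHom.id ℂ A) d)
    (hd' : IsTwistedDer (AlgHom.id ℂ A) (AlgHom.id ℂ A) d') (hd0 : ∀ s, d (ve s) = 0)
    (hd0' : ∀ s, d' (ve s) = 0) (hda : ∀ a, d (ar a) = w a • ar a)
    (hda' : ∀ a, d' (ar a) = w' a • ar a) (f : A) : d (d' f) = d' (d f) := by
  have h : IsTwistedDer (AlgHom.id ℂ A) (AlgHom.id ℂ A) (d ∘ₗ d' - d' ∘ₗ d) := fun x y => by
    simp only [LinearMap.sub_apply, LinearMap.comp_apply, hd x y, hd' x y, map_add, hd _ (d' y),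
      hd _ y, hd' _ (d y), hd' _ y, AlgHom.id_apply, mul_sub, sub_mul]
    abel
  have h0 := hA.der_eq_zero h (fun s => by simp [hd0, hd0']) fun a => by
    simp [hda, hda', smul_smul, mul_comm]
  exact sub_eq_zero.1 (LinearMap.congr_fun h0 f)

theorem outerValue_eq {I E : Type*} [Fintype I] [LinearOrder (DArrow E)] {Q : FinQuiver I E}
    {γ : E → ℂ} (a b : DArrow E) :
    outerValue Q γ a b = edgeValue Q γ (AQ.e Q γ) (AQ.arr Q γ) a b +
      fusionValue (AQ.e Q γ) (AQ.arr Q γ) a b :=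
  ((AQ.isLocalizedPathAlgebra Q γ).edgeValue_add_fusionValue γ a b).symm

/-! ### Vector fields on the representation space -/

section Coordinates

variable {I E : Type*} [Fintype I] [DecidableEq I] {n : I → ℕ} {Q : FinQuiver I E} {γ : E → ℂ}

theorem det_mem_subalgebra {R J : Type*} [CommRing R] [Algebra ℂ R] [Fintype J] [DecidableEq J]
    (S : Subalgebra ℂ R) {M : Matrix J J R} (hM : ∀ i j, M i j ∈ S) : M.det ∈ S := by
  rw [Matrix.det_apply]
  exact sum_mem fun σ _ => by
    rw [Units.smul_def]
    exact zsmul_mem (prod_mem fun i _ => hM _ _) _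

theorem locMat_mem_subalgebra {R : Type*} [CommRing R] [Algebra ℂ R] (S : Subalgebra ℂ R)
    {X : DArrow E → Matrix (DimIdx n) (DimIdx n) R} (hX : ∀ a i j, X a i j ∈ S) (a : DArrow E)
    (i j : DimIdx n) : locMat n Q γ X a i j ∈ S := by
  have h1 : ∀ i j, (1 : Matrix (DimIdx n) (DimIdx n) R) i j ∈ S := fun i j => by
    rw [Matrix.one_apply]
    split_ifs
    exacts [one_mem S, zero_mem S]
  have hv : ∀ s i j, vertexProj n R s i j ∈ S := fun s i j => by
    rw [vertexProj, Matrix.diagonal_apply]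
    split_ifs
    exacts [one_mem S, zero_mem S, zero_mem S]
  simp only [locMat, Matrix.add_apply, Matrix.sub_apply, Matrix.smul_apply, Matrix.mul_apply]
  exact add_mem (add_mem (sub_mem (h1 _ _) (hv _ _ _)) (S.smul_mem (hv _ _ _) _))
    (sum_mem fun k _ => mul_mem (hX _ _ _) (hX _ _ _))

/-- A subalgebra of `ℂ[M^γ]` which contains the coordinates and is closed under inverses is
everything. -/
theorem coordRing_subalgebra_eq_top (S : Subalgebra ℂ (coordRing n Q γ))
    (hx : ∀ a i j, univMat n Q γ a i j ∈ S) (hinv : ∀ f ∈ S, ∀ g, f * g = 1 → g ∈ S) : S = ⊤ := by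
  have hdet : ∀ a, (locMat n Q γ (univMat n Q γ) a).det ∈ S := fun a =>
    det_mem_subalgebra S (locMat_mem_subalgebra S hx a)
  have key : coordRing n Q γ ≤ S.map (coordRing n Q γ).val := by
    refine Algebra.adjoin_le ?_
    rintro f (⟨a, i, j, rfl⟩ | ⟨a, rfl⟩)
    · exact ⟨_, hx a i j, rfl⟩
    · refine ⟨⟨fun X => ((locMat n Q γ X.1 a).det)⁻¹, Algebra.subset_adjoin (Or.inr ⟨a, rfl⟩)⟩,
        hinv _ (hdet a) _ (evalAt_ext fun X => ?_), rfl⟩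
      rw [map_mul, AlgHom.map_det, map_locMat, map_one]
      exact mul_inv_cancel₀ (X.2.2 a)
  rw [Algebra.eq_top_iff]
  intro f
  obtain ⟨g, hg, hfg⟩ := key f.2
  rwa [← Subtype.ext hfg]

/-- The kernel of a derivation contains the inverse of any unit it contains, so it is enough that it
contains the coordinates. -/
theorem determinesDerivations_univMat :
    DeterminesDerivations {f | ∃ a i j, f = univMat n Q γ a i j} := by
  intro d hd
  let S : Subalgebra ℂ (coordRing n Q γ) :=
    { carrier := {f | d f = 0}
      mul_mem' := fun {x y} hx hy => by
        simp only [Set.mem_ofPred_eq] at *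
        simp [Derivation.leibniz, hx, hy]
      add_mem' := fun {x y} hx hy => by
        simp only [Set.mem_ofPred_eq] at *
        simp [hx, hy]
      algebraMap_mem' := fun c => by
        simp only [Set.mem_ofPred_eq]
        exact d.map_algebraMap c }
  have hS : S = ⊤ := coordRing_subalgebra_eq_top S (fun a i j => hd _ ⟨a, i, j, rfl⟩)
    fun f hf g hfg => by
      have h := d.leibniz f g
      have hf' : d f = 0 := hf
      rw [hfg, Derivation.map_one_eq_zero, hf', smul_zero, add_zero, smul_eq_mul] at h
      change d g = 0
      calc d g = (f * g) * d g := by rw [hfg, one_mul]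
        _ = g * (f * d g) := by ring
        _ = 0 := by rw [← h, mul_zero]
  ext1 f
  exact (Algebra.eq_top_iff.1 hS f : _)

end Coordinates

/-! ### Differentiation of regular functions along curves -/

section Curves

open Topology Filter

variable {I E : Type*} [Fintype I] [DecidableEq I] {n : I → ℕ} {Q : FinQuiver I E} {γ : E → ℂ}

open Classical in
/-- The extension of a function by zero. -/
noncomputable def extendZero (f : repSpace n Q γ → ℂ)
    (Y : DArrow E → Matrix (DimIdx n) (DimIdx n) ℂ) : ℂ :=
  if h : Y ∈ repSpace n Q γ then f ⟨Y, h⟩ else 0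

theorem extendZero_of_mem (f : repSpace n Q γ → ℂ)
    {Y : DArrow E → Matrix (DimIdx n) (DimIdx n) ℂ} (h : Y ∈ repSpace n Q γ) :
    extendZero f Y = f ⟨Y, h⟩ := dif_pos h

theorem extendZero_coe (f : repSpace n Q γ → ℂ) (X : repSpace n Q γ) :
    extendZero f X.1 = f X := extendZero_of_mem f X.2

/-- `C` is a germ of a curve in `M^γ` through `X` with velocity `V`. -/
structure IsCurve (X : repSpace n Q γ) (C : ℂ → DArrow E → Matrix (DimIdx n) (DimIdx n) ℂ)
    (V : DArrow E → Matrix (DimIdx n) (DimIdx n) ℂ) : Prop where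
  zero : C 0 = X.1
  mem : ∀ᶠ u in 𝓝 0, C u ∈ repSpace n Q γ
  deriv : ∀ a i j, HasDerivAt (fun u => C u a i j) (V a i j) 0

variable {X : repSpace n Q γ} {C : ℂ → DArrow E → Matrix (DimIdx n) (DimIdx n) ℂ}
  {V : DArrow E → Matrix (DimIdx n) (DimIdx n) ℂ}

theorem apply_eq_zero_of_mem_repSpace {Y : DArrow E → Matrix (DimIdx n) (DimIdx n) ℂ}
    (hY : Y ∈ repSpace n Q γ) {a : DArrow E} {i j : DimIdx n}
    (h : ¬ (i.1 = Q.dtail a ∧ j.1 = Q.dhead a)) : Y a i j = 0 := by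
  rw [hY.1 a]
  simp only [vertexProj, Matrix.mul_diagonal, Matrix.diagonal_mul]
  by_cases h1 : i.1 = Q.dtail a
  · simp [show ¬ j.1 = Q.dhead a from fun h2 => h ⟨h1, h2⟩]
  · simp [h1]

theorem IsCurve.velocity_eq_zero (hC : IsCurve X C V) {a : DArrow E} {i j : DimIdx n}
    (h : ¬ (i.1 = Q.dtail a ∧ j.1 = Q.dhead a)) : V a i j = 0 := by
  refine (hC.deriv a i j).unique ((hasDerivAt_const (0 : ℂ) (0 : ℂ)).congr_of_eventuallyEq ?_)
  filter_upwards [hC.mem] with u hu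
  exact apply_eq_zero_of_mem_repSpace hu h

variable [Fintype E]

/-- The regular functions which have regular partial derivatives along curves. -/
noncomputable def smoothSubalgebra (n : I → ℕ) (Q : FinQuiver I E) (γ : E → ℂ) :
    Subalgebra ℂ (coordRing n Q γ) where
  carrier := {f | ∃ G : DArrow E → DimIdx n → DimIdx n → coordRing n Q γ,
    ∀ X C V, IsCurve X C V → HasDerivAt (fun u => extendZero f.1 (C u))
      (∑ a, ∑ i, ∑ j, V a i j * (G a i j).1 X) 0}
  mul_mem' := by
    rintro f g ⟨F, hF⟩ ⟨G, hG⟩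
    refine ⟨fun a i j => F a i j * g + f * G a i j, fun X C V hC => ?_⟩
    refine (((hF X C V hC).mul (hG X C V hC)).congr_of_eventuallyEq ?_).congr_deriv ?_
    · filter_upwards [hC.mem] with u hu
      simp only [extendZero_of_mem _ hu, Pi.mul_apply]
      rfl
    · simp only [hC.zero, extendZero_coe, Finset.sum_mul, Finset.mul_sum, ← Finset.sum_add_distrib]
      refine Finset.sum_congr rfl fun a _ => Finset.sum_congr rfl fun i _ =>
        Finset.sum_congr rfl fun j _ => ?_
      simp only [Subalgebra.coe_add, Subalgebra.coe_mul, Pi.add_apply, Pi.mul_apply]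
      ring
  add_mem' := by
    rintro f g ⟨F, hF⟩ ⟨G, hG⟩
    refine ⟨fun a i j => F a i j + G a i j, fun X C V hC => ?_⟩
    refine (((hF X C V hC).add (hG X C V hC)).congr_of_eventuallyEq ?_).congr_deriv ?_
    · filter_upwards [hC.mem] with u hu
      simp only [extendZero_of_mem _ hu, Pi.add_apply]
      rfl
    · simp only [← Finset.sum_add_distrib, ← mul_add]
      rfl
  algebraMap_mem' := fun c => by
    refine ⟨0, fun X C V hC => ?_⟩
    refine ((hasDerivAt_const (0 : ℂ) c).congr_of_eventuallyEq ?_).congr_deriv (by simp)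
    filter_upwards [hC.mem] with u hu
    simp only [extendZero_of_mem _ hu]
    rfl

/-- The coordinates have a constant gradient, and the quotient rule provides the gradient of an
inverse. General curves, and not only coordinate lines, are needed in order to differentiate along
orbits of the group. -/
theorem smoothSubalgebra_eq_top : smoothSubalgebra n Q γ = ⊤ := by
  classical
  refine coordRing_subalgebra_eq_top _ (fun a i j => ?_) ?_
  · refine ⟨fun b k l => if b = a ∧ k = i ∧ l = j then 1 else 0, fun X C V hC => ?_⟩
    refine ((hC.deriv a i j).congr_of_eventuallyEq ?_).congr_deriv ?_
    · filter_upwards [hC.mem] with u hu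
      rw [extendZero_of_mem _ hu]
      rfl
    · rw [Finset.sum_eq_single a, Finset.sum_eq_single i, Finset.sum_eq_single j]
      · simp
      · intro l _ hl
        simp [hl]
      · simp
      · intro k _ hk
        simp [hk]
      · simp
      · intro b _ hb
        simp [hb]
      · simp
  · rintro f ⟨F, hF⟩ g hfg
    -- The gradient of `f⁻¹` is `-f⁻²` times that of `f`, written with `g = f⁻¹` so that it stays
    -- regular.
    refine ⟨fun a i j => -(F a i j * g * g), fun X C V hC => ?_⟩
    have hfg' : ∀ Y, f.1 Y * g.1 Y = 1 := fun Y => congrFun (congrArg Subtype.val hfg) Y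
    have hg : ∀ Y, g.1 Y = (f.1 Y)⁻¹ := fun Y => eq_inv_of_mul_eq_one_right (hfg' Y)
    have h0 : extendZero f.1 (C 0) ≠ 0 := by
      rw [hC.zero, extendZero_coe]
      exact left_ne_zero_of_mul_eq_one (hfg' X)
    refine (((hF X C V hC).inv h0).congr_of_eventuallyEq ?_).congr_deriv ?_
    · filter_upwards [hC.mem] with u hu
      simp only [extendZero_of_mem _ hu, Pi.inv_apply, hg]
    · rw [hC.zero, extendZero_coe, div_eq_mul_inv, neg_mul, Finset.sum_mul,
        ← Finset.sum_neg_distrib]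
      refine Finset.sum_congr rfl fun a _ => ?_
      rw [Finset.sum_mul, ← Finset.sum_neg_distrib]
      refine Finset.sum_congr rfl fun i _ => ?_
      rw [Finset.sum_mul, ← Finset.sum_neg_distrib]
      refine Finset.sum_congr rfl fun j _ => ?_
      have h1 : (-(F a i j * g * g) : coordRing n Q γ).1 X = -((F a i j).1 X * g.1 X * g.1 X) := rfl
      rw [h1, hg]
      ring

end Curves

/-! ### The coordinate vector fields as derivations -/

section PartialDerivatives

open Topology Filter

variable {I E : Type*} [Fintype I] [DecidableEq I] {n : I → ℕ} {Q : FinQuiver I E} {γ : E → ℂ}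

open Classical in
/-- The coordinate line through `X` along which the entry `(j, i)` of `X_a` varies. -/
noncomputable def coordLine (X : DArrow E → Matrix (DimIdx n) (DimIdx n) ℂ) (a : DArrow E)
    (i j : DimIdx n) (u : ℂ) : DArrow E → Matrix (DimIdx n) (DimIdx n) ℂ :=
  fun b => X b + if b = a then Matrix.single j i u else 0

open Classical in
theorem pder_eq (a : DArrow E) (i j : DimIdx n) (f : repSpace n Q γ → ℂ) (X : repSpace n Q γ) :
    pder n Q γ a i j f X = if i.1 = Q.dhead a ∧ j.1 = Q.dtail a then
      deriv (fun u => extendZero f (coordLine X.1 a i j u)) 0 else 0 := by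
  unfold pder extendZero coordLine
  rfl

theorem vertexProj_mul_mul_apply {R : Type*} [CommRing R] (s t : I)
    (M : Matrix (DimIdx n) (DimIdx n) R) (i j : DimIdx n) :
    (vertexProj n R s * M * vertexProj n R t) i j = if i.1 = s ∧ j.1 = t then M i j else 0 := by
  simp only [vertexProj, Matrix.mul_diagonal, Matrix.diagonal_mul]
  by_cases h1 : i.1 = s <;> by_cases h2 : j.1 = t <;> simp [h1, h2]

variable [Fintype E]

-- The line respects the block shape because the moving entry lies in the block of `a`. It stays in
-- `M^γ` for small `u` because finitely many determinants remain nonzero.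
open Classical in
theorem isCurve_coordLine (X : repSpace n Q γ) {a : DArrow E} {i j : DimIdx n}
    (hi : i.1 = Q.dhead a) (hj : j.1 = Q.dtail a) :
    IsCurve X (coordLine X.1 a i j) (fun b => if b = a then Matrix.single j i 1 else 0) where
  zero := by
    funext b
    simp [coordLine]
  mem := by
    have h1 : ∀ u b, coordLine X.1 a i j u b = vertexProj n ℂ (Q.dtail b) *
        coordLine X.1 a i j u b * vertexProj n ℂ (Q.dhead b) := fun u b => by
      ext k l
      rw [vertexProj_mul_mul_apply]
      split_ifs with h
      · rfl
      · simp only [coordLine, Matrix.add_apply]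
        rw [apply_eq_zero_of_mem_repSpace X.2 h, zero_add]
        split_ifs with hb
        · subst hb
          rw [Matrix.single_apply, if_neg]
          rintro ⟨rfl, rfl⟩
          exact h ⟨hj, hi⟩
        · rfl
    have h2 : ∀ b, ∀ᶠ u in 𝓝 (0 : ℂ), (locMat n Q γ (coordLine X.1 a i j u) b).det ≠ 0 := by
      intro b
      have hc : ∀ b, Continuous fun u => coordLine X.1 a i j u b := fun b => by
        unfold coordLine
        refine continuous_const.add ?_
        split_ifs
        · refine continuous_matrix fun k l => ?_
          simp only [Matrix.single_apply]
          split_ifs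
          exacts [continuous_id, continuous_const]
        · exact continuous_const
      have hd : Continuous fun u => (locMat n Q γ (coordLine X.1 a i j u) b).det :=
        (continuous_const.add ((hc b).matrix_mul (hc b.star))).matrix_det
      refine hd.continuousAt.eventually_ne ?_
      have h0 : coordLine X.1 a i j 0 = X.1 := by
        funext b
        simp [coordLine]
      rw [h0]
      exact X.2.2 b
    filter_upwards [eventually_all.2 h2] with u hu
    exact ⟨h1 u, hu⟩
  deriv b k l := by
    simp only [coordLine, Matrix.add_apply]
    refine HasDerivAt.const_add _ ?_
    split_ifs
    · simp only [Matrix.single_apply]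
      split_ifs
      exacts [hasDerivAt_id _, hasDerivAt_const _ _]
    · exact hasDerivAt_const _ _

open Classical in
theorem exists_gradient (f : coordRing n Q γ) :
    ∃ G : DArrow E → DimIdx n → DimIdx n → coordRing n Q γ,
      (∀ X C V, IsCurve X C V → HasDerivAt (fun u => extendZero f.1 (C u))
        (∑ a, ∑ i, ∑ j, V a i j * (G a i j).1 X) 0) ∧
      ∀ a i j X, pder n Q γ a i j f.1 X =
        if i.1 = Q.dhead a ∧ j.1 = Q.dtail a then (G a j i).1 X else 0 := by
  obtain ⟨G, hG⟩ : f ∈ smoothSubalgebra n Q γ := by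
    rw [smoothSubalgebra_eq_top]
    trivial
  refine ⟨G, hG, fun a i j X => ?_⟩
  rw [pder_eq]
  split_ifs with h
  · rw [(hG X _ _ (isCurve_coordLine X h.1 h.2)).deriv, Finset.sum_eq_single a,
      Finset.sum_eq_single j, Finset.sum_eq_single i]
    · simp
    · intro l _ hl
      simp [hl.symm]
    · simp
    · intro k _ hk
      simp [hk.symm]
    · simp
    · intro b _ hb
      simp [hb]
    · simp
  · rfl

/-- The entries outside the blocks are constantly zero along the curve. The velocity therefore
vanishes where `pder` is set to zero, and it does not matter that the gradient is arbitrary there.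
-/
theorem hasDerivAt_curve (f : coordRing n Q γ) {X : repSpace n Q γ}
    {C : ℂ → DArrow E → Matrix (DimIdx n) (DimIdx n) ℂ}
    {V : DArrow E → Matrix (DimIdx n) (DimIdx n) ℂ} (hC : IsCurve X C V) :
    HasDerivAt (fun u => extendZero f.1 (C u))
      (∑ a, ∑ i, ∑ j, V a i j * pder n Q γ a j i f.1 X) 0 := by
  obtain ⟨G, hG, hp⟩ := exists_gradient f
  refine (hG X C V hC).congr_deriv ?_
  refine Finset.sum_congr rfl fun a _ => Finset.sum_congr rfl fun i _ =>
    Finset.sum_congr rfl fun j _ => ?_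
  rw [hp]
  split_ifs with h
  · rfl
  · rw [hC.velocity_eq_zero fun h' => h h'.symm, zero_mul, zero_mul]

theorem hasDerivAt_coordLine (f : coordRing n Q γ) (X : repSpace n Q γ) {a : DArrow E}
    {i j : DimIdx n} (h : i.1 = Q.dhead a ∧ j.1 = Q.dtail a) :
    HasDerivAt (fun u => extendZero f.1 (coordLine X.1 a i j u)) (pder n Q γ a i j f.1 X) 0 := by
  rw [pder_eq, if_pos h]
  exact (hasDerivAt_curve f (isCurve_coordLine X h.1 h.2)).differentiableAt.hasDerivAt

/-- The vector field `(∂_a)_{ij}` as a derivation of `ℂ[M^γ]`. -/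
noncomputable def partialDer (a : DArrow E) (i j : DimIdx n) :
    Derivation ℂ (coordRing n Q γ) (coordRing n Q γ) :=
  have hadd : ∀ f g : coordRing n Q γ, ∀ X, pder n Q γ a i j (f + g).1 X =
      pder n Q γ a i j f.1 X + pder n Q γ a i j g.1 X := fun f g X => by
    by_cases h : i.1 = Q.dhead a ∧ j.1 = Q.dtail a
    · refine (hasDerivAt_coordLine (f + g) X h).unique (((hasDerivAt_coordLine f X h).add
        (hasDerivAt_coordLine g X h)).congr_of_eventuallyEq ?_)
      filter_upwards [(isCurve_coordLine X h.1 h.2).mem] with u hu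
      simp only [extendZero_of_mem _ hu, Pi.add_apply]
      rfl
    · simp only [pder_eq, if_neg h, add_zero]
  have hsmul : ∀ (c : ℂ) (f : coordRing n Q γ), ∀ X, pder n Q γ a i j (c • f).1 X =
      c * pder n Q γ a i j f.1 X := fun c f X => by
    by_cases h : i.1 = Q.dhead a ∧ j.1 = Q.dtail a
    · refine (hasDerivAt_coordLine (c • f) X h).unique
        (((hasDerivAt_coordLine f X h).const_mul c).congr_of_eventuallyEq ?_)
      filter_upwards [(isCurve_coordLine X h.1 h.2).mem] with u hu
      simp only [extendZero_of_mem _ hu]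
      rfl
    · simp only [pder_eq, if_neg h, mul_zero]
  have hmul : ∀ f g : coordRing n Q γ, ∀ X, pder n Q γ a i j (f * g).1 X =
      f.1 X * pder n Q γ a i j g.1 X + g.1 X * pder n Q γ a i j f.1 X := fun f g X => by
    by_cases h : i.1 = Q.dhead a ∧ j.1 = Q.dtail a
    · have hC := isCurve_coordLine X h.1 h.2
      have h' := (hasDerivAt_coordLine f X h).mul (hasDerivAt_coordLine g X h)
      rw [hC.zero, extendZero_coe, extendZero_coe] at h'
      rw [add_comm, mul_comm (g.1 X)]
      refine (hasDerivAt_coordLine (f * g) X h).unique (h'.congr_of_eventuallyEq ?_)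
      filter_upwards [hC.mem] with u hu
      simp only [extendZero_of_mem _ hu, Pi.mul_apply]
      rfl
    · simp only [pder_eq, if_neg h, mul_zero, add_zero]
  have hmem : ∀ f : coordRing n Q γ,
      (fun X => pder n Q γ a i j f.1 X) ∈ coordRing n Q γ := fun f => by
    obtain ⟨G, -, hp⟩ := exists_gradient f
    simp only [hp]
    split_ifs
    · exact (G a j i).2
    · exact zero_mem _
  Derivation.mk'
    { toFun := fun f => ⟨fun X => pder n Q γ a i j f.1 X, hmem f⟩
      map_add' := fun f g => Subtype.ext (funext (hadd f g))
      map_smul' := fun c f => Subtype.ext (funext (hsmul c f)) }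
    fun f g => Subtype.ext (funext (hmul f g))

open Classical in
theorem partialDer_univMat (a b : DArrow E) (i j k l : DimIdx n) :
    partialDer a i j (univMat n Q γ b k l) =
      if b = a ∧ k = j ∧ l = i ∧ i.1 = Q.dhead a ∧ j.1 = Q.dtail a then 1 else 0 := by
  refine evalAt_ext fun X => ?_
  change pder n Q γ a i j (univMat n Q γ b k l).1 X = _
  by_cases h : i.1 = Q.dhead a ∧ j.1 = Q.dtail a
  · have h1 := (hasDerivAt_coordLine (univMat n Q γ b k l) X h).unique
      (((isCurve_coordLine X h.1 h.2).deriv b k l).congr_of_eventuallyEq (by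
        filter_upwards [(isCurve_coordLine X h.1 h.2).mem] with u hu
        rw [extendZero_of_mem _ hu]
        rfl))
    rw [h1]
    by_cases hb : b = a
    · simp only [hb, if_true, Matrix.single_apply, h, and_true, true_and, eq_comm (a := k),
        eq_comm (a := l)]
      split_ifs <;> simp
    · simp [hb]
  · rw [pder_eq, if_neg h, if_neg fun h' => h h'.2.2.2, map_zero]

end PartialDerivatives

/-! ### Brackets of matrix entries of a representation -/

section Kronecker

variable {A R J : Type*} [Ring A] [Algebra ℂ A] [CommRing R] [Algebra ℂ R] [Fintype J]
  [DecidableEq J] (ρ : A →ₐ[ℂ] Matrix J J R)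

/-- The representation `x ↦ ρ x ⊗ 1`. -/
noncomputable def kronLeft : A →ₐ[ℂ] Matrix (J × J) (J × J) R :=
  AlgHom.ofLinearMap
    { toFun := fun x => Matrix.kroneckerMap (· * ·) (ρ x) (1 : Matrix J J R)
      map_add' := fun x y => by rw [map_add, Matrix.add_kronecker]
      map_smul' := fun c x => by rw [map_smul, Matrix.smul_kronecker]; rfl }
    (by simp)
    (fun x y => by simp [← Matrix.mul_kronecker_mul])

/-- The representation `x ↦ 1 ⊗ ρ x`. -/
noncomputable def kronRight : A →ₐ[ℂ] Matrix (J × J) (J × J) R :=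
  AlgHom.ofLinearMap
    { toFun := fun x => Matrix.kroneckerMap (· * ·) (1 : Matrix J J R) (ρ x)
      map_add' := fun x y => by rw [map_add, Matrix.kronecker_add]
      map_smul' := fun c x => by rw [map_smul, Matrix.kronecker_smul]; rfl }
    (by simp)
    (fun x y => by simp [← Matrix.mul_kronecker_mul])

theorem kronLeft_apply (x : A) :
    kronLeft ρ x = Matrix.kroneckerMap (· * ·) (ρ x) (1 : Matrix J J R) := rfl

theorem kronRight_apply (x : A) :
    kronRight ρ x = Matrix.kroneckerMap (· * ·) (1 : Matrix J J R) (ρ x) := rfl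

/-- The representation `ρ ⊗ ρ` of `A ⊗ A`. -/
noncomputable def kronRep : A ⊗[ℂ] A →ₐ[ℂ] Matrix (J × J) (J × J) R :=
  Algebra.TensorProduct.lift (kronLeft ρ) (kronRight ρ) fun x y => by
    rw [Commute, SemiconjBy, kronLeft_apply, kronRight_apply, ← Matrix.mul_kronecker_mul,
      ← Matrix.mul_kronecker_mul]
    simp

theorem kronRep_tmul (x y : A) : kronRep ρ (x ⊗ₜ y) = Matrix.kroneckerMap (· * ·) (ρ x) (ρ y) := by
  rw [kronRep, Algebra.TensorProduct.lift_tmul, kronLeft_apply, kronRight_apply,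
    ← Matrix.mul_kronecker_mul]
  simp

theorem kronRep_tmul_apply (x y : A) (k j i l : J) :
    kronRep ρ (x ⊗ₜ y) (k, i) (j, l) = ρ x k j * ρ y i l := by
  rw [kronRep_tmul]
  rfl

theorem kronRep_comp_inclL : (kronRep ρ).comp (inclL A) = kronLeft ρ := by
  ext1 x
  change kronRep ρ (x ⊗ₜ 1) = _
  rw [kronRep_tmul, map_one]
  rfl

theorem kronRep_comp_inclR : (kronRep ρ).comp (inclR A) = kronRight ρ := by
  ext1 x
  change kronRep ρ (1 ⊗ₜ x) = _
  rw [kronRep_tmul, map_one]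
  rfl

theorem kronLeft_mul_apply (x : A) (M : Matrix (J × J) (J × J) R) (k i j l : J) :
    (kronLeft ρ x * M) (k, i) (j, l) = ∑ m, ρ x k m * M (m, i) (j, l) := by
  rw [kronLeft_apply, Matrix.mul_apply, Fintype.sum_prod_type]
  simp [Matrix.one_apply]

theorem kronRight_mul_apply (x : A) (M : Matrix (J × J) (J × J) R) (k i j l : J) :
    (kronRight ρ x * M) (k, i) (j, l) = ∑ m, ρ x i m * M (k, m) (j, l) := by
  rw [kronRight_apply, Matrix.mul_apply, Fintype.sum_prod_type]
  simp [Matrix.one_apply]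

theorem mul_kronLeft_apply (x : A) (M : Matrix (J × J) (J × J) R) (k i j l : J) :
    (M * kronLeft ρ x) (k, i) (j, l) = ∑ m, M (k, i) (m, l) * ρ x m j := by
  rw [kronLeft_apply, Matrix.mul_apply, Fintype.sum_prod_type]
  simp [Matrix.one_apply]

theorem mul_kronRight_apply (x : A) (M : Matrix (J × J) (J × J) R) (k i j l : J) :
    (M * kronRight ρ x) (k, i) (j, l) = ∑ m, M (k, i) (j, m) * ρ x m l := by
  rw [kronRight_apply, Matrix.mul_apply, Fintype.sum_prod_type]
  simp [Matrix.one_apply]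

/-- The brackets of the matrix entries of `ρ`. -/
noncomputable def entryBracket (b : R →ₗ[ℂ] R →ₗ[ℂ] R) :
    A →ₗ[ℂ] A →ₗ[ℂ] Matrix (J × J) (J × J) R :=
  LinearMap.mk₂ ℂ (fun f g => Matrix.of fun p q => b (ρ f p.2 q.1) (ρ g p.1 q.2))
    (fun f f' g => by ext; simp) (fun c f g => by ext; simp) (fun f g g' => by ext; simp)
    (fun c f g => by ext; simp)

theorem entryBracket_apply (b : R →ₗ[ℂ] R →ₗ[ℂ] R) (f g : A) (k i j l : J) :
    entryBracket ρ b f g (k, i) (j, l) = b (ρ f i j) (ρ g k l) := rfl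

variable {ρ} {b : R →ₗ[ℂ] R →ₗ[ℂ] R}

/-- The index order pairs `(ρ f)_{ij}`, `(ρ g)_{kl}` with the entry `kj` of the first tensor factor
and `il` of the second. With this choice the Leibniz rule for matrix products becomes the outer one.
-/
theorem entryBracket_right (hb : IsSkewBiderivation b) (f : A) :
    IsTwistedDer (kronLeft ρ) (kronRight ρ) (entryBracket ρ b f) := fun g h => by
  ext ⟨k, i⟩ ⟨j, l⟩
  rw [Matrix.add_apply, kronLeft_mul_apply, mul_kronRight_apply]
  simp only [entryBracket_apply, map_mul, Matrix.mul_apply, map_sum, hb.leibniz,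
    ← Finset.sum_add_distrib]
  exact Finset.sum_congr rfl fun m _ => add_comm _ _

theorem entryBracket_left (hb : IsSkewBiderivation b) (h : A) :
    IsTwistedDer (kronRight ρ) (kronLeft ρ) ((entryBracket ρ b).flip h) := fun f g => by
  ext ⟨k, i⟩ ⟨j, l⟩
  rw [Matrix.add_apply, kronRight_mul_apply, mul_kronLeft_apply]
  simp only [LinearMap.flip_apply, entryBracket_apply, map_mul, Matrix.mul_apply, map_sum,
    LinearMap.sum_apply, hb.leibniz_left, ← Finset.sum_add_distrib]
  exact Finset.sum_congr rfl fun m _ => add_comm _ _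

/-- The brackets of the entries of a representation are given by an outer double bracket as soon
as this is true for arrows. -/
theorem IsLocalizedPathAlgebra.entryBracket_eq {I E : Type*} [Fintype I] {Q : FinQuiver I E}
    {ve : I → A} {ar : DArrow E → A} (hA : IsLocalizedPathAlgebra Q ve ar)
    {D : A →ₗ[ℂ] A →ₗ[ℂ] A ⊗[ℂ] A} (hD : IsOuterDoubleBracket D) (hv : ∀ f s, D f (ve s) = 0)
    (hb : IsSkewBiderivation b) (he : ∀ x s i j, b x (ρ (ve s) i j) = 0)
    (ha : ∀ a a' i j k l, b (ρ (ar a) i j) (ρ (ar a') k l) =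
      kronRep ρ (D (ar a) (ar a')) (k, i) (j, l)) (f g : A) (i j k l : J) :
    b (ρ f i j) (ρ g k l) = kronRep ρ (D f g) (k, i) (j, l) := by
  have h : entryBracket ρ b = D.compr₂ (kronRep ρ).toLinearMap := by
    refine hA.pairing_ext (entryBracket_right hb) (fun f g h => ?_) (entryBracket_left hb)
      (fun h f g => ?_) (fun f s => ?_) (fun f s => ?_) (fun a a' => ?_)
    · rw [← kronRep_comp_inclL, ← kronRep_comp_inclR]
      simp only [LinearMap.compr₂_apply, hD.right f g h, map_add, map_mul,
        AlgHom.toLinearMap_apply, AlgHom.comp_apply]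
    · rw [← kronRep_comp_inclL, ← kronRep_comp_inclR]
      have hl : D (f * g) h = inclR A f * D g h + D f h * inclL A g := hD.der_left f g h
      simp only [LinearMap.flip_apply, LinearMap.compr₂_apply, hl, map_add, map_mul,
        AlgHom.toLinearMap_apply, AlgHom.comp_apply]
    · ext ⟨k, i⟩ ⟨j, l⟩
      rw [entryBracket_apply, he, LinearMap.compr₂_apply, hv, map_zero]
      rfl
    · ext ⟨k, i⟩ ⟨j, l⟩
      rw [entryBracket_apply, hb.skew, he, neg_zero, LinearMap.compr₂_apply,
        doubleBracket_left_eq_zero hD.skew (fun f => hv f s), map_zero]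
      rfl
    · ext ⟨k, i⟩ ⟨j, l⟩
      exact ha a a' i j k l
  rw [← entryBracket_apply, h]
  rfl

end Kronecker

/-! ### The Jacobiator of matrix entries -/

section Jacobiator

variable {A R J : Type*} [Ring A] [Algebra ℂ A] [CommRing R] [Algebra ℂ R] [Fintype J]
  [DecidableEq J] (ρ : A →ₐ[ℂ] Matrix J J R)

/-- The functional `x ⊗ y ⊗ z ↦ (ρ x)_{pq} (ρ y)_{rs} (ρ z)_{tu}`. -/
noncomputable def entry3 (p q r s t u : J) : (A ⊗[ℂ] A) ⊗[ℂ] A →ₗ[ℂ] R :=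
  TensorProduct.lift ((LinearMap.mul ℂ R).compl₁₂
    (Matrix.entryLinearMap ℂ R (p, r) (q, s) ∘ₗ (kronRep ρ).toLinearMap)
    (Matrix.entryLinearMap ℂ R t u ∘ₗ ρ.toLinearMap))

theorem entry3_tmul (p q r s t u : J) (x : A ⊗[ℂ] A) (z : A) :
    entry3 ρ p q r s t u (x ⊗ₜ z) = kronRep ρ x (p, r) (q, s) * ρ z t u := rfl

theorem entry3_tmul_tmul (p q r s t u : J) (x y z : A) :
    entry3 ρ p q r s t u ((x ⊗ₜ y) ⊗ₜ z) = ρ x p q * ρ y r s * ρ z t u := by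
  rw [entry3_tmul, kronRep_tmul_apply]

theorem entry3_rot (p q r s t u : J) (x : (A ⊗[ℂ] A) ⊗[ℂ] A) :
    entry3 ρ p q r s t u (rot A x) = entry3 ρ r s t u p q x := by
  have h : entry3 ρ p q r s t u ∘ₗ (rot A).toLinearMap = entry3 ρ r s t u p q :=
    tensor3_ext fun x y z => by
      change entry3 ρ p q r s t u (rot A ((x ⊗ₜ y) ⊗ₜ z)) = _
      rw [rot_tmul, entry3_tmul_tmul, entry3_tmul_tmul]
      ring
  exact LinearMap.congr_fun h x

variable {ρ} {b : R →ₗ[ℂ] R →ₗ[ℂ] R} {D : A →ₗ[ℂ] A →ₗ[ℂ] A ⊗[ℂ] A}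

theorem bracket_kronRep (hb : IsSkewBiderivation b)
    (hbD : ∀ f g i j k l, b (ρ f i j) (ρ g k l) = kronRep ρ (D f g) (k, i) (j, l))
    (f : A) (x : A ⊗[ℂ] A) (i j k l m n : J) :
    b (ρ f i j) (kronRep ρ x (m, k) (l, n)) = entry3 ρ m j i l k n (leftExt D f x) +
      entry3 ρ k j i n m l (leftExt D f (TensorProduct.comm ℂ A A x)) := by
  induction x with
  | zero => simp
  | add x y hx hy =>
    simp only [map_add, Matrix.add_apply, hx, hy]
    ring
  | tmul u v =>
    rw [kronRep_tmul_apply, hb.leibniz, hbD, hbD, TensorProduct.comm_tmul, leftExt_tmul,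
      leftExt_tmul, entry3_tmul, entry3_tmul]
    ring

/-- Each double bracket expands by the Leibniz rule into two terms, one for each factor of the inner
double bracket. The first kind adds up to the triple bracket, the second to the triple bracket with
`g` and `h` exchanged. -/
theorem jacobiator_entries (hb : IsSkewBiderivation b) (hD : IsOuterDoubleBracket D)
    (hbD : ∀ f g i j k l, b (ρ f i j) (ρ g k l) = kronRep ρ (D f g) (k, i) (j, l))
    (f g h : A) (i j k l m n : J) :
    hb.jacobiator (ρ f i j) (ρ g k l) (ρ h m n) =
      entry3 ρ m j i l k n (triple D D f g h) - entry3 ρ k j i n m l (triple D D f h g) := by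
  have key : ∀ f g h i j k l m n, b (ρ f i j) (b (ρ g k l) (ρ h m n)) =
      entry3 ρ m j i l k n (leftExt D f (D g h)) -
        entry3 ρ k j i n m l (leftExt D f (D h g)) := fun f g h i j k l m n => by
    rw [hbD g h, bracket_kronRep hb hbD, hD.skew h g, map_neg, map_neg, sub_neg_eq_add]
  rw [hb.jacobiator_apply, key, key, key, triple_apply, triple_apply]
  simp only [map_add, entry3_rot]
  ring

end Jacobiator

/-! ### The trivector of an infinitesimal action -/

section Cartan

variable {R J : Type*} [CommRing R] [Fintype J]

/-- Each summation index joins two neighbouring factors around a cycle, so the triple sum is a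
product of three matrix products. -/
theorem sum_cyclic_mul (A A' B B' C C' : Matrix J J R) (i j k l m n : J) :
    ∑ p, ∑ q, ∑ r, (A p j * A' i q) * (B q l * B' k r) * (C r n * C' m p) =
      (C' * A) m j * (A' * B) i l * (B' * C) k n := by
  simp only [Matrix.mul_apply]
  rw [Finset.sum_mul_sum, Finset.sum_mul]
  refine Finset.sum_congr rfl fun p _ => ?_
  rw [Finset.sum_mul_sum]
  refine Finset.sum_congr rfl fun q _ => ?_
  exact Finset.sum_congr rfl fun r _ => by ring

theorem sum_cyclic (F G H : J → J → R) :
    ∑ p, ∑ q, ∑ r, F p q * G q r * H r p = ∑ p, ∑ q, ∑ r, G p q * H q r * F r p := by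
  calc _ = ∑ q, ∑ p, ∑ r, F p q * G q r * H r p := Finset.sum_comm
    _ = ∑ q, ∑ r, ∑ p, F p q * G q r * H r p := Finset.sum_congr rfl fun _ _ => Finset.sum_comm
    _ = _ := Finset.sum_congr rfl fun _ _ => Finset.sum_congr rfl fun _ _ =>
        Finset.sum_congr rfl fun _ _ => by ring

variable [Algebra ℂ R]

theorem Derivation.sum_apply {ι : Type*} (s : Finset ι) (d : ι → Derivation ℂ R R) (f : R) :
    (∑ i ∈ s, d i) f = ∑ i ∈ s, d i f := by
  change Derivation.coeFnAddMonoidHom (∑ i ∈ s, d i) f = _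
  rw [map_sum, Finset.sum_apply]
  rfl

/-- The trivector `∑ tr (Ξ_v Ξ_v Ξ_v)`, up to a factor, for matrices of derivations `Ξ_v`. -/
noncomputable def cartanDer {I : Type*} [Fintype I] (Ξ : I → J → J → Derivation ℂ R R) (f g : R) :
    Derivation ℂ R R :=
  (1 / 4 : ℂ) • ∑ v, ∑ p, ∑ q, ∑ r,
    ((Ξ v p q f * Ξ v q r g) • Ξ v r p - (Ξ v p q f * Ξ v r p g) • Ξ v q r)

variable {I : Type*} [Fintype I] (Ξ : I → J → J → Derivation ℂ R R)

theorem cartanDer_apply (f g h : R) :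
    cartanDer Ξ f g h = (1 / 4 : ℂ) • ∑ v,
      (∑ p, ∑ q, ∑ r, Ξ v p q f * Ξ v q r g * Ξ v r p h -
        ∑ p, ∑ q, ∑ r, Ξ v p q f * Ξ v q r h * Ξ v r p g) := by
  simp only [cartanDer, Derivation.smul_apply, Derivation.sum_apply,
    Derivation.sub_apply, smul_eq_mul, ← Finset.sum_sub_distrib]
  congr 1
  refine Finset.sum_congr rfl fun v _ => Finset.sum_congr rfl fun p _ =>
    Finset.sum_congr rfl fun q _ => Finset.sum_congr rfl fun r _ => ?_
  ring

theorem cartanDer_cyclic (f g h : R) : cartanDer Ξ f g h = cartanDer Ξ g h f := by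
  simp only [cartanDer_apply]
  congr 1
  refine Finset.sum_congr rfl fun v _ => ?_
  rw [sum_cyclic (fun p q => Ξ v p q f),
    ← sum_cyclic (fun p q => Ξ v p q g) _ (fun p q => Ξ v p q h)]

/-- A single invariant argument kills the trivector, since every term differentiates each of the
three functions once. -/
theorem cartanDer_eq_zero {f g h : R} (hh : ∀ v p q, Ξ v p q h = 0) : cartanDer Ξ f g h = 0 := by
  simp [cartanDer_apply, hh]

variable {A : Type*} [Ring A] [Algebra ℂ A] [DecidableEq J] {ρ : A →ₐ[ℂ] Matrix J J R}

/-- Each derivative is a difference of two terms, giving eight products. The cyclic sum contracts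
each into a product of three matrix entries, and these are the eight words of `cartanAux_terms`. -/
theorem sum_cyclic_entries {e f g h : A} (he : e * e = e) {Ξ : J → J → Derivation ℂ R R}
    {i j k l m n : J}
    (hf : ∀ p q, Ξ p q (ρ f i j) = ρ e p j * ρ (f * e) i q - ρ (e * f) p j * ρ e i q)
    (hg : ∀ p q, Ξ p q (ρ g k l) = ρ e p l * ρ (g * e) k q - ρ (e * g) p l * ρ e k q)
    (hh : ∀ p q, Ξ p q (ρ h m n) = ρ e p n * ρ (h * e) m q - ρ (e * h) p n * ρ e m q) :
    ∑ p, ∑ q, ∑ r, Ξ p q (ρ f i j) * Ξ q r (ρ g k l) * Ξ r p (ρ h m n) =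
      entry3 ρ m j i l k n (incl1 A h * cartanAux e f g - cartanAux e f g * incl3 A h) := by
  have he' : ∀ x, e * (e * x) = e * x := fun x => by rw [← mul_assoc, he]
  rw [cartanAux_terms]
  simp only [map_add, map_sub, entry3_tmul_tmul]
  have key : ∀ p q r, Ξ p q (ρ f i j) * Ξ q r (ρ g k l) * Ξ r p (ρ h m n) =
      (ρ e p j * ρ (f * e) i q) * (ρ e q l * ρ (g * e) k r) * (ρ e r n * ρ (h * e) m p)
      - (ρ e p j * ρ (f * e) i q) * (ρ e q l * ρ (g * e) k r) * (ρ (e * h) r n * ρ e m p)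
      - (ρ e p j * ρ (f * e) i q) * (ρ (e * g) q l * ρ e k r) * (ρ e r n * ρ (h * e) m p)
      + (ρ e p j * ρ (f * e) i q) * (ρ (e * g) q l * ρ e k r) * (ρ (e * h) r n * ρ e m p)
      - (ρ (e * f) p j * ρ e i q) * (ρ e q l * ρ (g * e) k r) * (ρ e r n * ρ (h * e) m p)
      + (ρ (e * f) p j * ρ e i q) * (ρ e q l * ρ (g * e) k r) * (ρ (e * h) r n * ρ e m p)
      + (ρ (e * f) p j * ρ e i q) * (ρ (e * g) q l * ρ e k r) * (ρ e r n * ρ (h * e) m p)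
      - (ρ (e * f) p j * ρ e i q) * (ρ (e * g) q l * ρ e k r) * (ρ (e * h) r n * ρ e m p) :=
    fun p q r => by
      rw [hf, hg, hh]
      ring
  simp only [key, Finset.sum_add_distrib, Finset.sum_sub_distrib, sum_cyclic_mul, ← map_mul]
  simp only [mul_assoc, he, he']
  ring

/-- The Jacobiator of the bracket induced by a double quasi-Poisson bracket is the trivector of
the infinitesimal action. -/
theorem jacobiator_eq_cartanDer {ve : I → A} {D : A →ₗ[ℂ] A →ₗ[ℂ] A ⊗[ℂ] A} {S : Type*} {ar : S → A}
    {b : R →ₗ[ℂ] R →ₗ[ℂ] R} {Ξ : I → J → J → Derivation ℂ R R} (hb : IsSkewBiderivation b)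
    (hD : IsOuterDoubleBracket D) (hT : ∀ f g, triple D D f g = cartanTriple ve f g)
    (hve : ∀ v, ve v * ve v = ve v)
    (hbD : ∀ f g i j k l, b (ρ f i j) (ρ g k l) = kronRep ρ (D f g) (k, i) (j, l))
    (hG : DeterminesDerivations {x | ∃ a i j, x = ρ (ar a) i j})
    (hΞ : ∀ v p q a i j, Ξ v p q (ρ (ar a) i j) =
      ρ (ve v) p j * ρ (ar a * ve v) i q - ρ (ve v * ar a) p j * ρ (ve v) i q) (f g h : R) :
    hb.jacobiator f g h = cartanDer Ξ f g h := by
  refine hG.ext3 hb.jacobiator_cyclic (cartanDer_cyclic Ξ) ?_ f g h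
  rintro _ ⟨a, i, j, rfl⟩ _ ⟨c, k, l, rfl⟩ _ ⟨s, m, n, rfl⟩
  rw [jacobiator_entries hb hD hbD, hT, hT, cartanDer_apply, cartanTriple_apply,
    cartanTriple_apply]
  have hΞ' := fun v a i j p q => hΞ v p q a i j
  have key := fun v => sum_cyclic_entries (hve v) (hΞ' v a i j) (hΞ' v c k l) (hΞ' v s m n)
  have key' := fun v => sum_cyclic_entries (hve v) (hΞ' v a i j) (hΞ' v s m n) (hΞ' v c k l)
  simp only [key, key', map_smul, ← smul_sub]
  rw [map_sum, map_sum, Finset.sum_sub_distrib]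

end Cartan

/-! ### The quasi-Poisson bivector in terms of matrices of derivations -/

section SkewBiderivations

/-- The space of skew-symmetric biderivations. -/
def skewBiderivations (R : Type*) [CommRing R] [Algebra ℂ R] :
    Submodule ℂ (R →ₗ[ℂ] R →ₗ[ℂ] R) where
  carrier := {b | IsSkewBiderivation b}
  add_mem' := fun {b b'} hb hb' => by
    have h := IsSkewBiderivation.add_smul hb hb' 1
    rwa [one_smul] at h
  zero_mem' := isPoissonBracket_zero.isSkewBiderivation
  smul_mem' := fun c b hb => by
    have h := isPoissonBracket_zero.isSkewBiderivation.add_smul hb c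
    rwa [zero_add] at h

variable {R J S : Type*} [CommRing R] [Algebra ℂ R] [Fintype J] [Fintype S] [LinearOrder S]

/-- The bracket of the bivector
`½ ∑ ε(a) tr [M_a P_a ∧ P_{a*}] - ½ ∑_{a<b} tr [F_a ∧ F_b]`, for matrices of derivations. -/
noncomputable def matrixBracket (star : S → S) (ε : S → ℂ) (M : S → Matrix J J R)
    (P F : S → J → J → Derivation ℂ R R) : R →ₗ[ℂ] R →ₗ[ℂ] R :=
  (1 / 2 : ℂ) • ∑ a, ε a • ∑ i, ∑ j, ∑ k, derWedge (M a i j • P a j k) (P (star a) k i)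
    + (-(1 / 2) : ℂ) • ∑ a, ∑ b, if a < b then ∑ i, ∑ j, derWedge (F a i j) (F b j i) else 0

variable (star : S → S) (ε : S → ℂ) (M : S → Matrix J J R) (P F : S → J → J → Derivation ℂ R R)

theorem matrixBracket_isSkewBiderivation :
    IsSkewBiderivation (matrixBracket star ε M P F) := by
  have h : ∀ V W : Derivation ℂ R R, derWedge V W ∈ skewBiderivations R :=
    derWedge_isSkewBiderivation
  change matrixBracket star ε M P F ∈ skewBiderivations R
  refine add_mem (Submodule.smul_mem _ _ (sum_mem fun a _ => Submodule.smul_mem _ _ (sum_mem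
    fun i _ => sum_mem fun j _ => sum_mem fun k _ => h _ _)))
    (Submodule.smul_mem _ _ (sum_mem fun a _ => sum_mem fun b _ => ?_))
  split_ifs
  · exact sum_mem fun i _ => sum_mem fun j _ => h _ _
  · exact zero_mem _

theorem matrixBracket_apply (f g : R) :
    matrixBracket star ε M P F f g =
      (1 / 2 : ℂ) • ∑ a, ε a • ∑ i, ∑ j, ∑ k, M a i j *
        (P a j k f * P (star a) k i g - P (star a) k i f * P a j k g)
      - (1 / 2 : ℂ) • ∑ a, ∑ b, if a < b then
          ∑ i, ∑ j, (F a i j f * F b j i g - F b j i f * F a i j g) else 0 := by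
  unfold matrixBracket
  simp only [LinearMap.add_apply, LinearMap.smul_apply, LinearMap.sum_apply, derWedge_apply,
    Derivation.smul_apply, smul_eq_mul]
  rw [neg_smul, ← sub_eq_add_neg]
  congr 1
  · congr 1
    refine Finset.sum_congr rfl fun a _ => ?_
    congr 1
    refine Finset.sum_congr rfl fun i _ => Finset.sum_congr rfl fun j _ =>
      Finset.sum_congr rfl fun k _ => ?_
    ring
  · congr 1
    refine Finset.sum_congr rfl fun a _ => Finset.sum_congr rfl fun b _ => ?_
    split_ifs
    · simp only [LinearMap.sum_apply, derWedge_apply]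
    · rfl

/-- The form `∑ ε(a) tr [M_a P_a f P_{a*} g]`. -/
noncomputable def edgeForm (f g : R) : R :=
  ∑ a, ε a • ∑ i, ∑ j, ∑ k, M a i j * (P a j k f * P (star a) k i g)

theorem sum_lt_eq_sum_ord {E : Type*} [Fintype E] [LinearOrder (DArrow E)]
    (s : DArrow E → DArrow E → R) :
    ∑ a, ∑ b, (if a < b then s a b - s b a else 0) = ∑ a, ∑ b, a.ord b • s a b := by
  have h : ∀ a b, a.ord b • s a b = (if a < b then s a b else 0) - if b < a then s a b else 0 := by
    intro a b
    unfold DArrow.ord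
    rcases lt_trichotomy a b with h | h | h
    · simp [h, h.not_gt]
    · simp [h]
    · simp [h, h.not_gt]
  simp only [h, Finset.sum_sub_distrib]
  rw [Finset.sum_comm (f := fun a b => if b < a then s a b else 0)]
  simp only [← Finset.sum_sub_distrib]
  refine Finset.sum_congr rfl fun a _ => Finset.sum_congr rfl fun b _ => ?_
  split_ifs <;> simp

/-- The first sum is the skew-symmetrisation of `edgeForm`. In the second, transposing the trace
indices turns the wedge over `a < b` into a full sum weighted by `ord`, which matches the
coefficients of `fusionValue`. -/
theorem matrixBracket_eq {E : Type*} [Fintype E] [LinearOrder (DArrow E)]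
    (star : DArrow E → DArrow E) (ε : DArrow E → ℂ) (M : DArrow E → Matrix J J R)
    (P F : DArrow E → J → J → Derivation ℂ R R) (f g : R) :
    matrixBracket star ε M P F f g =
      (1 / 2 : ℂ) • (edgeForm star ε M P f g - edgeForm star ε M P g f) -
        (1 / 2 : ℂ) • ∑ a, ∑ b, a.ord b • ∑ i, ∑ j, F a i j f * F b j i g := by
  have h1 : ∑ a, ε a • ∑ i, ∑ j, ∑ k, M a i j *
      (P a j k f * P (star a) k i g - P (star a) k i f * P a j k g) =
        edgeForm star ε M P f g - edgeForm star ε M P g f := by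
    unfold edgeForm
    rw [← Finset.sum_sub_distrib]
    refine Finset.sum_congr rfl fun a _ => ?_
    rw [← smul_sub]
    congr 1
    simp only [← Finset.sum_sub_distrib]
    refine Finset.sum_congr rfl fun i _ => Finset.sum_congr rfl fun j _ =>
      Finset.sum_congr rfl fun k _ => ?_
    ring
  have h2 : ∀ a b, ∑ i, ∑ j, (F a i j f * F b j i g - F b j i f * F a i j g) =
      ∑ i, ∑ j, F a i j f * F b j i g - ∑ i, ∑ j, F b i j f * F a j i g := fun a b => by
    rw [Finset.sum_comm (f := fun i j => F b i j f * F a j i g)]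
    simp only [← Finset.sum_sub_distrib]
  rw [matrixBracket_apply, h1]
  simp only [h2]
  rw [sum_lt_eq_sum_ord fun a b => ∑ i, ∑ j, F a i j f * F b j i g]

end SkewBiderivations

/-! ### The bracket of coordinates -/

section QuiverCoordinates

variable {I E : Type*} [Fintype I] [DecidableEq I]

open Classical in
/-- Matrices `x_a` of functions with the vector fields `P_a` of partial derivatives. -/
structure IsQuiverCoordinates (n : I → ℕ) (Q : FinQuiver I E) {R : Type*} [CommRing R]
    [Algebra ℂ R] (x : DArrow E → Matrix (DimIdx n) (DimIdx n) R)
    (P : DArrow E → DimIdx n → DimIdx n → Derivation ℂ R R) : Prop where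
  block : ∀ a i j, ¬ (i.1 = Q.dtail a ∧ j.1 = Q.dhead a) → x a i j = 0
  partial_apply : ∀ a b i j k l, P a i j (x b k l) =
    if b = a ∧ k = j ∧ l = i ∧ i.1 = Q.dhead a ∧ j.1 = Q.dtail a then 1 else 0

/-- The entry `(i, j)` of `∂_{a*} X_{a*} - X_a ∂_a` as a derivation. -/
noncomputable def fusDer {J R : Type*} [Fintype J] [CommRing R] [Algebra ℂ R]
    (x : DArrow E → Matrix J J R) (P : DArrow E → J → J → Derivation ℂ R R) (a : DArrow E)
    (i j : J) : Derivation ℂ R R :=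
  ∑ k, (x a.star k j • P a.star i k - x a i k • P a k j)

variable {n : I → ℕ} {Q : FinQuiver I E} {R : Type*} [CommRing R] [Algebra ℂ R]
  {x : DArrow E → Matrix (DimIdx n) (DimIdx n) R}
  {P : DArrow E → DimIdx n → DimIdx n → Derivation ℂ R R}

namespace IsQuiverCoordinates

-- The field for `c` sees only two coordinate matrices: it acts on columns of `x a` for `c = a*` and
-- on rows for `c = a`. The condition `p.1 = q.1` comes from the block shape.
open Classical in
theorem fusDer_apply (hx : IsQuiverCoordinates n Q x P) (c a : DArrow E) (p q i j : DimIdx n) :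
    fusDer x P c p q (x a i j) =
      (if c = a.star then (if p = j ∧ p.1 = q.1 then x a i q else 0) else 0) -
      (if c = a then (if q = i ∧ p.1 = q.1 then x a p j else 0) else 0) := by
  rw [fusDer, Derivation.sum_apply]
  simp only [Derivation.sub_apply, Derivation.smul_apply, smul_eq_mul, Finset.sum_sub_distrib,
    hx.partial_apply]
  congr 1
  · rw [Finset.sum_eq_single i]
    · by_cases h : c = a.star
      · subst h
        by_cases hz : i.1 = Q.dtail a ∧ q.1 = Q.dhead a
        · simp only [DArrow.star_star, hz, true_and,
            if_true, and_true, eq_comm (a := j)]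
          by_cases hp : p = j <;> simp [hp]
        · simp [hx.block a i q hz]
      · have h' : ¬ a = c.star := fun h' => h (by rw [h', DArrow.star_star])
        simp [h, h']
    · intro k _ hk
      simp [hk.symm]
    · simp
  · rw [Finset.sum_eq_single j]
    · by_cases h : c = a
      · subst h
        by_cases hz : p.1 = Q.dtail c ∧ j.1 = Q.dhead c
        · simp only [hz, true_and, if_true, eq_comm (a := i)]
          by_cases hq : q = i
          · simp [hq, eq_comm]
          · simp [hq]
        · simp [hx.block c p j hz]
      · simp [h, Ne.symm h]
    · intro k _ hk
      simp [hk.symm]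
    · simp

end IsQuiverCoordinates

end QuiverCoordinates

section VertexProj

variable {I R : Type*} [DecidableEq I] {n : I → ℕ} [CommRing R]

theorem vertexProj_apply (s : I) (i j : DimIdx n) :
    vertexProj n R s i j = if i = j then (if i.1 = s then 1 else 0) else 0 := by
  simp only [vertexProj, Matrix.diagonal_apply]

variable [Fintype I]

theorem vertexProj_mul_apply (M : Matrix (DimIdx n) (DimIdx n) R) (s : I) (i j : DimIdx n) :
    (vertexProj n R s * M) i j = if i.1 = s then M i j else 0 := by
  simp only [vertexProj, Matrix.diagonal_mul]
  split_ifs <;> simp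

theorem mul_vertexProj_apply (M : Matrix (DimIdx n) (DimIdx n) R) (s : I) (i j : DimIdx n) :
    (M * vertexProj n R s) i j = if j.1 = s then M i j else 0 := by
  simp only [vertexProj, Matrix.mul_diagonal]
  split_ifs <;> simp

end VertexProj

section CoordinateBrackets

variable {I E : Type*} [Fintype I] [DecidableEq I] {n : I → ℕ} {Q : FinQuiver I E}
  {R : Type*} [CommRing R] [Algebra ℂ R] {x : DArrow E → Matrix (DimIdx n) (DimIdx n) R}
  {P : DArrow E → DimIdx n → DimIdx n → Derivation ℂ R R}

/-- The matrix `γ_a Id + X_{a*} X_a`. -/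
noncomputable def momentMat {J R : Type*} [Fintype J] [DecidableEq J] [CommRing R] [Algebra ℂ R]
    (γ : E → ℂ) (x : DArrow E → Matrix J J R) (a : DArrow E) : Matrix J J R :=
  γ a.base • 1 + x a.star * x a

namespace IsQuiverCoordinates

theorem star_mul_apply_eq_zero (hx : IsQuiverCoordinates n Q x P) {a : DArrow E} {i j : DimIdx n}
    (h : ¬ (i.1 = Q.dhead a ∧ j.1 = Q.dhead a)) : (x a.star * x a) i j = 0 := by
  rw [Matrix.mul_apply]
  refine Finset.sum_eq_zero fun k _ => ?_
  by_cases h1 : i.1 = Q.dhead a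
  · rw [hx.block a k j fun h2 => h ⟨h1, h2.2⟩, mul_zero]
  · rw [hx.block a.star i k fun h2 => h1 h2.1, zero_mul]

variable [Fintype E]

open Classical in
theorem edgeForm_apply (hx : IsQuiverCoordinates n Q x P) (ε : DArrow E → ℂ)
    (M : DArrow E → Matrix (DimIdx n) (DimIdx n) R) (a b : DArrow E) (i j k l : DimIdx n) :
    edgeForm DArrow.star ε M P (x a i j) (x b k l) =
      if b = a.star ∧ l = i ∧ i.1 = Q.dtail a ∧ j.1 = Q.dhead a ∧ k.1 = Q.dhead a then
        ε a • M a k j else 0 := by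
  unfold edgeForm
  simp only [hx.partial_apply]
  rw [Finset.sum_eq_single a, Finset.sum_eq_single k, Finset.sum_eq_single j,
    Finset.sum_eq_single i]
  · by_cases h1 : b = a.star <;> by_cases h2 : l = i <;> by_cases h3 : i.1 = Q.dtail a <;>
      by_cases h4 : j.1 = Q.dhead a <;> by_cases h5 : k.1 = Q.dhead a <;>
      simp [h1, h2, h3, h4, h5]
  · intro r _ hr
    simp [hr.symm]
  · simp
  · intro q _ hq
    simp [hq.symm]
  · simp
  · intro p _ hp
    simp [hp.symm]
  · simp
  · intro c _ hc
    simp [hc.symm]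
  · simp

variable {A : Type*} [Ring A] [Algebra ℂ A] {ve : I → A} {ar : DArrow E → A}
  {ρ : A →ₐ[ℂ] Matrix (DimIdx n) (DimIdx n) R}

/-- The arrow `a` contributes `½ γ_a` and the product `x_{a*} x_a`, its opposite contributes the
other `½ γ_a` and `x_a x_{a*}`. The sign from skew-symmetry compensates `ε(a*) = -ε(a)`. -/
theorem edgePart_eq (hx : IsQuiverCoordinates n Q x P) (γ : E → ℂ)
    (hve : ∀ s, ρ (ve s) = vertexProj n R s) (har : ∀ a, ρ (ar a) = x a) (a b : DArrow E)
    (i j k l : DimIdx n) :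
    (1 / 2 : ℂ) • (edgeForm DArrow.star DArrow.sign (momentMat γ x) P (x a i j) (x b k l) -
      edgeForm DArrow.star DArrow.sign (momentMat γ x) P (x b k l) (x a i j)) =
      kronRep ρ (edgeValue Q γ ve ar a b) (k, i) (j, l) := by
  classical
  rw [hx.edgeForm_apply, hx.edgeForm_apply]
  unfold edgeValue
  by_cases h : b = a.star
  · subst h
    simp only [DArrow.star_star, true_and, if_true, DArrow.sign_star, FinQuiver.dtail_star,
      FinQuiver.dhead_star, map_smul, map_add, Matrix.smul_apply, Matrix.add_apply,
      kronRep_tmul_apply, map_mul, hve, har, vertexProj_apply, momentMat, DArrow.base_star]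
    have h1 : ∀ k j, ¬ (k.1 = Q.dhead a ∧ j.1 = Q.dhead a) → (x a.star * x a) k j = 0 :=
      fun k j => hx.star_mul_apply_eq_zero
    have h2 : ∀ i l, ¬ (i.1 = Q.dtail a ∧ l.1 = Q.dtail a) → (x a * x a.star) i l = 0 :=
      fun i l h => by
        have := hx.star_mul_apply_eq_zero (a := a.star) (i := i) (j := l)
        simp only [DArrow.star_star, FinQuiver.dhead_star] at this
        exact this h
    by_cases hl : l = i
    · subst hl
      by_cases hj : j = k
      · subst hj
        by_cases h3 : l.1 = Q.dtail a <;> by_cases h4 : j.1 = Q.dhead a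
        · simp only [h3, h4, if_true, and_self, Matrix.one_apply, mul_one, one_mul]
          module
        · simp [h3, h4, h1]
        · simp [h3, h4, h2]
        · simp [h3, h4]
      · by_cases h3 : l.1 = Q.dtail a <;> by_cases h4 : j.1 = Q.dhead a <;>
          by_cases h5 : k.1 = Q.dhead a
        · simp only [h3, h4, h5, if_true, and_self, Matrix.one_apply, mul_one, Ne.symm hj, hj,
            if_false, false_and, zero_mul]
          module
        all_goals simp [h3, h4, h5, h1, h2, hj, Ne.symm hj]
    · by_cases hj : j = k
      · subst hj
        by_cases h3 : l.1 = Q.dtail a <;> by_cases h4 : j.1 = Q.dhead a <;>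
          by_cases h5 : i.1 = Q.dtail a
        · simp only [h3, h4, h5, if_true, and_self, Matrix.one_apply, one_mul, Ne.symm hl, hl,
            if_false, false_and, mul_zero]
          module
        all_goals simp [h3, h4, h5, h1, h2, hl, Ne.symm hl]
      · simp [hl, hj, Ne.symm hl, Ne.symm hj]
  · have h' : a ≠ b.star := fun h' => h (by rw [h', DArrow.star_star])
    simp [h, h']

end IsQuiverCoordinates

end CoordinateBrackets

namespace IsQuiverCoordinates

variable {I E : Type*} [Fintype I] [DecidableEq I] [Fintype E] {n : I → ℕ} {Q : FinQuiver I E}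
  {R : Type*} [CommRing R] [Algebra ℂ R] {x : DArrow E → Matrix (DimIdx n) (DimIdx n) R}
  {P : DArrow E → DimIdx n → DimIdx n → Derivation ℂ R R}
  {A : Type*} [Ring A] [Algebra ℂ A] {ve : I → A} {ar : DArrow E → A}
  {ρ : A →ₐ[ℂ] Matrix (DimIdx n) (DimIdx n) R}

/-! ### Fusion part of the bracket of coordinates and the infinitesimal action -/

section Sums

open Classical in
theorem sum_sum_smul_ite {S R J : Type*} [Fintype S] [CommRing R] [Algebra ℂ R]
    [Fintype J] (o : S → S → ℂ) (a a' b b' : S) (α β α' β' : J → J → R) :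
    ∑ c, ∑ d, o c d • ∑ p, ∑ q, ((if c = a' then α p q else 0) - (if c = a then β p q else 0)) *
      ((if d = b' then α' q p else 0) - (if d = b then β' q p else 0)) =
    o a' b' • ∑ p, ∑ q, α p q * α' q p - o a' b • ∑ p, ∑ q, α p q * β' q p -
      o a b' • ∑ p, ∑ q, β p q * α' q p + o a b • ∑ p, ∑ q, β p q * β' q p := by
  have key : ∀ c d, ∑ p, ∑ q, ((if c = a' then α p q else 0) - (if c = a then β p q else 0)) *
      ((if d = b' then α' q p else 0) - (if d = b then β' q p else 0)) =
      (if c = a' then if d = b' then ∑ p, ∑ q, α p q * α' q p else 0 else 0) -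
      (if c = a' then if d = b then ∑ p, ∑ q, α p q * β' q p else 0 else 0) -
      (if c = a then if d = b' then ∑ p, ∑ q, β p q * α' q p else 0 else 0) +
      (if c = a then if d = b then ∑ p, ∑ q, β p q * β' q p else 0 else 0) := by
    intro c d
    split_ifs <;>
      simp only [sub_zero, zero_sub, zero_mul, mul_zero, sub_mul, mul_sub, Finset.sum_sub_distrib,
        Finset.sum_neg_distrib, neg_mul, mul_neg, Finset.sum_const_zero] <;> ring
  simp only [key, smul_add, smul_sub, Finset.sum_add_distrib, Finset.sum_sub_distrib, smul_ite,
    smul_zero]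
  simp

end Sums

variable [LinearOrder (DArrow E)]

/-- Only `c ∈ {a, a*}` and `d ∈ {b, b*}` contribute. The four resulting pairs are the four sums of
`fusionValue`, evaluated in `e1` to `e4`. -/
theorem fusionPart_eq (hx : IsQuiverCoordinates n Q x P)
    (hve : ∀ s, ρ (ve s) = vertexProj n R s) (har : ∀ a, ρ (ar a) = x a) (a b : DArrow E)
    (i j k l : DimIdx n) :
    -((1 / 2 : ℂ) • ∑ c, ∑ d, c.ord d • ∑ p, ∑ q,
      fusDer x P c p q (x a i j) * fusDer x P d q p (x b k l)) =
      kronRep ρ (fusionValue ve ar a b) (k, i) (j, l) := by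
  classical
  simp only [hx.fusDer_apply]
  refine (congrArg (fun t => -((1 / 2 : ℂ) • t)) (sum_sum_smul_ite (fun c d => DArrow.ord c d)
    a a.star b b.star (fun p q => if p = j ∧ p.1 = q.1 then x a i q else 0)
    (fun p q => if q = i ∧ p.1 = q.1 then x a p j else 0)
    (fun p q => if p = l ∧ p.1 = q.1 then x b k q else 0)
    (fun p q => if q = k ∧ p.1 = q.1 then x b p l else 0))).trans ?_
  unfold fusionValue
  simp only [map_add, map_sub, map_smul, map_sum, Matrix.add_apply, Matrix.sub_apply,
    Matrix.smul_apply, Matrix.sum_apply, kronRep_tmul_apply, map_mul, hve, har]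
  have e1 : ∑ p : DimIdx n, ∑ q : DimIdx n, (if p = j ∧ p.1 = q.1 then x a i q else 0) *
      (if q = l ∧ q.1 = p.1 then x b k p else 0) =
      ∑ v, (x b * vertexProj n R v) k j * (x a * vertexProj n R v) i l := by
    rw [Finset.sum_eq_single j, Finset.sum_eq_single l]
    · simp only [mul_vertexProj_apply, true_and, ite_mul, zero_mul, Finset.sum_ite_eq,
        Finset.mem_univ, if_true, eq_comm (a := l.1)]
      split_ifs <;> ring
    · intro q _ hq
      simp [hq]
    · simp
    · intro p _ hp
      simp [hp]
    · simp
  have e2 : ∑ p : DimIdx n, ∑ q : DimIdx n, (if p = j ∧ p.1 = q.1 then x a i q else 0) *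
      (if p = k ∧ q.1 = p.1 then x b q l else 0) =
      ∑ v, vertexProj n R v k j * (x a * vertexProj n R v * x b) i l := by
    rw [Finset.sum_eq_single j]
    · simp only [true_and, vertexProj_apply]
      by_cases h : j = k
      · subst h
        simp only [if_true, true_and, ite_mul, zero_mul, one_mul, Finset.sum_ite_eq,
          Finset.mem_univ, Matrix.mul_apply (N := x b), mul_vertexProj_apply]
        refine Finset.sum_congr rfl fun q _ => ?_
        simp only [eq_comm (a := j.1)]
        split_ifs <;> simp
      · simp [h, Ne.symm h]
    · intro p _ hp
      simp [hp]
    · simp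
  have e3 : ∑ p : DimIdx n, ∑ q : DimIdx n, (if q = i ∧ p.1 = q.1 then x a p j else 0) *
      (if q = l ∧ q.1 = p.1 then x b k p else 0) =
      ∑ v, (x b * vertexProj n R v * x a) k j * vertexProj n R v i l := by
    rw [Finset.sum_comm, Finset.sum_eq_single i]
    · simp only [true_and, vertexProj_apply]
      by_cases h : i = l
      · subst h
        simp only [if_true, true_and, mul_ite, mul_zero, mul_one, Finset.sum_ite_eq,
          Finset.mem_univ, Matrix.mul_apply (N := x a), mul_vertexProj_apply]
        refine Finset.sum_congr rfl fun q _ => ?_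
        simp only [eq_comm (a := i.1)]
        split_ifs <;> ring
      · simp [h]
    · intro p _ hp
      simp [hp]
    · simp
  have e4 : ∑ p : DimIdx n, ∑ q : DimIdx n, (if q = i ∧ p.1 = q.1 then x a p j else 0) *
      (if p = k ∧ q.1 = p.1 then x b q l else 0) =
      ∑ v, (vertexProj n R v * x a) k j * (vertexProj n R v * x b) i l := by
    rw [Finset.sum_eq_single k, Finset.sum_eq_single i]
    · simp only [vertexProj_mul_apply, true_and, ite_mul, zero_mul, Finset.sum_ite_eq,
        Finset.mem_univ, if_true]
      by_cases h : k.1 = i.1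
      · simp [h]
      · simp [h, Ne.symm h]
    · intro q _ hq
      simp [hq]
    · simp
    · intro p _ hp
      simp [hp]
    · simp
  rw [e1, e2, e3, e4]
  module

theorem matrixBracket_apply (hx : IsQuiverCoordinates n Q x P) (γ : E → ℂ)
    (hve : ∀ s, ρ (ve s) = vertexProj n R s) (har : ∀ a, ρ (ar a) = x a) (a b : DArrow E)
    (i j k l : DimIdx n) :
    matrixBracket DArrow.star DArrow.sign (momentMat γ x) P (fusDer x P) (x a i j) (x b k l) =
      kronRep ρ (edgeValue Q γ ve ar a b + fusionValue ve ar a b) (k, i) (j, l) := by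
  rw [matrixBracket_eq, hx.edgePart_eq γ hve har, map_add, Matrix.add_apply,
    ← hx.fusionPart_eq hve har, sub_eq_add_neg]

/-- The infinitesimal action of the general linear group of the vertex `v`. -/
noncomputable def _root_.glDer (x : DArrow E → Matrix (DimIdx n) (DimIdx n) R)
    (P : DArrow E → DimIdx n → DimIdx n → Derivation ℂ R R) (v : I) (p q : DimIdx n) :
    Derivation ℂ R R :=
  if p.1 = v ∧ q.1 = v then ∑ c, fusDer x P c p q else 0

/-- Summing over all arrows adds the column action of `c = a*` and the row action of `c = a`.
Together they are the derivative of conjugation, up to sign. -/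
theorem glDer_apply (hx : IsQuiverCoordinates n Q x P) (v : I) (p q : DimIdx n) (a : DArrow E)
    (i j : DimIdx n) : glDer x P v p q (x a i j) =
      vertexProj n R v p j * (x a * vertexProj n R v) i q -
        (vertexProj n R v * x a) p j * vertexProj n R v i q := by
  classical
  rw [mul_vertexProj_apply, vertexProj_mul_apply, vertexProj_apply, vertexProj_apply]
  unfold glDer
  by_cases h : p.1 = v ∧ q.1 = v
  · rw [if_pos h, Derivation.sum_apply]
    simp only [hx.fusDer_apply, Finset.sum_sub_distrib, Finset.sum_ite_eq',
      Finset.mem_univ, if_true, h.1, h.2, and_true, ite_mul, one_mul, zero_mul, mul_ite, mul_one,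
      mul_zero, eq_comm (a := i)]
    by_cases hq : q = i
    · subst hq
      simp [h.2]
    · simp [hq]
  · rw [if_neg h]
    by_cases h1 : p.1 = v
    · have h2 : ¬ q.1 = v := fun h2 => h ⟨h1, h2⟩
      by_cases hq : i = q
      · subst hq
        simp [h2]
      · simp [h2, hq]
    · simp [h1]

end IsQuiverCoordinates

/-! ### Invariant functions -/

section Invariants

theorem sum_single_mul_apply {J R : Type*} [Fintype J] [DecidableEq J] [CommRing R]
    (M : Matrix J J R) (G : J → J → R) (q p : J) :
    ∑ i, ∑ j, (Matrix.single q p (1 : R) * M) i j * G j i = ∑ k, M p k * G k q := by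
  rw [Finset.sum_eq_single q]
  · simp
  · intro i _ hi
    simp [hi]
  · simp

theorem sum_mul_single_apply {J R : Type*} [Fintype J] [DecidableEq J] [CommRing R]
    (M : Matrix J J R) (G : J → J → R) (q p : J) :
    ∑ i, ∑ j, (M * Matrix.single q p (1 : R)) i j * G j i = ∑ k, M k q * G p k := by
  rw [Finset.sum_comm, Finset.sum_eq_single p]
  · simp
  · intro j _ hj
    simp [hj]
  · simp

theorem glMat_mulSingle {I : Type*} [DecidableEq I] {n : I → ℕ} (v : I)
    (w : GL (Fin (n v)) ℂ) (q p : Fin (n v)) (u : ℂ)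
    (hw : (w : Matrix (Fin (n v)) (Fin (n v)) ℂ) = 1 + u • Matrix.single q p 1) :
    glMat n (Pi.mulSingle v w) = 1 + u • Matrix.single ⟨v, q⟩ ⟨v, p⟩ 1 := by
  ext ⟨r, i⟩ ⟨s, j⟩
  rw [glMat]
  by_cases hrs : r = s
  · subst hrs
    rw [Matrix.blockDiagonal'_apply_eq]
    by_cases hv : r = v
    · subst hv
      rw [Pi.mulSingle_eq_same, hw]
      simp [Matrix.one_apply, Matrix.single_apply]
    · rw [Pi.mulSingle_eq_of_ne hv]
      simp [Matrix.one_apply, Ne.symm hv]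
  · rw [Matrix.blockDiagonal'_apply_ne _ _ _ hrs, Matrix.add_apply, Matrix.smul_apply,
      Matrix.one_apply_ne (fun h => hrs (congrArg Sigma.fst h)), Matrix.single_apply, if_neg]
    · simp
    · rintro ⟨h1, h2⟩
      exact hrs ((congrArg Sigma.fst h1).symm.trans (congrArg Sigma.fst h2))

/-- The elementary matrix squares to itself or to zero, so `1 - c E` is inverse to `1 + u E` exactly
under the relation `hc`. -/
theorem exists_glMat_eq {I : Type*} [DecidableEq I] {n : I → ℕ} (v : I) (q p : Fin (n v)) {u c : ℂ}
    (hc : u - c - u * c * (if p = q then 1 else 0) = 0) :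
    ∃ g : ∀ s, GL (Fin (n s)) ℂ, glMat n g = 1 + u • Matrix.single ⟨v, q⟩ ⟨v, p⟩ 1 ∧
      glMat n g⁻¹ = 1 - c • Matrix.single ⟨v, q⟩ ⟨v, p⟩ 1 := by
  have hE : Matrix.single q p (1 : ℂ) * Matrix.single q p 1 =
      (if p = q then 1 else 0 : ℂ) • Matrix.single q p 1 := by
    split_ifs with h
    · subst h
      simp
    · rw [Matrix.single_mul_single_of_ne _ _ _ _ h, zero_smul]
  have h1 : (1 + u • Matrix.single q p (1 : ℂ)) * (1 + (-c) • Matrix.single q p 1) = 1 := by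
    rw [add_mul, mul_add, mul_add, smul_mul_smul_comm, hE, smul_smul, one_mul, mul_one, one_mul]
    have h : -c + (u + u * -c * (if p = q then 1 else 0)) = 0 := by
      linear_combination hc
    calc _ = 1 + (-c + (u + u * -c * (if p = q then 1 else 0))) • Matrix.single q p (1 : ℂ) := by
          module
      _ = 1 := by rw [h, zero_smul, add_zero]
  let w : GL (Fin (n v)) ℂ :=
    ⟨1 + u • Matrix.single q p 1, 1 + (-c) • Matrix.single q p 1, h1, mul_eq_one_comm.1 h1⟩
  refine ⟨Pi.mulSingle v w, glMat_mulSingle v w q p u rfl, ?_⟩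
  rw [← Pi.mulSingle_inv, glMat_mulSingle v w⁻¹ q p (-c) rfl, neg_smul, sub_eq_add_neg]

open Topology Filter

variable {I E : Type*} [Fintype I] [DecidableEq I] {n : I → ℕ} {Q : FinQuiver I E} {γ : E → ℂ}

theorem univRep_vert (s : I) : univRep n Q γ (AQ.e Q γ s) = vertexProj n _ s := by
  rw [univRep, AQ.e, RingQuot.liftAlgHom_mkAlgHom_apply, freeRep, PathGen.fe,
    FreeAlgebra.lift_ι_apply]

theorem isQuiverCoordinates_univMat [Fintype E] :
    IsQuiverCoordinates n Q (univMat n Q γ) partialDer where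
  block a i j h := evalAt_ext fun X => by
    rw [map_zero]
    exact apply_eq_zero_of_mem_repSpace X.2 h
  partial_apply := partialDer_univMat

/-- The orbit of `1 + u E` is a curve with velocity the commutator of `E` with `X`. The denominator
`1 + u`, present only for a diagonal `E`, is nonzero for small `u`. -/
theorem isCurve_orbit [Fintype E] (X : repSpace n Q γ) (v : I) (q p : Fin (n v)) :
    IsCurve X (fun u a => (1 + u • Matrix.single ⟨v, q⟩ ⟨v, p⟩ 1) * X.1 a *
        (1 - (u / (1 + (if p = q then 1 else 0) * u)) • Matrix.single ⟨v, q⟩ ⟨v, p⟩ 1))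
      (fun a => Matrix.single ⟨v, q⟩ ⟨v, p⟩ 1 * X.1 a - X.1 a * Matrix.single ⟨v, q⟩ ⟨v, p⟩ 1) ∧
    ∀ᶠ u in 𝓝 (0 : ℂ), ∃ g, (fun a => (1 + u • Matrix.single ⟨v, q⟩ ⟨v, p⟩ 1) * X.1 a *
        (1 - (u / (1 + (if p = q then 1 else 0) * u)) • Matrix.single ⟨v, q⟩ ⟨v, p⟩ 1)) =
      (act g X).1 := by
  have h0 : ∀ᶠ u in 𝓝 (0 : ℂ), 1 + (if p = q then 1 else 0) * u ≠ 0 := by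
    refine ContinuousAt.eventually_ne (g := fun u : ℂ => 1 + (if p = q then 1 else 0) * u) ?_ ?_
    · fun_prop
    · simp
  have h1 : ∀ᶠ u in 𝓝 (0 : ℂ), ∃ g, (fun a => (1 + u • Matrix.single ⟨v, q⟩ ⟨v, p⟩ 1) * X.1 a *
        (1 - (u / (1 + (if p = q then 1 else 0) * u)) • Matrix.single ⟨v, q⟩ ⟨v, p⟩ 1)) =
      (act g X).1 := by
    filter_upwards [h0] with u hu
    obtain ⟨g, hg, hg'⟩ := exists_glMat_eq v q p (u := u)
      (c := u / (1 + (if p = q then 1 else 0) * u)) (by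
        linear_combination -(div_mul_cancel₀ u hu))
    refine ⟨g, ?_⟩
    rw [← hg, ← hg']
    rfl
  refine ⟨⟨?_, ?_, fun a i j => ?_⟩, h1⟩
  · funext a
    simp
  · filter_upwards [h1] with u hu
    obtain ⟨g, hg⟩ := hu
    rw [hg]
    exact (act g X).2
  · set M : Matrix (DimIdx n) (DimIdx n) ℂ := Matrix.single ⟨v, q⟩ ⟨v, p⟩ 1
    set ε : ℂ := if p = q then 1 else 0
    have hc : HasDerivAt (fun u : ℂ => u / (1 + ε * u)) 1 0 := by
      have h := (hasDerivAt_id (0 : ℂ)).div (((hasDerivAt_id (0 : ℂ)).const_mul ε).const_add 1)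
        (by simp)
      refine h.congr_deriv ?_
      simp
    have hu := hasDerivAt_id (0 : ℂ)
    have h := (((hu.mul_const ((M * X.1 a) i j)).const_add (X.1 a i j)).sub
      (hc.mul_const ((X.1 a * M) i j))).sub ((hu.mul hc).mul_const ((M * X.1 a * M) i j))
    refine (h.congr_of_eventuallyEq (Eventually.of_forall fun u => ?_)).congr_deriv ?_
    · simp only [add_mul, mul_sub, one_mul, mul_one, Matrix.smul_mul, Matrix.mul_smul,
        Matrix.add_apply, Matrix.sub_apply, Matrix.smul_apply, smul_eq_mul,
        Pi.sub_apply, Pi.mul_apply, id]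
      ring
    · simp

theorem DArrow.sum_star {E M : Type*} [Fintype E] [AddCommMonoid M] (s : DArrow E → M) :
    ∑ a : DArrow E, s a.star = ∑ a, s a :=
  Equiv.sum_comp (Function.Involutive.toPerm DArrow.star DArrow.star_star) s

theorem glDer_eq_zero [Fintype E] {f : coordRing n Q γ}
    (hf : ∀ g X, f.1 (act g X) = f.1 X) (v : I) (p q : DimIdx n) :
    glDer (univMat n Q γ) partialDer v p q f = 0 := by
  unfold glDer
  split_ifs with h
  · obtain ⟨r, p⟩ := p
    obtain ⟨s, q⟩ := q
    obtain ⟨rfl, rfl⟩ : r = v ∧ s = v := h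
    refine evalAt_ext fun X => ?_
    obtain ⟨hC, hg⟩ := isCurve_orbit X s q p
    -- An invariant function is constant along the orbit, so the chain rule expression is zero.
    have h1 := (hasDerivAt_curve f hC).unique
      ((hasDerivAt_const (0 : ℂ) (f.1 X)).congr_of_eventuallyEq
      (by
        filter_upwards [hg] with u hu
        obtain ⟨g, hg⟩ := hu
        rw [hg, extendZero_coe, hf]))
    simp only [Matrix.sub_apply, sub_mul, Finset.sum_sub_distrib, sum_single_mul_apply,
      sum_mul_single_apply (M := X.1 _) (G := fun j i => pder n Q γ _ j i f.1 X)] at h1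
    rw [Derivation.sum_apply, map_sum, map_zero]
    have h2 : ∀ c, evalAt n Q γ X (fusDer (univMat n Q γ) partialDer c ⟨s, p⟩ ⟨s, q⟩ f) =
        ∑ k, X.1 c.star k ⟨s, q⟩ * pder n Q γ c.star ⟨s, p⟩ k f.1 X -
          ∑ k, X.1 c ⟨s, p⟩ k * pder n Q γ c k ⟨s, q⟩ f.1 X := fun c => by
      rw [fusDer, Derivation.sum_apply, map_sum, ← Finset.sum_sub_distrib]
      rfl
    simp only [h2, Finset.sum_sub_distrib]
    -- The column terms are indexed by opposite arrows. After reindexing, the derivation is minus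
    -- the derivative along the orbit.
    rw [DArrow.sum_star fun c => ∑ k, X.1 c k ⟨s, q⟩ * pder n Q γ c ⟨s, p⟩ k f.1 X]
    linear_combination -h1
  · rfl

end Invariants

/-! ### Symmetries of brackets of matrix entries -/

section EntrySymmetries

/-- Transporting `b` by `σ` gives a skew biderivation, to be compared with `b` on `G`. -/
theorem map_bracket_of_determines {R : Type*} [CommRing R] [Algebra ℂ R]
    {b : R →ₗ[ℂ] R →ₗ[ℂ] R} (hb : IsSkewBiderivation b) {G : Set R}
    (hG : DeterminesDerivations G) (σ : R ≃ₐ[ℂ] R)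
    (h : ∀ x ∈ G, ∀ y ∈ G, σ (b x y) = b (σ x) (σ y)) (f g : R) : σ (b f g) = b (σ f) (σ g) := by
  let b' : R →ₗ[ℂ] R →ₗ[ℂ] R :=
    (b.compl₁₂ σ.toLinearMap σ.toLinearMap).compr₂ σ.symm.toLinearMap
  have hb' : ∀ f g, b' f g = σ.symm (b (σ f) (σ g)) := fun f g => rfl
  have hs : IsSkewBiderivation b' :=
    { skew := fun f g => by rw [hb', hb', hb.skew, map_neg]
      leibniz := fun f g h => by
        simp only [hb', map_mul, hb.leibniz, map_add, AlgEquiv.symm_apply_apply] }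
  have h0 : b = b' := hG.ext2 hb hs fun x hx y hy => by
    rw [hb', ← h x hx y hy, AlgEquiv.symm_apply_apply]
  conv_lhs => rw [h0]
  rw [hb', AlgEquiv.apply_symm_apply]

variable {A R J : Type*} [Ring A] [Algebra ℂ A] [CommRing R] [Algebra ℂ R] [Fintype J]
  [DecidableEq J] {ρ : A →ₐ[ℂ] Matrix J J R} {b : R →ₗ[ℂ] R →ₗ[ℂ] R}
  {D : A →ₗ[ℂ] A →ₗ[ℂ] A ⊗[ℂ] A}

theorem map_kronRep {σ : R ≃ₐ[ℂ] R} {w w' : Matrix J J ℂ}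
    (hσ : ∀ f i j, σ (ρ f i j) = ∑ p, ∑ q, (w i p * w' q j) • ρ f p q) (y : A ⊗[ℂ] A)
    (i j k l : J) : σ (kronRep ρ y (k, i) (j, l)) =
      ∑ r, ∑ s, ∑ p, ∑ q, ((w k r * w' s l) * (w i p * w' q j)) • kronRep ρ y (r, p) (q, s) := by
  induction y with
  | zero => simp
  | add x y hx hy =>
    simp only [map_add, Matrix.add_apply, hx, hy, smul_add, Finset.sum_add_distrib]
  | tmul x y =>
    simp only [kronRep_tmul_apply, map_mul, hσ]
    rw [Finset.sum_mul_sum]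
    refine Finset.sum_congr rfl fun r _ => ?_
    rw [Finset.sum_comm (f := fun s p => ∑ q, _)]
    refine Finset.sum_congr rfl fun p _ => ?_
    rw [Finset.sum_mul_sum, Finset.sum_comm]
    refine Finset.sum_congr rfl fun s _ => Finset.sum_congr rfl fun q _ => ?_
    rw [smul_mul_smul_comm]
    congr 1
    ring

/-- Conjugation has constant coefficients. It transforms the entries of `ρ ⊗ ρ` as it does the pair
of entries being bracketed, so the bracket is equivariant. -/
theorem map_entry_bracket (hb : IsSkewBiderivation b)
    (hbD : ∀ f g i j k l, b (ρ f i j) (ρ g k l) = kronRep ρ (D f g) (k, i) (j, l))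
    {S : Type*} {ar : S → A} (hG : DeterminesDerivations {x | ∃ a i j, x = ρ (ar a) i j})
    {σ : R ≃ₐ[ℂ] R} {w w' : Matrix J J ℂ}
    (hσ : ∀ f i j, σ (ρ f i j) = ∑ p, ∑ q, (w i p * w' q j) • ρ f p q) (f g : R) :
    σ (b f g) = b (σ f) (σ g) := by
  refine map_bracket_of_determines hb hG σ ?_ f g
  rintro _ ⟨a, i, j, rfl⟩ _ ⟨c, k, l, rfl⟩
  rw [hbD, map_kronRep hσ, hσ, hσ]
  simp only [map_sum, LinearMap.sum_apply, map_smul, LinearMap.smul_apply, hbD, Finset.smul_sum,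
    smul_smul]

/-- Both `f ↦ U (ρ f)` and `f ↦ ρ (d f)` are derivations twisted by `ρ`, and they agree on
generators. -/
theorem derivation_entry {I E : Type*} [Fintype I] {Q : FinQuiver I E}
    {ve : I → A} {ar : DArrow E → A} (hA : IsLocalizedPathAlgebra Q ve ar)
    {d : A →ₗ[ℂ] A} (hd : IsTwistedDer (AlgHom.id ℂ A) (AlgHom.id ℂ A) d)
    (hd0 : ∀ s, d (ve s) = 0) {U : Derivation ℂ R R} (hU0 : ∀ s i j, U (ρ (ve s) i j) = 0)
    (hU : ∀ a i j, U (ρ (ar a) i j) = ρ (d (ar a)) i j) (f : A) (i j : J) :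
    U (ρ f i j) = ρ (d f) i j := by
  let T : A →ₗ[ℂ] Matrix J J R :=
    { toFun := fun f => Matrix.of fun i j => U (ρ f i j)
      map_add' := fun f g => by ext; simp
      map_smul' := fun c f => by ext; simp }
  have hT : IsTwistedDer ρ ρ T := fun f g => by
    ext i j
    change U (ρ (f * g) i j) = _
    rw [map_mul, Matrix.mul_apply, map_sum, Matrix.add_apply, Matrix.mul_apply, Matrix.mul_apply,
      ← Finset.sum_add_distrib]
    refine Finset.sum_congr rfl fun k _ => ?_
    rw [Derivation.leibniz, smul_eq_mul, smul_eq_mul, mul_comm (ρ g k j)]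
    rfl
  have hT' : IsTwistedDer ρ ρ (ρ.toLinearMap ∘ₗ d) := fun f g => by
    simp [hd f g]
  have h : T = ρ.toLinearMap ∘ₗ d := hA.der_ext hT hT'
    (fun s => by ext i j; simp [T, hU0, hd0]) (fun a => by ext i j; simp [T, hU])
  exact congrFun (congrFun (LinearMap.congr_fun h f) i) j

theorem derivation_kronRep {d : A →ₗ[ℂ] A} {U : Derivation ℂ R R}
    (hU : ∀ f i j, U (ρ f i j) = ρ (d f) i j) (y : A ⊗[ℂ] A) (i j k l : J) :
    U (kronRep ρ y (k, i) (j, l)) = kronRep ρ (tensorDer d y) (k, i) (j, l) := by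
  induction y with
  | zero => simp
  | add x y hx hy => simp only [map_add, Matrix.add_apply, hx, hy]
  | tmul x y =>
    rw [tensorDer_tmul, map_add, Matrix.add_apply, kronRep_tmul_apply, kronRep_tmul_apply,
      kronRep_tmul_apply, Derivation.leibniz, hU, hU, smul_eq_mul, smul_eq_mul]
    ring

theorem preservesBracket_entries (hb : IsSkewBiderivation b)
    (hbD : ∀ f g i j k l, b (ρ f i j) (ρ g k l) = kronRep ρ (D f g) (k, i) (j, l))
    {S : Type*} {ar : S → A} (hG : DeterminesDerivations {x | ∃ a i j, x = ρ (ar a) i j})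
    {d : A →ₗ[ℂ] A} (hd : ∀ f g, tensorDer d (D f g) = D (d f) g + D f (d g))
    {U : Derivation ℂ R R} (hU : ∀ f i j, U (ρ f i j) = ρ (d f) i j) : PreservesBracket U b := by
  refine preservesBracket_of_determines hG hb ?_
  rintro _ ⟨a, i, j, rfl⟩ _ ⟨c, k, l, rfl⟩
  rw [hU, hU, hbD, hbD, hbD, derivation_kronRep hU, hd, map_add, Matrix.add_apply]

theorem sum_kronRep_eq_trace (y : A ⊗[ℂ] A) :
    ∑ i, ∑ k, kronRep ρ y (k, i) (i, k) = Matrix.trace (ρ (LinearMap.mul' ℂ A y)) := by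
  induction y with
  | zero => simp
  | add x y hx hy =>
    simp only [map_add, Matrix.add_apply, Finset.sum_add_distrib, hx, hy, Matrix.trace_add]
  | tmul x y =>
    simp only [kronRep_tmul_apply]
    rw [Finset.sum_comm, LinearMap.mul'_apply, map_mul]
    rfl

theorem bracket_trace
    (hbD : ∀ f g i j k l, b (ρ f i j) (ρ g k l) = kronRep ρ (D f g) (k, i) (j, l)) (f g : A) :
    b (Matrix.trace (ρ f)) (Matrix.trace (ρ g)) =
      Matrix.trace (ρ (LinearMap.mul' ℂ A (D f g))) := by
  rw [← sum_kronRep_eq_trace]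
  simp only [Matrix.trace, Matrix.diag_apply, map_sum, LinearMap.sum_apply, hbD]
  exact Finset.sum_comm

end EntrySymmetries

/-! ### Restriction to a subalgebra -/

section Restriction

variable {K R : Type*} [CommRing K] [Algebra ℂ K] [CommRing R] [Algebra ℂ R] {φ : K →ₐ[ℂ] R}

theorem exists_restrict_bracket (hφ : Function.Injective φ) {b : R →ₗ[ℂ] R →ₗ[ℂ] R}
    (hb : IsSkewBiderivation b) (hK : ∀ f g, ∃ h, φ h = b (φ f) (φ g))
    (hJ : ∀ f g h, hb.jacobiator (φ f) (φ g) (φ h) = 0) :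
    ∃ b' : K →ₗ[ℂ] K →ₗ[ℂ] K, IsPoissonBracket b' ∧ ∀ f g, φ (b' f g) = b (φ f) (φ g) := by
  choose B hB using hK
  have hadd : ∀ f f' g, B (f + f') g = B f g + B f' g := fun f f' g => hφ (by simp [hB])
  refine ⟨LinearMap.mk₂ ℂ B hadd (fun c f g => hφ (by simp [hB]))
    (fun f g g' => hφ (by simp [hB])) (fun c f g => hφ (by simp [hB])),
    ⟨fun f g => hφ ?_, fun f g h => hφ ?_, fun f g h => hφ ?_⟩, hB⟩
  · simp only [LinearMap.mk₂_apply, hB, map_neg]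
    exact hb.skew _ _
  · simp only [LinearMap.mk₂_apply, hB, map_mul, map_add]
    exact hb.leibniz _ _ _
  · simp only [LinearMap.mk₂_apply, hB, map_add, map_zero]
    rw [← hb.jacobiator_apply, hJ]

theorem exists_restrict_derivation (hφ : Function.Injective φ) {U : Derivation ℂ R R}
    (hK : ∀ f, ∃ h, φ h = U (φ f)) :
    ∃ U' : Derivation ℂ K K, ∀ f, φ (U' f) = U (φ f) := by
  choose B hB using hK
  exact ⟨Derivation.mk' { toFun := B
                          map_add' := fun f g => hφ (by simp [hB])
                          map_smul' := fun c f => hφ (by simp [hB]) }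
    fun f g => hφ (by simp [hB]), hB⟩

end Restriction

theorem map_derivation_of_determines {R : Type*} [CommRing R] [Algebra ℂ R] {G : Set R}
    (hG : DeterminesDerivations G) {U : Derivation ℂ R R} (σ : R ≃ₐ[ℂ] R)
    (h : ∀ x ∈ G, σ (U x) = U (σ x)) (f : R) : σ (U f) = U (σ f) := by
  let U' : Derivation ℂ R R :=
    Derivation.mk' (σ.symm.toLinearMap ∘ₗ (U : R →ₗ[ℂ] R) ∘ₗ σ.toLinearMap) fun f g => by
      simp [Derivation.leibniz]
  have hU' : ∀ f, U' f = σ.symm (U (σ f)) := fun f => rfl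
  have h0 : U = U' := hG.ext fun x hx => by
    rw [hU', ← h x hx, AlgEquiv.symm_apply_apply]
  conv_lhs => rw [h0]
  rw [hU', AlgEquiv.apply_symm_apply]

theorem Derivation.map_vertexProj {I R : Type*} [DecidableEq I] {n : I → ℕ} [CommRing R]
    [Algebra ℂ R] (U : Derivation ℂ R R) (s : I) (i j : DimIdx n) :
    U (vertexProj n R s i j) = 0 := by
  rw [vertexProj_apply]
  split_ifs <;> simp

/-! ### Scaling vector fields and assembly of the bracket on invariants -/

namespace IsQuiverCoordinates

variable {I E : Type*} [Fintype I] [DecidableEq I] {n : I → ℕ} {Q : FinQuiver I E}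
  {R : Type*} [CommRing R] [Algebra ℂ R] {x : DArrow E → Matrix (DimIdx n) (DimIdx n) R}
  {P : DArrow E → DimIdx n → DimIdx n → Derivation ℂ R R}

/-- The vector field which scales the arrow `i` and its opposite. -/
noncomputable def _root_.scaleDer {J : Type*} [Fintype J] (x : DArrow E → Matrix J J R)
    (P : DArrow E → J → J → Derivation ℂ R R) (a : E) : Derivation ℂ R R :=
  ∑ i, ∑ j, (x (.rev a) i j • P (.rev a) j i - x (.fwd a) i j • P (.fwd a) j i)

theorem euler_apply (hx : IsQuiverCoordinates n Q x P) (a b : DArrow E) (k l : DimIdx n)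
    [Decidable (b = a)] :
    ∑ i, ∑ j, x a i j * P a j i (x b k l) = if b = a then x b k l else 0 := by
  classical
  simp only [hx.partial_apply]
  rw [Finset.sum_eq_single k, Finset.sum_eq_single l]
  · by_cases h : b = a
    · subst h
      by_cases hz : k.1 = Q.dtail b ∧ l.1 = Q.dhead b
      · simp [hz]
      · simp [hx.block b k l hz]
    · simp [h]
  · intro j _ hj
    simp [hj.symm]
  · simp
  · intro i _ hi
    simp [hi.symm]
  · simp

theorem scaleDer_apply (hx : IsQuiverCoordinates n Q x P) (a : E) (b : DArrow E)
    (k l : DimIdx n) : scaleDer x P a (x b k l) = DArrow.weight a b • x b k l := by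
  classical
  simp only [scaleDer, Derivation.sum_apply, Derivation.sub_apply, Derivation.smul_apply,
    smul_eq_mul, Finset.sum_sub_distrib, hx.euler_apply]
  unfold DArrow.weight
  cases b with
  | fwd b => by_cases h : b = a <;> simp [h, DArrow.base, DArrow.sign]
  | rev b => by_cases h : b = a <;> simp [h, DArrow.base, DArrow.sign]

variable {A : Type*} [Ring A] [Algebra ℂ A] {ρ : A →ₐ[ℂ] Matrix (DimIdx n) (DimIdx n) R}
  {ve : I → A} {ar : DArrow E → A} [Fintype E] [LinearOrder (DArrow E)] {γ : E → ℂ}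
  {D : A →ₗ[ℂ] A →ₗ[ℂ] A ⊗[ℂ] A}

theorem matrixBracket_entry (hx : IsQuiverCoordinates n Q x P)
    (hA : IsLocalizedPathAlgebra Q ve ar) (hve : ∀ s, ρ (ve s) = vertexProj n R s)
    (har : ∀ a, ρ (ar a) = x a) (hD : IsOuterDoubleBracket D) (hv : ∀ f s, D f (ve s) = 0)
    (ha : ∀ a b, D (ar a) (ar b) = edgeValue Q γ ve ar a b + fusionValue ve ar a b) (f g : A)
    (i j k l : DimIdx n) :
    matrixBracket DArrow.star DArrow.sign (momentMat γ x) P (fusDer x P) (ρ f i j) (ρ g k l) =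
      kronRep ρ (D f g) (k, i) (j, l) := by
  have hb := matrixBracket_isSkewBiderivation DArrow.star DArrow.sign (momentMat γ x) P
    (fusDer x P)
  refine hA.entryBracket_eq hD hv hb (fun y s i j => ?_) (fun a b i j k l => ?_) f g i j k l
  · rw [hve, ← hb.ham_apply, Derivation.map_vertexProj]
  · rw [ha, har, har, hx.matrixBracket_apply γ hve har]

/-- Here `K` plays the invariants and `σ` the group action. Equivariance lets the bracket and the
scaling fields restrict to `K`, and infinitesimal invariance (`hgl`) kills the Jacobiator. -/
theorem exists_bracket_of_invariant {K S : Type*} [CommRing K] [Algebra ℂ K] {φ : K →ₐ[ℂ] R}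
    (hφ : Function.Injective φ) (hx : IsQuiverCoordinates n Q x P)
    (hA : IsLocalizedPathAlgebra Q ve ar) (hve : ∀ s, ρ (ve s) = vertexProj n R s)
    (har : ∀ a, ρ (ar a) = x a) (hG : DeterminesDerivations {f | ∃ a i j, f = x a i j})
    (hD : IsOuterDoubleBracket D) (hv : ∀ f s, D f (ve s) = 0)
    (ha : ∀ a b, D (ar a) (ar b) = edgeValue Q γ ve ar a b + fusionValue ve ar a b)
    (hT : ∀ f g, triple D D f g = cartanTriple ve f g) {d : E → A →ₗ[ℂ] A}
    (hd : ∀ i, IsTwistedDer (AlgHom.id ℂ A) (AlgHom.id ℂ A) (d i))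
    (hd0 : ∀ i s, d i (ve s) = 0) (hda : ∀ i a, d i (ar a) = DArrow.weight i a • ar a)
    {σ : S → R ≃ₐ[ℂ] R} {w w' : S → Matrix (DimIdx n) (DimIdx n) ℂ}
    (hσ : ∀ s f i j, σ s (ρ f i j) = ∑ p, ∑ q, (w s i p * w' s q j) • ρ f p q)
    (hK : ∀ f, (∃ h, φ h = f) ↔ ∀ s, σ s f = f) (hgl : ∀ f v p q, glDer x P v p q (φ f) = 0)
    {τ : A → K} (hτ : ∀ f, φ (τ f) = Matrix.trace (ρ f)) :
    ∃ (b : K →ₗ[ℂ] K →ₗ[ℂ] K) (V : E → Derivation ℂ K K),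
      IsPoissonBracket b ∧ (∀ i, PreservesBracket (V i) b) ∧
      (∀ i j f, V i (V j f) = V j (V i f)) ∧
      (∀ f g, φ (b f g) = matrixBracket DArrow.star DArrow.sign (momentMat γ x) P (fusDer x P)
        (φ f) (φ g)) ∧
      (∀ i f, φ (V i f) = scaleDer x P i (φ f)) ∧
      (∀ f g, b (τ f) (τ g) = τ (LinearMap.mul' ℂ A (D f g))) ∧
      ∀ i f, V i (τ f) = τ (d i f) := by
  have hbD := hx.matrixBracket_entry hA hve har hD hv ha
  have hb := matrixBracket_isSkewBiderivation DArrow.star DArrow.sign (momentMat γ x) P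
    (fusDer x P)
  generalize matrixBracket DArrow.star DArrow.sign (momentMat γ x) P (fusDer x P) = b at hbD hb ⊢
  have hG' : DeterminesDerivations {f | ∃ a i j, f = ρ (ar a) i j} := by simpa only [har] using hG
  have hinv : ∀ f s, σ s (φ f) = φ f := fun f => (hK _).1 ⟨f, rfl⟩
  obtain ⟨b', hb', hval⟩ := exists_restrict_bracket hφ hb
    (fun f g => (hK _).2 fun s => by
      rw [map_entry_bracket hb hbD hG' (hσ s), hinv, hinv])
    (fun f g h => by
      refine Eq.trans ?_ (cartanDer_eq_zero (glDer x P) (f := φ f) (g := φ g) (hgl h))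
      rw [jacobiator_eq_cartanDer (Ξ := glDer x P) hb hD hT hA.idem hbD hG'
        (fun v p q a i j => by
          rw [map_mul, map_mul, hve, har, hx.glDer_apply])])
  have hU : ∀ i f k l, scaleDer x P i (ρ f k l) = ρ (d i f) k l := fun i =>
    derivation_entry hA (hd i) (hd0 i) (fun s k l => by rw [hve, Derivation.map_vertexProj])
      (fun a k l => by rw [hda, map_smul, har, hx.scaleDer_apply]; rfl)
  have hpres : ∀ i, PreservesBracket (scaleDer x P i) b := fun i =>
    preservesBracket_entries hb hbD hG' (hA.tensorDer_outer hD hv ha (hd i) (hd0 i) (hda i))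
      (hU i)
  have hcomm : ∀ i j f, scaleDer x P i (scaleDer x P j f) = scaleDer x P j (scaleDer x P i f) :=
    fun i j => hG.commute (by
      rintro _ ⟨a, k, l, rfl⟩
      simp only [hx.scaleDer_apply, Derivation.map_smul]
      rw [smul_comm])
  -- The action mixes only the entries of one and the same arrow, on which the scaling field is a
  -- constant. Hence the two commute.
  have hVK : ∀ i f, ∃ h, φ h = scaleDer x P i (φ f) := fun i f => (hK _).2 fun s => by
    rw [map_derivation_of_determines hG' (σ s), hinv]
    rintro _ ⟨a, k, l, rfl⟩
    rw [hU, hσ, hσ, hda]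
    simp only [map_sum, Derivation.map_smul, hU, hda]
  choose V hV using fun i => exists_restrict_derivation hφ (hVK i)
  refine ⟨b', V, hb', fun i f g => hφ ?_, fun i j f => hφ ?_, hval, hV, fun f g => hφ ?_,
    fun i f => hφ ?_⟩
  · rw [map_add, hV, hval, hval, hval, hV, hV, hpres]
  · rw [hV, hV, hV, hV, hcomm]
  · rw [hval, hτ, hτ, hτ, bracket_trace hbD]
  · rw [hV, hτ, hτ]
    simp only [Matrix.trace, Matrix.diag_apply, map_sum, hU]

end IsQuiverCoordinates

/-! ### The action on regular functions -/

section ActionOnFunctions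

variable {I E : Type*} [Fintype I] [DecidableEq I] {n : I → ℕ} {Q : FinQuiver I E} {γ : E → ℂ}

theorem act_inv_act (g : ∀ s, GL (Fin (n s)) ℂ) (X : repSpace n Q γ) : act g⁻¹ (act g X) = X := by
  refine Subtype.ext (funext fun a => ?_)
  change glMat n g⁻¹ * (glMat n g * X.1 a * glMat n g⁻¹) * glMat n g⁻¹⁻¹ = X.1 a
  rw [mul_assoc (glMat n g), ← mul_assoc, glMat_inv_mul, one_mul, mul_assoc, glMat_mul_inv, mul_one]

theorem act_act_inv (g : ∀ s, GL (Fin (n s)) ℂ) (X : repSpace n Q γ) : act g (act g⁻¹ X) = X := by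
  simpa using act_inv_act g⁻¹ X

theorem glMat_conj_apply (g : ∀ s, GL (Fin (n s)) ℂ) (M : Matrix (DimIdx n) (DimIdx n) ℂ)
    (i j : DimIdx n) : (glMat n g * M * glMat n g⁻¹) i j =
      ∑ p, ∑ q, (glMat n g i p * glMat n g⁻¹ q j) * M p q := by
  simp only [Matrix.mul_apply, Finset.sum_mul]
  rw [Finset.sum_comm]
  refine Finset.sum_congr rfl fun p _ => Finset.sum_congr rfl fun q _ => ?_
  ring

/-- The action is linear on coordinates and leaves the determinants unchanged. -/
theorem comp_act_mem (g : ∀ s, GL (Fin (n s)) ℂ) (f : coordRing n Q γ) :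
    (fun X => f.1 (act g X)) ∈ coordRing n Q γ := by
  let Φ : (repSpace n Q γ → ℂ) →ₐ[ℂ] repSpace n Q γ → ℂ :=
    AlgHom.pi fun X => Pi.evalAlgHom ℂ (fun _ => ℂ) (act g X)
  suffices h : coordRing n Q γ ≤ (coordRing n Q γ).comap Φ from h f.2
  refine Algebra.adjoin_le ?_
  rintro _ (⟨a, i, j, rfl⟩ | ⟨a, rfl⟩)
  · have h : Φ (fun X => X.1 a i j) =
        (∑ p, ∑ q, (glMat n g i p * glMat n g⁻¹ q j) • univMat n Q γ a p q :
          coordRing n Q γ).1 := by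
      funext X
      change (glMat n g * X.1 a * glMat n g⁻¹) i j = evalAt n Q γ X _
      simp only [map_sum, map_smul, glMat_conj_apply]
      rfl
    change Φ _ ∈ coordRing n Q γ
    rw [h]
    exact Subtype.property _
  · have h : Φ (fun X => ((locMat n Q γ X.1 a).det)⁻¹) =
        fun X => ((locMat n Q γ X.1 a).det)⁻¹ := by
      funext X
      change ((locMat n Q γ (conjAll g X.1) a).det)⁻¹ = _
      rw [locMat_conjAll, Matrix.det_mul, Matrix.det_mul, mul_right_comm, ← Matrix.det_mul,
        glMat_mul_inv, Matrix.det_one, one_mul]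
    change Φ _ ∈ coordRing n Q γ
    rw [h]
    exact Algebra.subset_adjoin (Or.inr ⟨a, rfl⟩)

/-- The automorphism of `ℂ[M^γ]` given by the action of `g`. -/
noncomputable def actEquiv (g : ∀ s, GL (Fin (n s)) ℂ) : coordRing n Q γ ≃ₐ[ℂ] coordRing n Q γ where
  toFun f := ⟨fun X => f.1 (act g X), comp_act_mem g f⟩
  invFun f := ⟨fun X => f.1 (act g⁻¹ X), comp_act_mem g⁻¹ f⟩
  left_inv f := Subtype.ext (funext fun X => congrArg f.1 (act_act_inv g X))
  right_inv f := Subtype.ext (funext fun X => congrArg f.1 (act_inv_act g X))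
  map_mul' _ _ := rfl
  map_add' _ _ := rfl
  commutes' _ := rfl

theorem actEquiv_univRep (g : ∀ s, GL (Fin (n s)) ℂ) (f : AQ Q γ) (i j : DimIdx n) :
    actEquiv g (univRep n Q γ f i j) =
      ∑ p, ∑ q, (glMat n g i p * glMat n g⁻¹ q j) • univRep n Q γ f p q := by
  refine evalAt_ext fun X => ?_
  have h := congrFun (congrFun (univRep_act n Q γ g X f) i) j
  rw [glMat_conj_apply] at h
  simp only [map_sum, map_smul]
  exact h

end ActionOnFunctions

/-! ### The Poisson bracket on invariant functions -/

section InvariantBracket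

variable {I E : Type*} [Fintype I] [DecidableEq I] {n : I → ℕ} {Q : FinQuiver I E} {γ : E → ℂ}

variable (n Q γ) in
/-- The inclusion of the invariant functions. -/
noncomputable def invIncl : invRing n Q γ →ₐ[ℂ] coordRing n Q γ :=
  Subalgebra.inclusion fun _ h => h.1

theorem exists_invIncl_eq_iff (f : coordRing n Q γ) :
    (∃ h, invIncl n Q γ h = f) ↔ ∀ g, actEquiv g f = f := by
  refine ⟨?_, fun h => ⟨⟨f.1, f.2, fun g X => ?_⟩, rfl⟩⟩
  · rintro ⟨h, rfl⟩ g
    exact Subtype.ext (funext fun X => h.2.2 g X)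
  · exact congrFun (congrArg Subtype.val (h g)) X

theorem evalAt_partialDer [Fintype E] (X : repSpace n Q γ) (a : DArrow E) (i j : DimIdx n)
    (f : coordRing n Q γ) : evalAt n Q γ X (partialDer a i j f) = pder n Q γ a i j f.1 X := rfl

theorem evalAt_fusDer [Fintype E] (X : repSpace n Q γ) (a : DArrow E) (i j : DimIdx n)
    (f : coordRing n Q γ) : evalAt n Q γ X (fusDer (univMat n Q γ) partialDer a i j f) =
      fusField n Q γ a i j f.1 X := by
  rw [fusDer, Derivation.sum_apply, map_sum]
  rfl

theorem evalAt_scaleDer [Fintype E] (X : repSpace n Q γ) (a : E)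
    (f : coordRing n Q γ) : evalAt n Q γ X (scaleDer (univMat n Q γ) partialDer a f) =
      scaleField n Q γ (.fwd a) f.1 X := by
  simp only [scaleDer, Derivation.sum_apply, map_sum]
  rfl

theorem evalAt_momentMat (X : repSpace n Q γ) (a : DArrow E) (i j : DimIdx n) :
    evalAt n Q γ X (momentMat γ (univMat n Q γ) a i j) =
      (γ a.base • (1 : Matrix (DimIdx n) (DimIdx n) ℂ) + X.1 a.star * X.1 a) i j := by
  have h : (evalAt n Q γ X).mapMatrix (momentMat γ (univMat n Q γ) a) =
      γ a.base • (1 : Matrix (DimIdx n) (DimIdx n) ℂ) + X.1 a.star * X.1 a := by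
    simp only [momentMat, map_add, map_smul, map_one, map_mul, map_univMat]
  exact congrFun (congrFun h i) j

theorem evalAt_matrixBracket [Fintype E] [LinearOrder (DArrow E)] (X : repSpace n Q γ)
    (f g : coordRing n Q γ) :
    evalAt n Q γ X (matrixBracket DArrow.star DArrow.sign (momentMat γ (univMat n Q γ)) partialDer
      (fusDer (univMat n Q γ) partialDer) f g) = quasiPoisson n Q γ f.1 g.1 X := by
  have hite : ∀ (p : Prop) [Decidable p] (x : coordRing n Q γ),
      evalAt n Q γ X (if p then x else 0) = if p then evalAt n Q γ X x else 0 := fun p _ x => by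
    split_ifs
    exacts [rfl, map_zero _]
  rw [matrixBracket_apply]
  simp only [map_sub, map_smul, map_sum, map_mul, hite, evalAt_partialDer, evalAt_fusDer,
    evalAt_momentMat, smul_eq_mul]
  rfl

end InvariantBracket

theorem exists_invariant_bracket {I E : Type*} [Fintype I] [DecidableEq I] [Fintype E]
    {Q : FinQuiver I E} [LinearOrder (DArrow E)] {γ : E → ℂ}
    {D : AQ Q γ →ₗ[ℂ] AQ Q γ →ₗ[ℂ] AQ Q γ ⊗[ℂ] AQ Q γ} (hD : IsOuterDoubleBracket D)
    (hv : ∀ f s, D f (AQ.e Q γ s) = 0)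
    (ha : ∀ a b, D (AQ.arr Q γ a) (AQ.arr Q γ b) =
      edgeValue Q γ (AQ.e Q γ) (AQ.arr Q γ) a b + fusionValue (AQ.e Q γ) (AQ.arr Q γ) a b)
    (hT : ∀ f g, triple D D f g = cartanTriple (AQ.e Q γ) f g)
    {d : E → AQ Q γ →ₗ[ℂ] AQ Q γ}
    (hd : ∀ i, IsTwistedDer (AlgHom.id ℂ (AQ Q γ)) (AlgHom.id ℂ (AQ Q γ)) (d i))
    (hd0 : ∀ i s, d i (AQ.e Q γ s) = 0)
    (hda : ∀ i a, d i (AQ.arr Q γ a) = DArrow.weight i a • AQ.arr Q γ a) (n : I → ℕ) :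
    ∃ (b : invRing n Q γ →ₗ[ℂ] invRing n Q γ →ₗ[ℂ] invRing n Q γ)
      (S : E → Derivation ℂ (invRing n Q γ) (invRing n Q γ)),
      IsPoissonBracket b ∧ (∀ i, PreservesBracket (S i) b) ∧
      (∀ i j f, S i (S j f) = S j (S i f)) ∧
      (∀ (f g : invRing n Q γ) (X : repSpace n Q γ),
        (b f g : repSpace n Q γ → ℂ) X = quasiPoisson n Q γ f g X) ∧
      (∀ i (f : invRing n Q γ) (X : repSpace n Q γ),
        (S i f : repSpace n Q γ → ℂ) X = scaleField n Q γ (.fwd i) f X) ∧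
      (∀ f g, b (traceFun n Q γ f) (traceFun n Q γ g) =
        traceFun n Q γ (LinearMap.mul' ℂ (AQ Q γ) (D f g))) ∧
      ∀ i f, S i (traceFun n Q γ f) = traceFun n Q γ (d i f) := by
  obtain ⟨b, V, h1, h2, h3, h4, h5, h6, h7⟩ :=
    (isQuiverCoordinates_univMat (n := n) (Q := Q) (γ := γ)).exists_bracket_of_invariant
      (φ := invIncl n Q γ) (ρ := univRep n Q γ) (σ := actEquiv) (w := glMat n)
      (w' := fun g => glMat n g⁻¹) (τ := traceFun n Q γ) (Subalgebra.inclusion_injective _)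
      (AQ.isLocalizedPathAlgebra Q γ) univRep_vert (univRep_arr n Q γ)
      determinesDerivations_univMat hD hv ha hT hd hd0 hda actEquiv_univRep exists_invIncl_eq_iff
      (fun f => glDer_eq_zero f.2.2) (fun f => rfl)
  refine ⟨b, V, h1, h2, h3, fun f g X => ?_, fun i f X => ?_, h6, h7⟩
  · exact (congrArg (evalAt n Q γ X) (h4 f g)).trans (evalAt_matrixBracket X _ _)
  · exact (congrArg (evalAt n Q γ X) (h5 i f)).trans (evalAt_scaleDer X i _)

/-! ### Compatibility of the trace map and the main theorem -/

section Morphism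

/-- An algebra morphism intertwines biderivations if it does so on generators. -/
theorem SymmetricAlgebra.map_bracket {V R : Type*} [AddCommGroup V] [Module ℂ V] [CommRing R]
    [Algebra ℂ R] (φ : SymmetricAlgebra ℂ V →ₐ[ℂ] R)
    {b : SymmetricAlgebra ℂ V →ₗ[ℂ] SymmetricAlgebra ℂ V →ₗ[ℂ] SymmetricAlgebra ℂ V}
    {b' : R →ₗ[ℂ] R →ₗ[ℂ] R} (hb : IsSkewBiderivation b) (hb' : IsSkewBiderivation b')
    (h : ∀ v w, φ (b (ι ℂ V v) (ι ℂ V w)) = b' (φ (ι ℂ V v)) (φ (ι ℂ V w)))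
    (F G : SymmetricAlgebra ℂ V) : φ (b F G) = b' (φ F) (φ G) := by
  have key : ∀ F : SymmetricAlgebra ℂ V, (∀ v, φ (b F (ι ℂ V v)) = b' (φ F) (φ (ι ℂ V v))) →
      ∀ G, φ (b F G) = b' (φ F) (φ G) := fun F hF G => by
    induction G using SymmetricAlgebra.induction with
    | algebraMap r =>
      rw [AlgHom.commutes, ← hb.ham_apply, ← hb'.ham_apply, Derivation.map_algebraMap,
        Derivation.map_algebraMap, map_zero]
    | ι v => exact hF v
    | mul x y hx hy => simp only [hb.leibniz, map_add, map_mul, hx, hy, hb'.leibniz]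
    | add x y hx hy => simp only [map_add, hx, hy]
  refine key F (fun v => ?_) G
  rw [hb.skew, hb'.skew, map_neg, key _ (h v)]

end Morphism

theorem traceMap_symTr {I E : Type*} [Fintype I] [DecidableEq I] {n : I → ℕ}
    {Q : FinQuiver I E} {γ : E → ℂ} (f : AQ Q γ) :
    traceMap n Q γ (symTr f) = traceFun n Q γ f := by
  simp only [traceMap, symTr, LinearMap.comp_apply, SymmetricAlgebra.lift_ι_apply]
  exact Submodule.liftQ_apply _ _ _

theorem theorem4p4 {I E : Type*} [Fintype I] [DecidableEq I] [Fintype E]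
    (Q : FinQuiver I E) [LinearOrder (DArrow E)] (γ : E → ℂ) :
    ∃ (dblO : AQ Q γ →ₗ[ℂ] AQ Q γ →ₗ[ℂ] AQ Q γ ⊗[ℂ] AQ Q γ)
      (brO : SymmetricAlgebra ℂ (HZero (AQ Q γ)) →ₗ[ℂ] SymmetricAlgebra ℂ (HZero (AQ Q γ)) →ₗ[ℂ]
        SymmetricAlgebra ℂ (HZero (AQ Q γ))),
      (IsVdBOuter Q γ dblO ∧ ∀ D, IsVdBOuter Q γ D → D = dblO) ∧
      (IsPoissonBracket brO ∧ IsInducedByOuter dblO brO ∧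
        ∀ b, IsPoissonBracket b → IsInducedByOuter dblO b → b = brO) ∧
      ∀ z : E → E → ℂ,
        ∃ (dblR : AQ Q γ →ₗ[ℂ] AQ Q γ →ₗ[ℂ] AQ Q γ ⊗[ℂ] AQ Q γ)
          (brZ : SymmetricAlgebra ℂ (HZero (AQ Q γ)) →ₗ[ℂ]
            SymmetricAlgebra ℂ (HZero (AQ Q γ)) →ₗ[ℂ] SymmetricAlgebra ℂ (HZero (AQ Q γ))),
          (IsQuiverRight Q γ z dblR ∧ ∀ D, IsQuiverRight Q γ z D → D = dblR) ∧
          (IsPoissonBracket brZ ∧ IsInducedByRight dblR brZ ∧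
            ∀ b, IsPoissonBracket b → IsInducedByRight dblR b → b = brZ) ∧
          ∀ z₀ : ℂ,
            IsPoissonBracket (z₀ • brO + brZ) ∧
            ∀ n : I → ℕ,
              ∃ brM : invRing n Q γ →ₗ[ℂ] invRing n Q γ →ₗ[ℂ] invRing n Q γ,
                IsPoissonBracket brM ∧
                (∀ (f g : invRing n Q γ) (X : repSpace n Q γ),
                  (brM f g : repSpace n Q γ → ℂ) X =
                    z₀ * quasiPoisson n Q γ f g X + scaleBivector n Q γ z f g X) ∧
                ∀ F G, traceMap n Q γ ((z₀ • brO + brZ) F G) =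
                  brM (traceMap n Q γ F) (traceMap n Q γ G) := by
  have hA := AQ.isLocalizedPathAlgebra Q γ
  obtain ⟨D, hD, hv, ha, hT⟩ := hA.exists_quasiPoisson_bracket γ
  obtain ⟨brO, hbrO, hindO⟩ := exists_inducedByOuter hD fun f g h => by
    rw [hT, mul3_cartanTriple]
  choose d hd hd0 hda using hA.exists_scaling
  choose U hU using fun i => exists_symDerivation (hd i)
  -- On traces this is the invariance of `D` under `d i`, pushed through the multiplication.
  have hUb : ∀ i, PreservesBracket (U i) brO := fun i =>
    preservesBracket_of_determines determinesDerivations_symTr hbrO.isSkewBiderivation <| by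
      rintro _ ⟨f, rfl⟩ _ ⟨g, rfl⟩
      rw [hindO, hU, hU, hU, hindO, hindO, ← map_add, ← map_add,
        ← hA.tensorDer_outer hD hv ha (hd i) (hd0 i) (hda i), mul'_tensorDer (hd i)]
  have hdd : ∀ i j f, d i (d j f) = d j (d i f) := fun i j =>
    hA.scaling_commute (hd i) (hd j) (hd0 i) (hd0 j) (hda i) (hda j)
  have hUc : ∀ i j F, U i (U j F) = U j (U i F) := fun i j =>
    determinesDerivations_symTr.commute <| by
      rintro _ ⟨f, rfl⟩
      simp only [hU, hdd]
  have hvO : IsVdBOuter Q γ D := ⟨hD, hv, fun a b => by rw [ha, outerValue_eq]⟩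
  refine ⟨D, brO, ⟨hvO, fun D' hD' => hA.outer_ext hD'.outer hD hD'.vert hv fun a b => by
    rw [hD'.value, hvO.value]⟩, ⟨hbrO, hindO, fun b hb h => inducedByOuter_unique hb hbrO h hindO⟩,
    fun z => ?_⟩
  have hR : IsQuiverRight Q γ z (rightWedge (DArrow.upper z) d) :=
    ⟨rightWedge_isRightDoubleBracket _ hd, fun f s => by
      simp [rightWedge_apply, hd0], rightWedge_arrow z hda⟩
  have hZ : IsPoissonBracket (wedgeSum (DArrow.upper z) U) := by
    -- The bracket for `z` alone is a deformation of the zero bracket.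
    have h := isPoissonBracket_zero.add_wedgeSum (DArrow.upper z) U
      (fun i f g => by simp) hUc
    rwa [zero_add] at h
  have hindZ := wedgeSum_inducedByRight (DArrow.upper z) d U hU
  refine ⟨_, _, ⟨hR, fun D' hD' => hA.right_ext hD'.right hR.right hD'.vert hR.vert fun a b => by
    rw [hD'.value, hR.value]⟩, ⟨hZ, hindZ, fun b hb h => inducedByRight_unique hb hZ h hindZ⟩,
    fun z₀ => ?_⟩
  have hsum := (hbrO.smul z₀).add_wedgeSum (DArrow.upper z) U (fun i => (hUb i).smul z₀) hUc
  refine ⟨hsum, fun n => ?_⟩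
  obtain ⟨b, S, hb, hSb, hSc, hbv, hSv, hbt, hSt⟩ :=
    exists_invariant_bracket hD hv ha hT hd hd0 hda n
  have hsum' := (hb.smul z₀).add_wedgeSum (DArrow.upper z) S (fun i => (hSb i).smul z₀) hSc
  refine ⟨_, hsum', fun f g X => ?_, ?_⟩
  · have h1 : (((z₀ • b + wedgeSum (DArrow.upper z) S) f g : invRing n Q γ) :
        repSpace n Q γ → ℂ) X = z₀ * (b f g : repSpace n Q γ → ℂ) X +
          ∑ i, ∑ j, DArrow.upper z i j * ((S i f : repSpace n Q γ → ℂ) X *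
            (S j g : repSpace n Q γ → ℂ) X - (S j f : repSpace n Q γ → ℂ) X *
            (S i g : repSpace n Q γ → ℂ) X) := by
      rw [LinearMap.add_apply, LinearMap.add_apply, wedgeSum_apply]
      simp
    rw [h1, hbv]
    simp only [hSv]
    congr 1
    unfold scaleBivector
    refine Finset.sum_congr rfl fun i _ => Finset.sum_congr rfl fun j _ => ?_
    unfold DArrow.upper wedge
    split_ifs
    · simp
    · simp
  -- On two traces both sides reduce to the same formula in `D` and the `d i`.
  · refine SymmetricAlgebra.map_bracket _ hsum.isSkewBiderivation hsum'.isSkewBiderivation ?_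
    intro v w
    obtain ⟨f, rfl⟩ := (commutatorSpan (AQ Q γ)).mkQ_surjective v
    obtain ⟨g, rfl⟩ := (commutatorSpan (AQ Q γ)).mkQ_surjective w
    rw [← symTr_apply, ← symTr_apply]
    simp only [LinearMap.add_apply, LinearMap.smul_apply, hindO f g, wedgeSum_apply, hU, map_add,
      map_smul, map_sum, map_sub, map_mul, traceMap_symTr, hbt, hSt]
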